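/- Let $n\ge 4$ and $2\le r\le n-2$, let $\Bbbk=\mathbb{Q}(q)$ with $q$ an indeterminate, $[k]=\frac{q^k-q^{-k}}{q-q^{-1}}$, and $I=\{0,1,\dots,n-1\}$, subscripts being read modulo $n$. Let $P=\mathbb{Z}\Lambda_r\oplus\bigoplus_{i=1}^n\mathbb{Z}\delta_i$ and $P^\vee=\mathrm{Hom}_{\mathbb Z}(P,\mathbb{Z})$ with dual basis $c,\delta_1^\vee,\dots,\delta_n^\vee$; put $\alpha_i=\delta_i-\delta_{i+1}$ and $\alpha_i^\vee=\delta_i^\vee-\delta_{i+1}^\vee+(\delta_{ir}-\delta_{i0})c$ for $i\in I$, where $\delta_{ir},\delta_{i0}$ are Kronecker deltas. Let $U_q(\widehat{\mathfrak{gl}}_n)$ be the associative $\Bbbk$-algebra with generators $q^h,e_i,f_i$ ($h\in P^\vee$, $i\in I$) and relations $q^0=1$, $q^{h+h'}=q^hq^{h'}$, $q^he_iq^{-h}=q^{\langle\alpha_i,h\rangle}e_i$, $q^hf_iq^{-h}=q^{-\langle\alpha_i,h\rangle}f_i$, $e_if_j-f_je_i=\delta_{ij}\frac{k_i-k_i^{-1}}{q-q^{-1}}$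 with $k_i=q^{\alpha_i^\vee}$, $e_ie_j=e_je_i$ and $f_if_j=f_jf_i$ if $i-j\not\equiv\pm1 \pmod n$, and $e_i^2e_j-[2]e_ie_je_i+e_je_i^2=0=f_i^2f_j-[2]f_if_jf_i+f_jf_i^2$ if $i-j\equiv\pm1\pmod n$. Tensor products of modules are formed with the comultiplication $\Delta(q^h)=q^h\otimes q^h$, $\Delta(e_i)=1\otimes e_i+e_i\otimes k_i^{-1}$, $\Delta(f_i)=f_i\otimes1+k_i\otimes f_i$. Let $U_q(\mathfrak{gl}_n)$ be the subalgebra generated by all $q^h$ and by $e_i,f_i$ for $i\neq0$. Let $\mathcal W=\bigoplus_{\mathbf m\in\mathbb{Z}_{\ge0}^n}\Bbbk|\mathbf m\rangle$ be the $U_q(\widehat{\mathfrak{gl}}_n)$-module on which $q^c$ acts by $q^{-1}$, $q^{\delta_i^\vee}|\mathbf m\rangle=q^{-m_i}|\mathbf m\rangle$ for $i\le r$, $q^{\delta_j^\vee}|\mathbf m\rangle=q^{m_j}|\mathbf m\rangle$ for $j>r$, and (with $\mathbf e_i$ the standard basis vectors and $|\mathbf m'\rangle=0$ if $\mathbf m'\notin\mathbb{Z}_{\ge0}^n$)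 $$e_0|\mathbf m\rangle=|\mathbf m+\mathbf e_1+\mathbf e_n\rangle,\qquad f_0|\mathbf m\rangle=-[m_1][m_n]\,|\mathbf m-\mathbf e_1-\mathbf e_n\rangle,$$ $$e_r|\mathbf m\rangle=-[m_r][m_{r+1}]\,|\mathbf m-\mathbf e_r-\mathbf e_{r+1}\rangle,\qquad f_r|\mathbf m\rangle=|\mathbf m+\mathbf e_r+\mathbf e_{r+1}\rangle,$$ $$e_i|\mathbf m\rangle=[m_i]\,|\mathbf m-\mathbf e_i+\mathbf e_{i+1}\rangle,\qquad f_i|\mathbf m\rangle=[m_{i+1}]\,|\mathbf m+\mathbf e_i-\mathbf e_{i+1}\rangle\qquad(1\le i<r),$$ $$e_j|\mathbf m\rangle=[m_{j+1}]\,|\mathbf m+\mathbf e_j-\mathbf e_{j+1}\rangle,\qquad f_j|\mathbf m\rangle=[m_j]\,|\mathbf m-\mathbf e_j+\mathbf e_{j+1}\rangle\qquad(r<j\le n-1).$$ For $l\in\mathbb{Z}$ let $\mathcal W_l\subseteq\mathcal W$ be the submodule spanned by the $|\mathbf m\rangle$ with $(m_{r+1}+\dots+m_n)-(m_1+\dots+m_r)=l$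 (the $l$-th fundamental $q$-oscillator representation). Let $P_{\rm fin}=P/\mathbb{Z}(\Lambda_r-\delta_1-\dots-\delta_r)$, with dual lattice $P_{\rm fin}^\vee\subset P^\vee$ spanned by $\delta_i^\vee+c$ ($i\le r$) and $\delta_j^\vee$ ($j>r$). For $\mu$ in $P$ (in $P_{\rm fin}$), let $V_\mu$ be the space of all $v\in V$ with $q^hv=q^{\langle\mu,h\rangle}v$ for all $h\in P^\vee$ (all $h\in P_{\rm fin}^\vee$). A set of weights is finitely dominated if there are finitely many $\gamma_1,\dots,\gamma_k$ such that each of its elements lies in $\gamma_s-\sum_{i\in I\setminus\{0\}}\mathbb{Z}_{\ge0}\alpha_i$ for some $s$. For integers $\lambda=(\lambda_1\ge\dots\ge\lambda_\ell)$ with at most $r$ negative and at most $n-r$ positive parts, let $\mathcal V^\lambda$ be the irreducible highest weight $U_q(\mathfrak{gl}_n)$-module of highest weight $-\ell\Lambda_r+\sum_{\lambda_i>0}\lambda_i\delta_{r+i}+\sum_{\lambda_j<0}\lambda_j\delta_{r-\ell+j}$. Let $\mathcal O_{\rm osc}$ be the category of $U_q(\mathfrak{gl}_n)$-modules $V$ such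 that (1) $V=\bigoplus_{\mu\in P_{\rm fin}}V_\mu$ with all $V_\mu$ finite-dimensional and with finitely dominated set of weights; (2) $V=\bigoplus_{\ell\ge1}V_\ell$, where $V_\ell$ is a direct sum of modules $\mathcal V^\lambda$ with $\lambda$ of length $\ell$ as above, each occurring with finite multiplicity, and $V_\ell=0$ for all large $\ell$. Let $\widehat{\mathcal O}_{\rm osc}$ be the category of $U_q(\widehat{\mathfrak{gl}}_n)$-modules $V$ such that $V=\bigoplus_{\mu\in P}V_\mu$ with all $V_\mu$ finite-dimensional and with finitely dominated set of weights, and such that the restriction of $V$ to $U_q(\mathfrak{gl}_n)$ lies in $\mathcal O_{\rm osc}$. **Theorem.** For all $l,m\in\mathbb{Z}$, the tensor product $\mathcal W_l\otimes\mathcal W_m$ is an irreducible $U_q(\widehat{\mathfrak{gl}}_n)$-module, and it belongs to $\widehat{\mathcal O}_{\rm osc}$. -/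

import Mathlib

noncomputable section

open scoped TensorProduct

namespace QOsc

/-! ## The ground field -/

/-- The ground field, the rational functions in one variable over the rational numbers. -/
def GF : Type := RatFunc ℚ

instance : Field GF := inferInstanceAs (Field (RatFunc ℚ))

/-- The indeterminate `q`. -/
def q : GF := (RatFunc.X : RatFunc ℚ)

/-- The quantum integer `[m] = (q^m - q^{-m}) / (q - q^{-1})`. -/
def qInt (m : ℕ) : GF := (q ^ m - q⁻¹ ^ m) / (q - q⁻¹)

/-! ## Weight lattices

The index set `I = {0, 1, …, n-1}` is `ZMod n`; subscripts are read modulo `n`, and in particular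
`δ_n` is the basis vector with index `0`. -/

/-- The lattice `P = ℤ Λ_r ⊕ ℤ δ_1 ⊕ ⋯ ⊕ ℤ δ_n`: the first component is the coefficient of `Λ_r`,
the second one lists the coefficients of the `δ_i`. -/
abbrev Wt (n : ℕ) : Type := ℤ × (ZMod n → ℤ)

/-- The dual lattice `P^∨ = Hom_ℤ(P, ℤ)`; the pairing is evaluation. -/
abbrev CoWt (n : ℕ) : Type := Module.Dual ℤ (Wt n)

variable {n : ℕ}

/-- `Λ_r`. -/
def LambdaR : Wt n := (1, 0)

/-- `δ_i`. -/
def delta (i : ZMod n) : Wt n := (0, Pi.single i 1)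

/-- `c`. -/
def cVee : CoWt n := LinearMap.fst ℤ ℤ (ZMod n → ℤ)

/-- `δ_i^∨`. -/
def deltaVee (i : ZMod n) : CoWt n :=
  (LinearMap.proj (R := ℤ) (φ := fun _ : ZMod n => ℤ) i).comp (LinearMap.snd ℤ ℤ (ZMod n → ℤ))

/-- The simple root `α_i = δ_i - δ_{i+1}`. -/
def alpha (i : ZMod n) : Wt n := delta i - delta (i + 1)

/-- The simple coroot `α_i^∨ = δ_i^∨ - δ_{i+1}^∨ + (δ_{ir} - δ_{i0}) c`. -/
def alphaVee (r : ℕ) (i : ZMod n) : CoWt n :=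
  deltaVee i - deltaVee (i + 1)
    + ((if i = (r : ZMod n) then (1 : ℤ) else 0) - (if i = 0 then (1 : ℤ) else 0)) • cVee

/-- `i ≡ j ± 1` modulo `n`. -/
def Neighbours (i j : ZMod n) : Prop := i - j = 1 ∨ i - j = -1

/-! ## The quantum affine algebra -/

/-- The generators `q^h`, `e_i`, `f_i`. -/
inductive Gen (n : ℕ) : Type
  | qh (h : CoWt n) : Gen n
  | e (i : ZMod n) : Gen n
  | f (i : ZMod n) : Gen n

/-- The generator `q^h` of the free algebra. -/
def K0 (h : CoWt n) : FreeAlgebra GF (Gen n) := FreeAlgebra.ι GF (Gen.qh h)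
/-- The generator `e_i` of the free algebra. -/
def E0 (i : ZMod n) : FreeAlgebra GF (Gen n) := FreeAlgebra.ι GF (Gen.e i)
/-- The generator `f_i` of the free algebra. -/
def F0 (i : ZMod n) : FreeAlgebra GF (Gen n) := FreeAlgebra.ι GF (Gen.f i)

/-- The defining relations of the quantum affine algebra of `gl_n`. -/
inductive Rel (n r : ℕ) : FreeAlgebra GF (Gen n) → FreeAlgebra GF (Gen n) → Prop
  | qh_zero : Rel n r (K0 0) 1
  | qh_add (h h' : CoWt n) : Rel n r (K0 (h + h')) (K0 h * K0 h')
  | qh_e (h : CoWt n) (i : ZMod n) :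
      Rel n r (K0 h * E0 i * K0 (-h)) (q ^ (h (alpha i)) • E0 i)
  | qh_f (h : CoWt n) (i : ZMod n) :
      Rel n r (K0 h * F0 i * K0 (-h)) (q ^ (-(h (alpha i))) • F0 i)
  | e_f_same (i : ZMod n) :
      Rel n r (E0 i * F0 i - F0 i * E0 i)
        ((q - q⁻¹)⁻¹ • (K0 (alphaVee r i) - K0 (-(alphaVee r i))))
  | e_f_ne (i j : ZMod n) (hij : i ≠ j) : Rel n r (E0 i * F0 j - F0 j * E0 i) 0
  | e_comm (i j : ZMod n) (hij : ¬ Neighbours i j) : Rel n r (E0 i * E0 j - E0 j * E0 i) 0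
  | f_comm (i j : ZMod n) (hij : ¬ Neighbours i j) : Rel n r (F0 i * F0 j - F0 j * F0 i) 0
  | e_serre (i j : ZMod n) (hij : Neighbours i j) :
      Rel n r (E0 i ^ 2 * E0 j - qInt 2 • (E0 i * E0 j * E0 i) + E0 j * E0 i ^ 2) 0
  | f_serre (i j : ZMod n) (hij : Neighbours i j) :
      Rel n r (F0 i ^ 2 * F0 j - qInt 2 • (F0 i * F0 j * F0 i) + F0 j * F0 i ^ 2) 0

/-- The quantum affine algebra `U_q(\hat{gl}_n)` by generators and relations. -/
def Uq (n r : ℕ) : Type := RingQuot (Rel n r)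

instance (n r : ℕ) : Ring (Uq n r) := inferInstanceAs (Ring (RingQuot (Rel n r)))
instance (n r : ℕ) : Algebra GF (Uq n r) := inferInstanceAs (Algebra GF (RingQuot (Rel n r)))

variable {r : ℕ}

/-- The projection from the free algebra. -/
def Uq.mk (n r : ℕ) : FreeAlgebra GF (Gen n) →ₐ[GF] Uq n r := RingQuot.mkAlgHom GF (Rel n r)

/-- The element `q^h`. -/
def Uq.K (r : ℕ) (h : CoWt n) : Uq n r := Uq.mk n r (K0 h)
/-- The element `e_i`. -/
def Uq.E (r : ℕ) (i : ZMod n) : Uq n r := Uq.mk n r (E0 i)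
/-- The element `f_i`. -/
def Uq.F (r : ℕ) (i : ZMod n) : Uq n r := Uq.mk n r (F0 i)

/-- Elements of an algebra that satisfy the defining relations. -/
structure Relations (r : ℕ) {A : Type*} [Ring A] [Algebra GF A]
    (K : CoWt n → A) (E F : ZMod n → A) : Prop where
  qh_zero : K 0 = 1
  qh_add : ∀ h h', K (h + h') = K h * K h'
  qh_e : ∀ h i, K h * E i * K (-h) = q ^ (h (alpha i)) • E i
  qh_f : ∀ h i, K h * F i * K (-h) = q ^ (-(h (alpha i))) • F i
  e_f_same : ∀ i, E i * F i - F i * E i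
    = (q - q⁻¹)⁻¹ • (K (alphaVee r i) - K (-(alphaVee r i)))
  e_f_ne : ∀ i j, i ≠ j → E i * F j - F j * E i = 0
  e_comm : ∀ i j, ¬ Neighbours i j → E i * E j - E j * E i = 0
  f_comm : ∀ i j, ¬ Neighbours i j → F i * F j - F j * F i = 0
  e_serre : ∀ i j, Neighbours i j →
    E i ^ 2 * E j - qInt 2 • (E i * E j * E i) + E j * E i ^ 2 = 0
  f_serre : ∀ i j, Neighbours i j →
    F i ^ 2 * F j - qInt 2 • (F i * F j * F i) + F j * F i ^ 2 = 0

theorem Uq.rel {x y : FreeAlgebra GF (Gen n)} (h : Rel n r x y) : Uq.mk n r x = Uq.mk n r y :=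
  RingQuot.mkAlgHom_rel GF h

theorem Uq.relations (n r : ℕ) : Relations (n := n) r (Uq.K r) (Uq.E r) (Uq.F r) where
  qh_zero := by simpa [Uq.K, Uq.E, Uq.F] using Uq.rel (r := r) (Rel.qh_zero (n := n))
  qh_add h h' := by simpa [Uq.K, Uq.E, Uq.F] using Uq.rel (r := r) (Rel.qh_add h h')
  qh_e h i := by simpa [Uq.K, Uq.E, Uq.F] using Uq.rel (r := r) (Rel.qh_e h i)
  qh_f h i := by simpa [Uq.K, Uq.E, Uq.F] using Uq.rel (r := r) (Rel.qh_f h i)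
  e_f_same i := by simpa [Uq.K, Uq.E, Uq.F] using Uq.rel (r := r) (Rel.e_f_same i)
  e_f_ne i j hij := by simpa [Uq.K, Uq.E, Uq.F] using Uq.rel (r := r) (Rel.e_f_ne i j hij)
  e_comm i j hij := by simpa [Uq.K, Uq.E, Uq.F] using Uq.rel (r := r) (Rel.e_comm i j hij)
  f_comm i j hij := by simpa [Uq.K, Uq.E, Uq.F] using Uq.rel (r := r) (Rel.f_comm i j hij)
  e_serre i j hij := by simpa [Uq.K, Uq.E, Uq.F] using Uq.rel (r := r) (Rel.e_serre i j hij)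
  f_serre i j hij := by simpa [Uq.K, Uq.E, Uq.F] using Uq.rel (r := r) (Rel.f_serre i j hij)

/-- The values of a homomorphism on the generators. -/
def genMap {A : Type*} (K : CoWt n → A) (E F : ZMod n → A) : Gen n → A
  | Gen.qh h => K h
  | Gen.e i => E i
  | Gen.f i => F i

/-- The algebra homomorphism given by elements that satisfy the defining relations. -/
def Uq.lift {A : Type*} [Ring A] [Algebra GF A] {K : CoWt n → A} {E F : ZMod n → A}
    (H : Relations r K E F) : Uq n r →ₐ[GF] A :=
  RingQuot.liftAlgHom GF (s := Rel n r) ⟨FreeAlgebra.lift GF (genMap K E F), by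
    intro x y hxy
    cases hxy with
    | qh_zero => simpa [K0, genMap] using H.qh_zero
    | qh_add h h' => simpa [K0, genMap] using H.qh_add h h'
    | qh_e h i => simpa [K0, E0, genMap] using H.qh_e h i
    | qh_f h i => simpa [K0, F0, genMap] using H.qh_f h i
    | e_f_same i => simpa [K0, E0, F0, genMap] using H.e_f_same i
    | e_f_ne i j hij => simpa [K0, E0, F0, genMap] using H.e_f_ne i j hij
    | e_comm i j hij => simpa [K0, E0, F0, genMap] using H.e_comm i j hij
    | f_comm i j hij => simpa [K0, E0, F0, genMap] using H.f_comm i j hij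
    | e_serre i j hij => simpa [K0, E0, F0, genMap] using H.e_serre i j hij
    | f_serre i j hij => simpa [K0, E0, F0, genMap] using H.f_serre i j hij⟩

section lift

variable {A : Type*} [Ring A] [Algebra GF A] {K : CoWt n → A} {E F : ZMod n → A}
  (H : Relations r K E F)

theorem Uq.lift_mk (x : FreeAlgebra GF (Gen n)) :
    Uq.lift H (Uq.mk n r x) = FreeAlgebra.lift GF (genMap K E F) x :=
  RingQuot.liftAlgHom_mkAlgHom_apply _ _ _ _

@[simp] theorem Uq.lift_K (h : CoWt n) : Uq.lift H (Uq.K r h) = K h := by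
  rw [Uq.K, Uq.lift_mk]; simp [K0, genMap]

@[simp] theorem Uq.lift_E (i : ZMod n) : Uq.lift H (Uq.E r i) = E i := by
  rw [Uq.E, Uq.lift_mk]; simp [E0, genMap]

@[simp] theorem Uq.lift_F (i : ZMod n) : Uq.lift H (Uq.F r i) = F i := by
  rw [Uq.F, Uq.lift_mk]; simp [F0, genMap]

end lift

/-- Every property that holds for scalars and generators and is closed under sums and products
holds on the whole algebra. -/
theorem Uq.induction {p : Uq n r → Prop} (hs : ∀ c : GF, p (algebraMap GF (Uq n r) c))
    (hK : ∀ h, p (Uq.K r h)) (hE : ∀ i, p (Uq.E r i)) (hF : ∀ i, p (Uq.F r i))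
    (hmul : ∀ a b, p a → p b → p (a * b)) (hadd : ∀ a b, p a → p b → p (a + b))
    (a : Uq n r) : p a := by
  obtain ⟨x, rfl⟩ : ∃ x, Uq.mk n r x = a := RingQuot.mkAlgHom_surjective GF (Rel n r) a
  induction x using FreeAlgebra.induction with
  | grade0 c => simpa using hs c
  | grade1 g =>
    cases g with
    | qh h => exact hK h
    | e i => exact hE i
    | f i => exact hF i
  | mul a b ha hb => rw [map_mul]; exact hmul _ _ ha hb
  | add a b ha hb => rw [map_add]; exact hadd _ _ ha hb

/-! ## Tensor products -/

/-- The standing assumption `2 ≤ r ≤ n - 2` (so that `n ≥ 4`). -/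
structure Admissible (n r : ℕ) : Prop where
  two_le : 2 ≤ r
  add_two_le : r + 2 ≤ n

theorem q_ne_zero : q ≠ 0 := RatFunc.X_ne_zero (K := ℚ)

theorem q_sub_ne_zero : q - q⁻¹ ≠ 0 := by
  intro h
  have h2 : q * q = 1 := by
    have := congrArg (q * ·) h
    simp only [mul_sub, mul_inv_cancel₀ q_ne_zero, mul_zero] at this
    exact sub_eq_zero.mp this
  have h2' : (RatFunc.X : RatFunc ℚ) * RatFunc.X = 1 := h2
  have h3 : (algebraMap (Polynomial ℚ) (RatFunc ℚ)) (Polynomial.X * Polynomial.X)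
      = (algebraMap (Polynomial ℚ) (RatFunc ℚ)) 1 := by
    simpa [RatFunc.algebraMap_X] using h2'
  have h4 := congrArg (Polynomial.eval 2) (RatFunc.algebraMap_injective ℚ h3)
  norm_num at h4

theorem qInt_two : qInt 2 = q + q⁻¹ := by
  have := q_sub_ne_zero
  rw [qInt, div_eq_iff this]; ring

theorem Admissible.natCast_ne_zero (h : Admissible n r) {m : ℕ} (hm : 0 < m) (hm3 : m < 4) :
    ((m : ℕ) : ZMod n) ≠ 0 := by
  have h1 := h.two_le
  have h2 := h.add_two_le
  rw [Ne, ZMod.natCast_eq_zero_iff]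
  intro hd
  have := Nat.le_of_dvd hm hd
  omega

theorem Admissible.one_ne_zero (h : Admissible n r) : (1 : ZMod n) ≠ 0 := by
  simpa using h.natCast_ne_zero (m := 1) (by norm_num) (by norm_num)

theorem Admissible.two_ne_zero (h : Admissible n r) : (1 + 1 : ZMod n) ≠ 0 := by
  have := h.natCast_ne_zero (m := 2) (by norm_num) (by norm_num)
  rwa [one_add_one_eq_two]

theorem alphaVee_alpha (i j : ZMod n) : alphaVee r i (alpha j)
    = ((if i = j then 1 else 0) - (if i = j + 1 then 1 else 0))
      - ((if i + 1 = j then 1 else 0) - (if i = j then 1 else 0)) := by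
  simp [alphaVee, alpha, deltaVee, delta, cVee, Pi.single_apply]

theorem alphaVee_alpha_symm (i j : ZMod n) :
    alphaVee r i (alpha j) = alphaVee r j (alpha i) := by
  simp only [alphaVee_alpha, eq_comm (a := j), eq_comm (a := j + 1)]
  ring

theorem alphaVee_alpha_self (h : Admissible n r) (i : ZMod n) :
    alphaVee r i (alpha i) = 2 := by
  have := h.one_ne_zero
  simp [alphaVee_alpha, this]

theorem alphaVee_alpha_neighbours (h : Admissible n r) {i j : ZMod n} (hij : Neighbours i j) :
    alphaVee r i (alpha j) = -1 := by
  have h1 := h.one_ne_zero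
  have h2 := h.two_ne_zero
  rcases hij with hij | hij
  · obtain rfl : i = j + 1 := by rw [← hij]; ring
    simp [alphaVee_alpha, h1, add_assoc, h2]
  · obtain rfl : j = i + 1 := by
      have := congrArg Neg.neg hij
      simp only [neg_sub, neg_neg] at this
      rw [← this]; ring
    simp [alphaVee_alpha, h1, add_assoc, h2]

theorem alphaVee_alpha_eq_zero {i j : ZMod n} (hne : i ≠ j) (hij : ¬ Neighbours i j) :
    alphaVee r i (alpha j) = 0 := by
  have h1 : i ≠ j + 1 := fun h => hij (Or.inl (by rw [h]; ring))
  have h2 : i + 1 ≠ j := fun h => hij (Or.inr (by rw [← h]; ring))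
  simp [alphaVee_alpha, hne, h1, h2]

/-- The quantum Serre relation for sums of `q`-commuting elements. -/
theorem serre_sum {k R : Type*} [Field k] {t s : k} (hq : t ≠ 0)
    (hs : s = t + t⁻¹) [Ring R] [Algebra k R] {A B A' B' : R}
    (hA : A ^ 2 * A' - s • (A * A' * A) + A' * A ^ 2 = 0)
    (hB : B ^ 2 * B' - s • (B * B' * B) + B' * B ^ 2 = 0)
    (h1 : B * A = t ^ (-2 : ℤ) • (A * B)) (h2 : B * A' = t • (A' * B))
    (h3 : B' * A = t • (A * B')) :
    (A + B) ^ 2 * (A' + B') - s • ((A + B) * (A' + B') * (A + B))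
      + (A' + B') * (A + B) ^ 2 = 0 := by
  have e1 : A * B * A' = t • (A * A' * B) := by rw [mul_assoc, h2, mul_smul_comm, mul_assoc]
  have e2 : B * A * A' = t⁻¹ • (A * A' * B) := by
    rw [h1, smul_mul_assoc, e1, smul_smul]; congr 1
    rw [zpow_neg]; field_simp
  have e3 : B * A' * A = t⁻¹ • (A' * A * B) := by
    rw [h2, smul_mul_assoc, mul_assoc, h1, mul_smul_comm, smul_smul, mul_assoc]; congr 1
    rw [zpow_neg]; field_simp
  have e4 : A' * B * A = (t ^ (-2 : ℤ)) • (A' * A * B) := by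
    rw [mul_assoc, h1, mul_smul_comm, mul_assoc]
  have f1 : A * B' * A = t • (A * A * B') := by rw [mul_assoc, h3, mul_smul_comm, mul_assoc]
  have f2 : B' * A * A = (t * t) • (A * A * B') := by
    rw [h3, smul_mul_assoc, f1, smul_smul]
  have g1 : B * A' * B = t • (A' * B * B) := by rw [h2, smul_mul_assoc]
  have g2 : B * B * A' = (t * t) • (A' * B * B) := by
    rw [mul_assoc, h2, mul_smul_comm, ← mul_assoc, g1, smul_smul]
  have k1 : B * A * B' = t ^ (-2 : ℤ) • (A * B * B') := by rw [h1, smul_mul_assoc]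
  have k2 : B * B' * A = t⁻¹ • (A * B * B') := by
    rw [mul_assoc, h3, mul_smul_comm, ← mul_assoc, k1, smul_smul]; congr 1
    rw [zpow_neg]; field_simp
  have k3 : B' * A * B = t • (A * B' * B) := by rw [h3, smul_mul_assoc]
  have k4 : B' * B * A = t⁻¹ • (A * B' * B) := by
    rw [mul_assoc, h1, mul_smul_comm, ← mul_assoc, k3, smul_smul]; congr 1
    rw [zpow_neg]; field_simp
  have hexp : (A + B) ^ 2 * (A' + B') - s • ((A + B) * (A' + B') * (A + B))
      + (A' + B') * (A + B) ^ 2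
      = (A ^ 2 * A' - s • (A * A' * A) + A' * A ^ 2)
      + (B ^ 2 * B' - s • (B * B' * B) + B' * B ^ 2)
      + (A * B * A' + B * A * A' - s • (A * A' * B) - s • (B * A' * A)
          + A' * A * B + A' * B * A)
      + (A * A * B' - s • (A * B' * A) + B' * A * A)
      + (B * B * A' - s • (B * A' * B) + A' * B * B)
      + (A * B * B' + B * A * B' - s • (A * B' * B) - s • (B * B' * A)
          + B' * A * B + B' * B * A) := by
    simp only [sq, add_mul, mul_add, smul_add, ← mul_assoc]
    abel
  rw [hexp, hA, hB, e1, e2, e3, e4, f1, f2, g1, g2, k1, k2, k3, k4, hs, zpow_neg]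
  have hz : t ^ (2 : ℤ) = t * t := by rw [zpow_ofNat, sq]
  rw [hz]
  match_scalars <;> field_simp <;> ring


section Relations

variable {A : Type*} [Ring A] [Algebra GF A] {K : CoWt n → A} {E F : ZMod n → A}

theorem Relations.neg_mul_self (H : Relations r K E F) (h : CoWt n) : K (-h) * K h = 1 := by
  rw [← H.qh_add, neg_add_cancel, H.qh_zero]

theorem Relations.K_comm (H : Relations r K E F) (h h' : CoWt n) : K h * K h' = K h' * K h := by
  rw [← H.qh_add, ← H.qh_add, add_comm]

theorem Relations.K_mul_E (H : Relations r K E F) (h : CoWt n) (i : ZMod n) :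
    K h * E i = q ^ (h (alpha i)) • (E i * K h) := by
  rw [← smul_mul_assoc, ← H.qh_e, mul_assoc, H.neg_mul_self, mul_one]

theorem Relations.K_mul_F (H : Relations r K E F) (h : CoWt n) (i : ZMod n) :
    K h * F i = q ^ (-(h (alpha i))) • (F i * K h) := by
  rw [← smul_mul_assoc, ← H.qh_f, mul_assoc, H.neg_mul_self, mul_one]

/-- The elements `Δ(q^h) = q^h ⊗ q^h`, `Δ(e_i) = 1 ⊗ e_i + e_i ⊗ k_i^{-1}` and
`Δ(f_i) = f_i ⊗ 1 + k_i ⊗ f_i` satisfy the defining relations. -/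
theorem Relations.tensor (hn : Admissible n r) (H : Relations r K E F) :
    Relations r (A := A ⊗[GF] A) (fun h => K h ⊗ₜ K h)
      (fun i => 1 ⊗ₜ E i + E i ⊗ₜ K (-(alphaVee r i)))
      (fun i => F i ⊗ₜ 1 + K (alphaVee r i) ⊗ₜ F i) where
  qh_zero := by simp [H.qh_zero, Algebra.TensorProduct.one_def]
  qh_add h h' := by simp [H.qh_add]
  qh_e h i := by
    have e1 : K h * K (-(alphaVee r i)) * K (-h) = K (-(alphaVee r i)) := by
      rw [H.K_comm h, mul_assoc, H.K_comm h, H.neg_mul_self, mul_one]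
    have e2 : K h * K (-h) = 1 := by rw [H.K_comm h, H.neg_mul_self]
    simp only [mul_add, add_mul, Algebra.TensorProduct.tmul_mul_tmul, mul_one, H.qh_e, e1, e2,
      smul_add, TensorProduct.tmul_smul, TensorProduct.smul_tmul']
  qh_f h i := by
    have e1 : K h * K (alphaVee r i) * K (-h) = K (alphaVee r i) := by
      rw [H.K_comm h, mul_assoc, H.K_comm h, H.neg_mul_self, mul_one]
    have e2 : K h * K (-h) = 1 := by rw [H.K_comm h, H.neg_mul_self]
    simp only [mul_add, add_mul, Algebra.TensorProduct.tmul_mul_tmul, mul_one, H.qh_f, e1, e2,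
      smul_add, TensorProduct.tmul_smul, TensorProduct.smul_tmul']
  e_f_same i := by
    have e1 : (E i * K (alphaVee r i)) ⊗ₜ[GF] (K (-(alphaVee r i)) * F i)
        = (K (alphaVee r i) * E i) ⊗ₜ[GF] (F i * K (-(alphaVee r i))) := by
      rw [H.K_mul_E, H.K_mul_F, TensorProduct.tmul_smul, TensorProduct.smul_tmul',
        LinearMap.neg_apply, neg_neg]
    have e2 : (1 ⊗ₜ E i + E i ⊗ₜ K (-(alphaVee r i))) * (F i ⊗ₜ 1 + K (alphaVee r i) ⊗ₜ F i)
        - (F i ⊗ₜ 1 + K (alphaVee r i) ⊗ₜ F i) * (1 ⊗ₜ E i + E i ⊗ₜ K (-(alphaVee r i)))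
        = K (alphaVee r i) ⊗ₜ[GF] (E i * F i - F i * E i)
          + (E i * F i - F i * E i) ⊗ₜ[GF] K (-(alphaVee r i)) := by
      simp only [mul_add, add_mul, Algebra.TensorProduct.tmul_mul_tmul, mul_one, one_mul, e1,
        TensorProduct.tmul_sub, TensorProduct.sub_tmul]
      abel
    simp only [e2, H.e_f_same, TensorProduct.tmul_smul, ← TensorProduct.smul_tmul',
      TensorProduct.tmul_sub, TensorProduct.sub_tmul, ← smul_add]
    congr 1
    abel
  e_f_ne i j hij := by
    have e1 : (E i * K (alphaVee r j)) ⊗ₜ[GF] (K (-(alphaVee r i)) * F j)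
        = (K (alphaVee r j) * E i) ⊗ₜ[GF] (F j * K (-(alphaVee r i))) := by
      rw [H.K_mul_E, H.K_mul_F, TensorProduct.tmul_smul, TensorProduct.smul_tmul',
        LinearMap.neg_apply, neg_neg, alphaVee_alpha_symm]
    have e2 : (1 ⊗ₜ E i + E i ⊗ₜ K (-(alphaVee r i))) * (F j ⊗ₜ 1 + K (alphaVee r j) ⊗ₜ F j)
        - (F j ⊗ₜ 1 + K (alphaVee r j) ⊗ₜ F j) * (1 ⊗ₜ E i + E i ⊗ₜ K (-(alphaVee r i)))
        = K (alphaVee r j) ⊗ₜ[GF] (E i * F j - F j * E i)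
          + (E i * F j - F j * E i) ⊗ₜ[GF] K (-(alphaVee r i)) := by
      simp only [mul_add, add_mul, Algebra.TensorProduct.tmul_mul_tmul, mul_one, one_mul, e1,
        TensorProduct.tmul_sub, TensorProduct.sub_tmul]
      abel
    simp only [e2, H.e_f_ne i j hij, TensorProduct.tmul_zero, TensorProduct.zero_tmul, add_zero]
  e_comm i j hij := by
    by_cases hne : i = j
    · rw [hne, sub_self]
    have h0 := alphaVee_alpha_eq_zero (r := r) hne hij
    have h0' := alphaVee_alpha_symm (r := r) i j ▸ h0
    have e0 := sub_eq_zero.mp (H.e_comm i j hij)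
    simp only [mul_add, add_mul, Algebra.TensorProduct.tmul_mul_tmul, mul_one, one_mul,
      H.K_mul_E, LinearMap.neg_apply, h0, h0', neg_zero, zpow_zero, one_smul, e0,
      H.K_comm (-(alphaVee r i))]
    abel
  f_comm i j hij := by
    by_cases hne : i = j
    · rw [hne, sub_self]
    have h0 := alphaVee_alpha_eq_zero (r := r) hne hij
    have h0' := alphaVee_alpha_symm (r := r) i j ▸ h0
    have e0 := sub_eq_zero.mp (H.f_comm i j hij)
    simp only [mul_add, add_mul, Algebra.TensorProduct.tmul_mul_tmul, mul_one, one_mul,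
      H.K_mul_F, h0, h0', neg_zero, zpow_zero, one_smul, e0,
      H.K_comm (alphaVee r i)]
    abel
  e_serre i j hij := by
    have h0 := alphaVee_alpha_neighbours hn hij
    have h0' := alphaVee_alpha_symm (r := r) i j ▸ h0
    have h2 := alphaVee_alpha_self hn i
    apply serre_sum q_ne_zero qInt_two
    · simp only [sq, Algebra.TensorProduct.tmul_mul_tmul, mul_one, ← TensorProduct.tmul_smul,
        ← TensorProduct.tmul_sub, ← TensorProduct.tmul_add]
      rw [← sq, H.e_serre i j hij, TensorProduct.tmul_zero]
    · have c1 : K (-(alphaVee r i)) * K (-(alphaVee r j)) * K (-(alphaVee r i))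
          = K (-(alphaVee r i)) * K (-(alphaVee r i)) * K (-(alphaVee r j)) := by
        rw [mul_assoc, H.K_comm (-(alphaVee r j)), mul_assoc]
      have c2 : K (-(alphaVee r j)) * (K (-(alphaVee r i)) * K (-(alphaVee r i)))
          = K (-(alphaVee r i)) * K (-(alphaVee r i)) * K (-(alphaVee r j)) := by
        rw [← mul_assoc, H.K_comm (-(alphaVee r j)), c1]
      simp only [sq, Algebra.TensorProduct.tmul_mul_tmul, c1, c2, TensorProduct.smul_tmul',
        ← TensorProduct.sub_tmul, ← TensorProduct.add_tmul]
      rw [← sq, H.e_serre i j hij, TensorProduct.zero_tmul]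
    · simp [H.K_mul_E, h2]
    · simp [H.K_mul_E, h0]
    · simp [H.K_mul_E, h0']
  f_serre i j hij := by
    have h0 := alphaVee_alpha_neighbours hn hij
    have h0' := alphaVee_alpha_symm (r := r) i j ▸ h0
    have h2 := alphaVee_alpha_self hn i
    apply serre_sum q_ne_zero qInt_two
    · simp only [sq, Algebra.TensorProduct.tmul_mul_tmul, mul_one, TensorProduct.smul_tmul',
        ← TensorProduct.sub_tmul, ← TensorProduct.add_tmul]
      rw [← sq, H.f_serre i j hij, TensorProduct.zero_tmul]
    · have c1 : K (alphaVee r i) * K (alphaVee r j) * K (alphaVee r i)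
          = K (alphaVee r i) * K (alphaVee r i) * K (alphaVee r j) := by
        rw [mul_assoc, H.K_comm (alphaVee r j), mul_assoc]
      have c2 : K (alphaVee r j) * (K (alphaVee r i) * K (alphaVee r i))
          = K (alphaVee r i) * K (alphaVee r i) * K (alphaVee r j) := by
        rw [← mul_assoc, H.K_comm (alphaVee r j), c1]
      simp only [sq, Algebra.TensorProduct.tmul_mul_tmul, c1, c2, ← TensorProduct.tmul_smul,
        ← TensorProduct.tmul_sub, ← TensorProduct.tmul_add]
      have e := H.f_serre i j hij
      rw [sq] at e
      rw [e, TensorProduct.tmul_zero]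
    · simp [H.K_mul_F, h2, TensorProduct.smul_tmul']
    · simp [H.K_mul_F, h0, TensorProduct.smul_tmul']
    · simp [H.K_mul_F, h0', TensorProduct.smul_tmul']

end Relations

/-- The comultiplication `Δ`. -/
def Uq.comul (hn : Admissible n r) : Uq n r →ₐ[GF] Uq n r ⊗[GF] Uq n r :=
  Uq.lift ((Uq.relations n r).tensor hn)

/-- The tensor product of two representations, through the comultiplication. -/
def tensorRep (hn : Admissible n r) {V W : Type*} [AddCommGroup V] [Module GF V]
    [AddCommGroup W] [Module GF W] (ρ : Uq n r →ₐ[GF] Module.End GF V)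
    (σ : Uq n r →ₐ[GF] Module.End GF W) : Uq n r →ₐ[GF] Module.End GF (V ⊗[GF] W) :=
  (Module.endTensorEndAlgHom (R := GF) (S := GF) (A := GF) (M := V) (N := W)).comp
    ((Algebra.TensorProduct.map ρ σ).comp (Uq.comul hn))

/-! ## The `q`-oscillator module -/

/-- The space `𝓦` with basis the vectors `|m⟩` for `m = (m_1, …, m_n)`, `m_i ≥ 0`. -/
def OscSpace (n : ℕ) : Type := (ZMod n → ℕ) →₀ GF

instance (n : ℕ) : AddCommGroup (OscSpace n) := inferInstanceAs (AddCommGroup (_ →₀ GF))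
instance (n : ℕ) : Module GF (OscSpace n) := inferInstanceAs (Module GF (_ →₀ GF))

/-- The basis of `𝓦`. -/
def oscBasis (n : ℕ) : Module.Basis (ZMod n → ℕ) GF (OscSpace n) :=
  Module.Basis.ofRepr (LinearEquiv.refl GF ((ZMod n → ℕ) →₀ GF))

/-- The basis vector `|m⟩`. -/
def ket (m : ZMod n → ℕ) : OscSpace n := oscBasis n m

/-- The `i`-th standard basis vector. -/
def eps (i : ZMod n) : ZMod n → ℕ := Pi.single i 1

/-- The linear operator `|m⟩ ↦ c(m) |φ(m)⟩`. -/
def ketMap (c : (ZMod n → ℕ) → GF) (φ : (ZMod n → ℕ) → (ZMod n → ℕ)) :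
    Module.End GF (OscSpace n) :=
  (oscBasis n).constr GF (fun m => c m • ket (φ m))

/-- The index `i` lies in `{1, …, r}` (and not in `{r+1, …, n}`). -/
def IsLow (r : ℕ) (i : ZMod n) : Prop := i ≠ 0 ∧ i.val ≤ r

instance (r : ℕ) (i : ZMod n) : Decidable (IsLow r i) := inferInstanceAs (Decidable (_ ∧ _))

/-- The weight `-Λ_r - ∑_{i ≤ r} m_i δ_i + ∑_{j > r} m_j δ_j` of `|m⟩`. -/
def ketWt (r : ℕ) (m : ZMod n → ℕ) : Wt n :=
  (-1, fun i => if IsLow r i then -(m i : ℤ) else (m i : ℤ))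

/-- The action of `q^h`; in particular `q^c` acts by `q^{-1}`, `q^{δ_i^∨}` by `q^{-m_i}` for
`1 ≤ i ≤ r` and `q^{δ_j^∨}` by `q^{m_j}` for `r < j ≤ n`. -/
def oscK (r : ℕ) (h : CoWt n) : Module.End GF (OscSpace n) :=
  ketMap (fun m => q ^ (h (ketWt r m))) (fun m => m)

/-- The action of `e_i`, with spectral parameter `x`. Whenever a coordinate of the target would
be negative, the coefficient is zero, so the truncated subtraction is harmless. -/
def oscE (r : ℕ) (x : GFˣ) (i : ZMod n) : Module.End GF (OscSpace n) :=
  if i = 0 then ketMap (fun _ => (x : GF)) (fun m => m + eps 1 + eps 0)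
  else if i = (r : ZMod n) then
    ketMap (fun m => -(qInt (m i) * qInt (m (i + 1)))) (fun m => m - eps i - eps (i + 1))
  else if i.val < r then ketMap (fun m => qInt (m i)) (fun m => m - eps i + eps (i + 1))
  else ketMap (fun m => qInt (m (i + 1))) (fun m => m + eps i - eps (i + 1))

/-- The action of `f_i`, with spectral parameter `x`. -/
def oscF (r : ℕ) (x : GFˣ) (i : ZMod n) : Module.End GF (OscSpace n) :=
  if i = 0 then
    ketMap (fun m => -((x : GF)⁻¹ * qInt (m 1) * qInt (m 0))) (fun m => m - eps 1 - eps 0)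
  else if i = (r : ZMod n) then ketMap (fun _ => 1) (fun m => m + eps i + eps (i + 1))
  else if i.val < r then ketMap (fun m => qInt (m (i + 1))) (fun m => m + eps i - eps (i + 1))
  else ketMap (fun m => qInt (m i)) (fun m => m - eps i + eps (i + 1))

/-! ### The operators satisfy the defining relations -/

theorem ketMap_ket (c : (ZMod n → ℕ) → GF) (φ : (ZMod n → ℕ) → (ZMod n → ℕ)) (m : ZMod n → ℕ) :
    ketMap c φ (ket m) = c m • ket (φ m) := by
  exact (oscBasis n).constr_basis GF _ m

theorem osc_ext {f g : Module.End GF (OscSpace n)} (h : ∀ m, f (ket m) = g (ket m)) : f = g := by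
  exact (oscBasis n).ext h

theorem qInt_zero : qInt 0 = 0 := by simp [qInt]

theorem qInt_one : qInt 1 = 1 := by
  simp [qInt, div_self q_sub_ne_zero]

theorem qInt_add_two (k : ℕ) : qInt (k + 2) + qInt k = qInt 2 * qInt (k + 1) := by
  have hq := q_ne_zero
  rw [qInt_two]
  simp only [qInt, ← add_div, ← mul_div_assoc]
  congr 1
  rw [inv_pow, inv_pow, inv_pow]
  field_simp
  ring

/-- Lowering at one coordinate. -/
def lower (a : ZMod n) : Module.End GF (OscSpace n) :=
  ketMap (fun m => qInt (m a)) (fun m => m - eps a)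

/-- Raising at one coordinate. -/
def raise (a : ZMod n) : Module.End GF (OscSpace n) :=
  ketMap (fun _ => 1) (fun m => m + eps a)

theorem lower_ket (a : ZMod n) (m) : lower a (ket m) = qInt (m a) • ket (m - eps a) :=
  ketMap_ket _ _ _

theorem raise_ket (a : ZMod n) (m) : raise a (ket m) = ket (m + eps a) := by
  simp [raise, ketMap_ket]

theorem eps_self (a : ZMod n) : eps a a = 1 := by simp [eps]

theorem eps_ne {a b : ZMod n} (h : a ≠ b) : eps a b = 0 := by simp [eps, h.symm]

theorem lower_lower (a b : ZMod n) : lower a * lower b = lower b * lower a := by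
  by_cases hab : a = b
  · rw [hab]
  refine osc_ext fun m => ?_
  simp [lower_ket, eps_ne hab, eps_ne (Ne.symm hab), smul_smul, mul_comm, tsub_right_comm]

theorem raise_raise (a b : ZMod n) : raise a * raise b = raise b * raise a := by
  refine osc_ext fun m => ?_
  simp [raise_ket, add_right_comm]

theorem lower_raise {a b : ZMod n} (hab : a ≠ b) : lower a * raise b = raise b * lower a := by
  refine osc_ext fun m => ?_
  have : m + eps b - eps a = m - eps a + eps b := by
    funext c
    by_cases hc : c = a
    · subst hc; simp [eps_ne (Ne.symm hab)]
    · simp [eps_ne (Ne.symm hc)]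
  simp [raise_ket, lower_ket, eps_ne (Ne.symm hab), this]

theorem sub_add_eps {m : ZMod n → ℕ} {a : ZMod n} (h : m a ≠ 0) : m - eps a + eps a = m := by
  funext c
  by_cases hc : c = a
  · subst hc; simp [eps_self]; omega
  · simp [eps_ne (Ne.symm hc)]

theorem raise_lower_ket (a : ZMod n) (m) : raise a (lower a (ket m)) = qInt (m a) • ket m := by
  by_cases h : m a = 0
  · simp [lower_ket, h, qInt_zero]
  · simp [lower_ket, raise_ket, sub_add_eps h]

theorem lower_raise_ket (a : ZMod n) (m) :
    lower a (raise a (ket m)) = qInt (m a + 1) • ket m := by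
  simp [lower_ket, raise_ket, eps_self]

theorem site_serre_lower (a : ZMod n) :
    lower a ^ 2 * raise a - qInt 2 • (lower a * raise a * lower a)
      + raise a * lower a ^ 2 = 0 := by
  refine osc_ext fun m => ?_
  have e1 : lower a (lower a (raise a (ket m)))
      = (qInt (m a + 1) * qInt (m a)) • ket (m - eps a) := by
    rw [lower_raise_ket, map_smul, lower_ket, smul_smul]
  have e2 : lower a (raise a (lower a (ket m))) = (qInt (m a) * qInt (m a)) • ket (m - eps a) := by
    rw [raise_lower_ket, map_smul, lower_ket, smul_smul]
  have e3 : raise a (lower a (lower a (ket m)))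
      = (qInt (m a) * qInt (m a - 1)) • ket (m - eps a) := by
    rw [lower_ket, map_smul, map_smul, raise_lower_ket, smul_smul, Pi.sub_apply, eps_self]
  have e4 : qInt (m a + 1) * qInt (m a) - qInt 2 * (qInt (m a) * qInt (m a))
      + qInt (m a) * qInt (m a - 1) = 0 := by
    rcases m a with _ | k
    · simp [qInt_zero]
    · have h1 := qInt_add_two k
      simp only [Nat.add_sub_cancel]
      linear_combination (qInt (k + 1)) * h1
  simp only [sq, LinearMap.add_apply, LinearMap.sub_apply, LinearMap.smul_apply,
    Module.End.mul_apply, e1, e2, e3, LinearMap.zero_apply]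
  rw [smul_smul, ← sub_smul, ← add_smul, e4, zero_smul]

theorem site_serre_raise (a : ZMod n) :
    raise a ^ 2 * lower a - qInt 2 • (raise a * lower a * raise a)
      + lower a * raise a ^ 2 = 0 := by
  refine osc_ext fun m => ?_
  have e1 : raise a (raise a (lower a (ket m))) = qInt (m a) • ket (m + eps a) := by
    rw [raise_lower_ket, map_smul, raise_ket]
  have e2 : raise a (lower a (raise a (ket m))) = qInt (m a + 1) • ket (m + eps a) := by
    rw [lower_raise_ket, map_smul, raise_ket]
  have e3 : lower a (raise a (raise a (ket m))) = qInt (m a + 2) • ket (m + eps a) := by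
    rw [raise_ket, lower_raise_ket, Pi.add_apply, eps_self]
  have e4 : qInt (m a) - qInt 2 * qInt (m a + 1) + qInt (m a + 2) = 0 := by
    linear_combination qInt_add_two (m a)
  simp only [sq, LinearMap.add_apply, LinearMap.sub_apply, LinearMap.smul_apply,
    Module.End.mul_apply, e1, e2, e3, LinearMap.zero_apply]
  rw [smul_smul, ← sub_smul, ← add_smul, e4, zero_smul]

/-- The factor that raises the weight by `δ_a`. -/
def up (r : ℕ) (a : ZMod n) : Module.End GF (OscSpace n) :=
  if IsLow r a then lower a else raise a

/-- The factor that lowers the weight by `δ_a`. -/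
def down (r : ℕ) (a : ZMod n) : Module.End GF (OscSpace n) :=
  if IsLow r a then raise a else lower a

theorem up_up (a b : ZMod n) : Commute (up r a) (up r b) := by
  by_cases hab : a = b
  · rw [hab]
  unfold up Commute SemiconjBy
  split_ifs
  · exact lower_lower _ _
  · exact lower_raise hab
  · exact (lower_raise (Ne.symm hab)).symm
  · exact raise_raise _ _

theorem down_down (a b : ZMod n) : Commute (down r a) (down r b) := by
  by_cases hab : a = b
  · rw [hab]
  unfold down Commute SemiconjBy
  split_ifs
  · exact raise_raise _ _
  · exact (lower_raise (Ne.symm hab)).symm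
  · exact lower_raise hab
  · exact lower_lower _ _

theorem up_down {a b : ZMod n} (hab : a ≠ b) : Commute (up r a) (down r b) := by
  unfold up down Commute SemiconjBy
  split_ifs
  · exact lower_raise hab
  · exact lower_lower _ _
  · exact raise_raise _ _
  · exact (lower_raise (Ne.symm hab)).symm

theorem site_serre_up (a : ZMod n) :
    up r a ^ 2 * down r a - qInt 2 • (up r a * down r a * up r a)
      + down r a * up r a ^ 2 = 0 := by
  unfold up down
  split_ifs
  · exact site_serre_lower a
  · exact site_serre_raise a

theorem site_serre_down (a : ZMod n) :
    down r a ^ 2 * up r a - qInt 2 • (down r a * up r a * down r a)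
      + up r a * down r a ^ 2 = 0 := by
  unfold up down
  split_ifs
  · exact site_serre_raise a
  · exact site_serre_lower a

/-- The Serre relation for products: `X` and `Y` satisfy it, `P` commutes with everything. -/
theorem serre_mul {k R : Type*} [Field k] [Ring R] [Algebra k R] {s : k} {X Y P Q : R}
    (h : X ^ 2 * Y - s • (X * Y * X) + Y * X ^ 2 = 0)
    (hPX : Commute P X) (hPY : Commute P Y) (hQX : Commute Q X) (hPQ : Commute P Q) :
    (P * X) ^ 2 * (Q * Y) - s • (P * X * (Q * Y) * (P * X)) + Q * Y * (P * X) ^ 2 = 0 := by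
  have d1 := fun z => hPX.symm.left_comm z
  have d2 := fun z => hPY.symm.left_comm z
  have d3 := fun z => hQX.symm.left_comm z
  have d4 := fun z => hPQ.symm.left_comm z
  have e1 : (P * X) ^ 2 * (Q * Y) = P * P * Q * (X ^ 2 * Y) := by
    simp only [sq, mul_assoc, d1, d3]
  have e2 : P * X * (Q * Y) * (P * X) = P * P * Q * (X * Y * X) := by
    simp only [mul_assoc, d1, d2, d3, d4]
  have e3 : Q * Y * (P * X) ^ 2 = P * P * Q * (Y * X ^ 2) := by
    simp only [sq, mul_assoc, d1, d2, d4]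
  rw [e1, e2, e3, ← mul_smul_comm, ← mul_sub, ← mul_add, h, mul_zero]

theorem serre_smul {k R : Type*} [Field k] [Ring R] [Algebra k R] {s : k} {X Y : R} (a b : k)
    (h : X ^ 2 * Y - s • (X * Y * X) + Y * X ^ 2 = 0) :
    (a • X) ^ 2 * (b • Y) - s • ((a • X) * (b • Y) * (a • X)) + (b • Y) * (a • X) ^ 2 = 0 := by
  have : (a • X) ^ 2 * (b • Y) - s • ((a • X) * (b • Y) * (a • X)) + (b • Y) * (a • X) ^ 2
      = (a ^ 2 * b) • (X ^ 2 * Y - s • (X * Y * X) + Y * X ^ 2) := by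
    have e1 : a * b * a = a ^ 2 * b := by ring
    have e2 : b * a ^ 2 = a ^ 2 * b := by ring
    simp only [smul_pow, smul_mul_smul_comm, smul_add, smul_sub, e1, e2]
    rw [smul_comm s]
  rw [this, h, smul_zero]

/-- The scalar in `e_i`. -/
def scalE (r : ℕ) (x : GFˣ) (i : ZMod n) : GF :=
  if i = 0 then (x : GF) else if i = (r : ZMod n) then -1 else 1

/-- The scalar in `f_i`. -/
def scalF (x : GFˣ) (i : ZMod n) : GF :=
  if i = 0 then -(x : GF)⁻¹ else 1


theorem Admissible.neZero (hn : Admissible n r) : NeZero n :=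
  ⟨by have := hn.add_two_le; omega⟩

theorem Admissible.val_add_one (hn : Admissible n r) (i : ZMod n) :
    (i + 1).val = if i.val + 1 = n then 0 else i.val + 1 := by
  have := hn.neZero
  have h2 := hn.add_two_le
  have : Fact (1 < n) := ⟨by omega⟩
  have hi := ZMod.val_lt i
  rw [ZMod.val_add, ZMod.val_one]
  split_ifs with h
  · rw [h, Nat.mod_self]
  · exact Nat.mod_eq_of_lt (by omega)

theorem Admissible.val_r (hn : Admissible n r) : ((r : ZMod n)).val = r := by
  have h2 := hn.add_two_le
  exact ZMod.val_natCast_of_lt (by omega)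

theorem Admissible.r_ne_zero (hn : Admissible n r) : (r : ZMod n) ≠ 0 := by
  intro h
  have h1 := hn.val_r
  have h2 := hn.two_le
  rw [h, ZMod.val_zero] at h1
  omega

theorem Admissible.add_one_ne (hn : Admissible n r) (i : ZMod n) : i + 1 ≠ i := by
  intro h
  exact hn.one_ne_zero (by simpa using h)

/-- The four kinds of nodes. -/
theorem Admissible.cases (hn : Admissible n r) (i : ZMod n) :
    (i = 0 ∧ ¬ IsLow r i ∧ IsLow r (i + 1)) ∨
    (i ≠ 0 ∧ i = (r : ZMod n) ∧ IsLow r i ∧ ¬ IsLow r (i + 1)) ∨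
    (i ≠ 0 ∧ i ≠ (r : ZMod n) ∧ i.val < r ∧ IsLow r i ∧ IsLow r (i + 1)) ∨
    (i ≠ 0 ∧ i ≠ (r : ZMod n) ∧ ¬ i.val < r ∧ ¬ IsLow r i ∧ ¬ IsLow r (i + 1)) := by
  have := hn.neZero
  have h1 := hn.two_le
  have h2 := hn.add_two_le
  have hi := ZMod.val_lt i
  have hv := hn.val_add_one i
  have z : ∀ j : ZMod n, j = 0 ↔ j.val = 0 := fun j => (ZMod.val_eq_zero j).symm
  have hr : i = (r : ZMod n) ↔ i.val = r := by
    constructor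
    · intro h; rw [h, hn.val_r]
    · intro h; rw [← h, ZMod.natCast_zmod_val]
  simp only [IsLow, Ne, hr, z, hv]
  clear hv hr z
  generalize i.val = v at hi ⊢
  grind

theorem oscE_eq (hn : Admissible n r) (x : GFˣ) (i : ZMod n) :
    oscE r x i = scalE r x i • (up r i * down r (i + 1)) := by
  have hne := hn.add_one_ne i
  rcases hn.cases i with ⟨h, a, b⟩ | ⟨h, h', a, b⟩ | ⟨h, h', h'', a, b⟩ | ⟨h, h', h'', a, b⟩
  · subst h
    rw [zero_add] at b
    refine osc_ext fun m => ?_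
    simp [oscE, scalE, up, down, a, b, ketMap_ket, raise_ket]
  · refine osc_ext fun m => ?_
    rw [oscE, if_neg h, if_pos h', scalE, if_neg h, if_pos h', up, if_pos a, down, if_neg b]
    simp [ketMap_ket, lower_ket, eps_ne hne, smul_smul, mul_comm, tsub_right_comm]
  · refine osc_ext fun m => ?_
    rw [oscE, if_neg h, if_neg h', if_pos h'', scalE, if_neg h, if_neg h', up, if_pos a, down,
      if_pos b, lower_raise hne.symm]
    simp [ketMap_ket, lower_ket, raise_ket]
  · refine osc_ext fun m => ?_
    rw [oscE, if_neg h, if_neg h', if_neg h'', scalE, if_neg h, if_neg h', up, if_neg a, down,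
      if_neg b, ← lower_raise hne]
    simp [ketMap_ket, lower_ket, raise_ket, eps_ne hne.symm]

theorem oscF_eq (hn : Admissible n r) (x : GFˣ) (i : ZMod n) :
    oscF r x i = scalF x i • (down r i * up r (i + 1)) := by
  have hne := hn.add_one_ne i
  rcases hn.cases i with ⟨h, a, b⟩ | ⟨h, h', a, b⟩ | ⟨h, h', h'', a, b⟩ | ⟨h, h', h'', a, b⟩
  · subst h
    rw [zero_add] at b hne
    refine osc_ext fun m => ?_
    simp [oscF, scalF, up, down, a, b, ketMap_ket, lower_ket, eps_ne hne, smul_smul, mul_assoc]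
  · refine osc_ext fun m => ?_
    rw [oscF, if_neg h, if_pos h', scalF, if_neg h, up, if_neg b, down, if_pos a, raise_raise]
    simp [ketMap_ket, raise_ket]
  · refine osc_ext fun m => ?_
    rw [oscF, if_neg h, if_neg h', if_pos h'', scalF, if_neg h, up, if_pos b, down,
      if_pos a, ← lower_raise hne]
    simp [ketMap_ket, lower_ket, raise_ket, eps_ne hne.symm]
  · refine osc_ext fun m => ?_
    rw [oscF, if_neg h, if_neg h', if_neg h'', scalF, if_neg h, up, if_neg b, down,
      if_neg a, lower_raise hne.symm]
    simp [ketMap_ket, lower_ket, raise_ket]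

theorem oscK_ket (h : CoWt n) (m) : oscK r h (ket m) = q ^ (h (ketWt r m)) • ket m :=
  ketMap_ket _ _ _

/-- Lowering or raising one coordinate shifts the weight. -/
theorem ketWt_add_eps (a : ZMod n) (m : ZMod n → ℕ) :
    ketWt r (m + eps a) = ketWt r m + (if IsLow r a then -delta a else delta a) := by
  have : ∀ b : ZMod n, b ≠ a → (Pi.single a 1 : ZMod n → ℤ) b = 0 := fun b hb => by simp [hb]
  split_ifs with ha
  · refine Prod.ext (by simp [ketWt, delta]) (funext fun b => ?_)
    by_cases hb : b = a
    · subst hb; simp [ketWt, delta, ha, eps_self]; ring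
    · simp [ketWt, delta, eps_ne (Ne.symm hb), hb]
  · refine Prod.ext (by simp [ketWt, delta]) (funext fun b => ?_)
    by_cases hb : b = a
    · subst hb; simp [ketWt, delta, ha, eps_self]
    · simp [ketWt, delta, eps_ne (Ne.symm hb), hb]

theorem oscK_raise (h : CoWt n) (a : ZMod n) :
    oscK r h * raise a
      = q ^ (h (if IsLow r a then -delta a else delta a)) • (raise a * oscK r h) := by
  refine osc_ext fun m => ?_
  simp [raise_ket, oscK_ket, ketWt_add_eps, zpow_add₀ q_ne_zero, smul_smul, mul_comm]

theorem oscK_lower (h : CoWt n) (a : ZMod n) :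
    oscK r h * lower a
      = q ^ (-(h (if IsLow r a then -delta a else delta a))) • (lower a * oscK r h) := by
  refine osc_ext fun m => ?_
  by_cases hm : m a = 0
  · simp [lower_ket, oscK_ket, hm, qInt_zero]
  · have e1 := ketWt_add_eps (r := r) a (m - eps a)
    rw [sub_add_eps hm] at e1
    have e2 : q ^ (-(h (if IsLow r a then -delta a else delta a))) * q ^ (h (ketWt r m))
        = q ^ (h (ketWt r (m - eps a))) := by
      rw [← zpow_add₀ q_ne_zero, e1, map_add]; congr 1; ring
    simp only [Module.End.mul_apply, lower_ket, oscK_ket, map_smul, LinearMap.smul_apply, ← e2,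
      smul_smul]
    congr 1; ring

theorem oscK_up (h : CoWt n) (a : ZMod n) :
    oscK r h * up r a = q ^ (h (delta a)) • (up r a * oscK r h) := by
  unfold up
  split_ifs with ha
  · rw [oscK_lower, if_pos ha, map_neg, neg_neg]
  · rw [oscK_raise, if_neg ha]

theorem oscK_down (h : CoWt n) (a : ZMod n) :
    oscK r h * down r a = q ^ (-(h (delta a))) • (down r a * oscK r h) := by
  unfold down
  split_ifs with ha
  · rw [oscK_raise, if_pos ha, map_neg]
  · rw [oscK_lower, if_neg ha]

theorem oscK_add (h h' : CoWt n) : oscK r (h + h') = oscK r h * oscK r h' := by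
  refine osc_ext fun m => ?_
  simp [oscK_ket, zpow_add₀ q_ne_zero, smul_smul, mul_comm]

theorem oscK_zero : oscK r (0 : CoWt n) = 1 := by
  refine osc_ext fun m => ?_
  simp [oscK_ket]

theorem oscK_mul_neg (h : CoWt n) : oscK r h * oscK r (-h) = 1 := by
  rw [← oscK_add, add_neg_cancel, oscK_zero]

theorem up_down_ket (a : ZMod n) (m) :
    up r a (down r a (ket m)) = qInt (if IsLow r a then m a + 1 else m a) • ket m := by
  unfold up down
  split_ifs
  · exact lower_raise_ket a m
  · exact raise_lower_ket a m

theorem down_up_ket (a : ZMod n) (m) :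
    down r a (up r a (ket m)) = qInt (if IsLow r a then m a else m a + 1) • ket m := by
  unfold up down
  split_ifs
  · exact raise_lower_ket a m
  · exact lower_raise_ket a m

theorem qInt_eq_zpow (k : ℕ) : qInt k = (q - q⁻¹)⁻¹ * (q ^ (k : ℤ) - q ^ (-(k : ℤ))) := by
  rw [qInt, div_eq_inv_mul, zpow_natCast, zpow_neg, zpow_natCast, inv_pow]

theorem qInt_identity (a b : ℕ) :
    qInt (a + 1) * qInt b - qInt a * qInt (b + 1)
      = (q - q⁻¹)⁻¹ * (q ^ ((b : ℤ) - a) - q ^ ((a : ℤ) - b)) := by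
  have hq := q_ne_zero
  have hs := q_sub_ne_zero
  have hk : q ^ 2 - 1 ≠ 0 := by
    intro h
    apply hs
    have e : q - q⁻¹ = q⁻¹ * (q ^ 2 - 1) := by field_simp
    rw [e, h, mul_zero]
  simp only [qInt, zpow_sub₀ hq, zpow_natCast, inv_pow]
  field_simp
  ring

theorem qInt_identity' (a b : ℕ) :
    qInt (a + 1) * qInt (b + 1) - qInt a * qInt b
      = (q - q⁻¹)⁻¹ * (q ^ ((a : ℤ) + b + 1) - q ^ (-((a : ℤ) + b + 1))) := by
  have hq := q_ne_zero
  have hs := q_sub_ne_zero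
  have hk : q ^ 2 - 1 ≠ 0 := by
    intro h
    apply hs
    have e : q - q⁻¹ = q⁻¹ * (q ^ 2 - 1) := by field_simp
    rw [e, h, mul_zero]
  simp only [qInt, zpow_neg, zpow_add₀ hq, zpow_natCast, inv_pow, zpow_one]
  field_simp
  ring

theorem scalE_mul_scalF (hn : Admissible n r) (x : GFˣ) (i : ZMod n) :
    scalE r x i * scalF x i = if IsLow r i ↔ IsLow r (i + 1) then 1 else -1 := by
  rcases hn.cases i with ⟨h, a, b⟩ | ⟨h, h', a, b⟩ | ⟨h, h', h'', a, b⟩ | ⟨h, h', h'', a, b⟩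
  · have hx : (x : GF) * (x : GF)⁻¹ = 1 := mul_inv_cancel₀ x.ne_zero
    rw [if_neg (by tauto), scalE, scalF, if_pos h, if_pos h, mul_neg, hx]
  · rw [if_neg (by tauto), scalE, scalF, if_neg h, if_neg h, if_pos h', mul_one]
  · rw [if_pos (by tauto), scalE, scalF, if_neg h, if_neg h, if_neg h', mul_one]
  · rw [if_pos (by tauto), scalE, scalF, if_neg h, if_neg h, if_neg h', mul_one]

theorem alphaVee_ketWt (hn : Admissible n r) (i : ZMod n) (m : ZMod n → ℕ) :
    alphaVee r i (ketWt r m) =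
      if IsLow r i then
        (if IsLow r (i + 1) then (m (i + 1) : ℤ) - m i else -((m i : ℤ) + m (i + 1) + 1))
      else (if IsLow r (i + 1) then (m i : ℤ) + m (i + 1) + 1 else (m i : ℤ) - m (i + 1)) := by
  rcases hn.cases i with ⟨h, a, b⟩ | ⟨h, h', a, b⟩ | ⟨h, h', h'', a, b⟩ | ⟨h, h', h'', a, b⟩
  · have h' : i ≠ (r : ZMod n) := by rw [h]; exact hn.r_ne_zero.symm
    have b' := b
    subst h
    rw [zero_add] at b'
    simp [alphaVee, deltaVee, cVee, ketWt, a, b', h']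
  · simp [alphaVee, deltaVee, cVee, ketWt, h, a, b, if_pos h']
    ring
  · simp [alphaVee, deltaVee, cVee, ketWt, h, a, b, h']
    ring
  · simp [alphaVee, deltaVee, cVee, ketWt, h, a, b, h']

/-- The operators above satisfy the defining relations, for every non-zero `x`. -/
theorem osc_relations (hn : Admissible n r) (x : GFˣ) :
    Relations (n := n) r (oscK r) (oscE r x) (oscF r x) where
  qh_zero := oscK_zero
  qh_add := oscK_add
  qh_e h i := by
    have e : oscK r h * (up r i * down r (i + 1))
        = q ^ (h (alpha i)) • (up r i * down r (i + 1) * oscK r h) := by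
      rw [← mul_assoc, oscK_up, smul_mul_assoc, mul_assoc, oscK_down, mul_smul_comm, smul_smul,
        ← zpow_add₀ q_ne_zero, alpha, map_sub, sub_eq_add_neg, mul_assoc]
    rw [oscE_eq hn, mul_smul_comm, e, smul_mul_assoc, smul_mul_assoc, mul_assoc, oscK_mul_neg,
      mul_one, smul_comm]
  qh_f h i := by
    have e : oscK r h * (down r i * up r (i + 1))
        = q ^ (-(h (alpha i))) • (down r i * up r (i + 1) * oscK r h) := by
      rw [← mul_assoc, oscK_down, smul_mul_assoc, mul_assoc, oscK_up, mul_smul_comm, smul_smul,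
        ← zpow_add₀ q_ne_zero, alpha, map_sub, neg_sub, sub_eq_neg_add, mul_assoc]
    rw [oscF_eq hn, mul_smul_comm, e, smul_mul_assoc, smul_mul_assoc, mul_assoc, oscK_mul_neg,
      mul_one, smul_comm]
  e_f_same i := by
    have hne := hn.add_one_ne i
    have c1 : up r i * down r (i + 1) * (down r i * up r (i + 1))
        = up r i * down r i * (down r (i + 1) * up r (i + 1)) := by
      simp only [mul_assoc]
      rw [(down_down (r := r) (i + 1) i).left_comm]
    have c2 : down r i * up r (i + 1) * (up r i * down r (i + 1))
        = down r i * up r i * (up r (i + 1) * down r (i + 1)) := by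
      simp only [mul_assoc]
      rw [(up_up (r := r) (i + 1) i).left_comm]
    rw [oscE_eq hn, oscF_eq hn, smul_mul_smul_comm, smul_mul_smul_comm, c1, c2,
      mul_comm (scalF x i), scalE_mul_scalF hn, ← smul_sub]
    refine osc_ext fun m => ?_
    simp only [LinearMap.smul_apply, LinearMap.sub_apply, Module.End.mul_apply, down_up_ket,
      up_down_ket, map_smul, oscK_ket, smul_smul, ← sub_smul, LinearMap.neg_apply]
    congr 1
    rw [alphaVee_ketWt hn]
    by_cases a : IsLow r i <;> by_cases b : IsLow r (i + 1) <;> simp only [a, b, if_true, if_false,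
      iff_true, iff_false, not_true_eq_false, one_mul, neg_mul, neg_sub, neg_neg]
    · linear_combination (exp := 1) qInt_identity (m i) (m (i + 1))
    · linear_combination (exp := 1) -qInt_identity' (m i) (m (i + 1))
    · linear_combination (exp := 1) qInt_identity' (m i) (m (i + 1))
    · linear_combination (exp := 1) qInt_identity (m (i + 1)) (m i)
  e_f_ne i j hij := by
    have h1 : Commute (up r i * down r (i + 1)) (down r j * up r (j + 1)) := by
      refine Commute.mul_left (Commute.mul_right (up_down hij) (up_up _ _))
        (Commute.mul_right (down_down _ _) (up_down ?_).symm)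
      intro h
      exact hij (add_right_cancel h).symm
    rw [oscE_eq hn, oscF_eq hn]
    exact sub_eq_zero.mpr ((h1.smul_left _).smul_right _).eq
  e_comm i j hij := by
    have n1 : i ≠ j + 1 := fun h => hij (Or.inl (by rw [h]; ring))
    have n2 : j ≠ i + 1 := fun h => hij (Or.inr (by rw [h]; ring))
    have h1 : Commute (up r i * down r (i + 1)) (up r j * down r (j + 1)) :=
      Commute.mul_left (Commute.mul_right (up_up _ _) (up_down n1))
        (Commute.mul_right (up_down n2).symm (down_down _ _))
    rw [oscE_eq hn, oscE_eq hn]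
    exact sub_eq_zero.mpr ((h1.smul_left _).smul_right _).eq
  f_comm i j hij := by
    have n1 : i ≠ j + 1 := fun h => hij (Or.inl (by rw [h]; ring))
    have n2 : j ≠ i + 1 := fun h => hij (Or.inr (by rw [h]; ring))
    have h1 : Commute (down r i * up r (i + 1)) (down r j * up r (j + 1)) :=
      Commute.mul_left (Commute.mul_right (down_down _ _) (up_down n1.symm).symm)
        (Commute.mul_right (up_down n2.symm) (up_up _ _))
    rw [oscF_eq hn, oscF_eq hn]
    exact sub_eq_zero.mpr ((h1.smul_left _).smul_right _).eq
  e_serre i j hij := by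
    have h1 := hn.one_ne_zero
    have h2 := hn.two_ne_zero
    rw [oscE_eq hn, oscE_eq hn]
    apply serre_smul
    rcases hij with hij | hij
    · obtain rfl : i = j + 1 := by rw [← hij]; ring
      have n1 : j + 1 + 1 ≠ j + 1 := hn.add_one_ne _
      have n2 : j + 1 ≠ j := hn.add_one_ne _
      have n3 : j ≠ j + 1 + 1 := by rw [add_assoc]; simpa using h2
      rw [(up_down n1.symm).eq]
      exact serre_mul (site_serre_up (j + 1)) (up_down n1.symm).symm (down_down _ _)
        (up_up _ _) (up_down n3).symm
    · obtain rfl : j = i + 1 := by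
        have := congrArg Neg.neg hij
        simp only [neg_sub, neg_neg] at this
        rw [← this]; ring
      have n1 : i + 1 + 1 ≠ i + 1 := hn.add_one_ne _
      have n2 : i + 1 ≠ i := hn.add_one_ne _
      have n3 : i ≠ i + 1 + 1 := by rw [add_assoc]; simpa using h2
      rw [(up_down n1.symm).eq]
      exact serre_mul (site_serre_down (i + 1)) (up_down n2.symm) (up_up _ _)
        (down_down _ _) (up_down n3)
  f_serre i j hij := by
    have h1 := hn.one_ne_zero
    have h2 := hn.two_ne_zero
    rw [oscF_eq hn, oscF_eq hn]
    apply serre_smul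
    rcases hij with hij | hij
    · obtain rfl : i = j + 1 := by rw [← hij]; ring
      have n1 : j + 1 + 1 ≠ j + 1 := hn.add_one_ne _
      have n2 : j + 1 ≠ j := hn.add_one_ne _
      have n3 : j ≠ j + 1 + 1 := by rw [add_assoc]; simpa using h2
      rw [← (up_down n1).eq]
      exact serre_mul (site_serre_down (j + 1)) (up_down n1) (up_up _ _)
        (down_down _ _) (up_down n3.symm)
    · obtain rfl : j = i + 1 := by
        have := congrArg Neg.neg hij
        simp only [neg_sub, neg_neg] at this
        rw [← this]; ring
      have n1 : i + 1 + 1 ≠ i + 1 := hn.add_one_ne _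
      have n2 : i + 1 ≠ i := hn.add_one_ne _
      have n3 : i ≠ i + 1 + 1 := by rw [add_assoc]; simpa using h2
      rw [← (up_down n1).eq]
      exact serre_mul (site_serre_up (i + 1)) (up_down n2).symm (down_down _ _)
        (up_up _ _) (up_down n3.symm).symm

/-- The module `𝓦(x)` over the quantum affine algebra. -/
def oscRep (hn : Admissible n r) (x : GFˣ) : Uq n r →ₐ[GF] Module.End GF (OscSpace n) :=
  Uq.lift (osc_relations hn x)

/-- `l(m) = (m_{r+1} + ⋯ + m_n) - (m_1 + ⋯ + m_r)`. -/
def charge (r : ℕ) (m : ZMod n → ℕ) : ℤ :=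
  ∑ j ∈ Finset.Icc (r + 1) n, (m (j : ZMod n) : ℤ) - ∑ i ∈ Finset.Icc 1 r, (m (i : ZMod n) : ℤ)

/-- The subspace `𝓦_l`, spanned by the `|m⟩` with `l(m) = l`. -/
def Fund (n r : ℕ) (l : ℤ) : Submodule GF (OscSpace n) :=
  Submodule.span GF (ket '' {m | charge r m = l})

theorem charge_eq_sum (hn : Admissible n r) (m : ZMod n → ℕ) :
    charge r m = ∑ j ∈ Finset.Icc 1 n, (if IsLow r (j : ZMod n) then -(m (j : ZMod n) : ℤ)
      else (m (j : ZMod n) : ℤ)) := by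
  have h1 := hn.two_le
  have h2 := hn.add_two_le
  have hlow : ∀ j ∈ Finset.Icc 1 r, IsLow r (j : ZMod n) := by
    intro j hj
    rw [Finset.mem_Icc] at hj
    have hv : (j : ZMod n).val = j := ZMod.val_natCast_of_lt (by omega)
    refine ⟨fun h => ?_, by omega⟩
    rw [h, ZMod.val_zero] at hv
    omega
  have hhigh : ∀ j ∈ Finset.Icc (r + 1) n, ¬ IsLow r (j : ZMod n) := by
    intro j hj hl
    rw [Finset.mem_Icc] at hj
    rcases hj.2.eq_or_lt with h | h
    · exact hl.1 (by rw [h, ZMod.natCast_self])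
    · have hv : (j : ZMod n).val = j := ZMod.val_natCast_of_lt h
      have := hl.2
      omega
  have hunion : Finset.Icc 1 n = Finset.Icc 1 r ∪ Finset.Icc (r + 1) n := by
    ext j; simp only [Finset.mem_union, Finset.mem_Icc]; omega
  have hdisj : Disjoint (Finset.Icc 1 r) (Finset.Icc (r + 1) n) := by
    rw [Finset.disjoint_left]; intro j; simp only [Finset.mem_Icc]; omega
  rw [hunion, Finset.sum_union hdisj, Finset.sum_congr rfl fun j hj => if_pos (hlow j hj),
    Finset.sum_congr rfl fun j hj => if_neg (hhigh j hj), Finset.sum_neg_distrib, charge]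
  ring

theorem charge_add_eps (hn : Admissible n r) (a : ZMod n) (m : ZMod n → ℕ) :
    charge r (m + eps a) = charge r m + if IsLow r a then -1 else 1 := by
  have := hn.neZero
  have h2 := hn.add_two_le
  have ha := ZMod.val_lt a
  have hcast : ((a.val : ℕ) : ZMod n) = a := ZMod.natCast_zmod_val a
  obtain ⟨j₀, hj₀, hj₀', huniq⟩ : ∃ j₀ ∈ Finset.Icc 1 n, (j₀ : ZMod n) = a ∧
      ∀ j ∈ Finset.Icc 1 n, (j : ZMod n) = a → j = j₀ := by
    refine ⟨if a.val = 0 then n else a.val, ?_, ?_, ?_⟩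
    · rw [Finset.mem_Icc]; split_ifs <;> omega
    · split_ifs with h
      · rw [ZMod.natCast_self, ← hcast, h, Nat.cast_zero]
      · exact hcast
    · intro j hj hja
      rw [Finset.mem_Icc] at hj
      have hv : a.val = j % n := by rw [← hja, ZMod.val_natCast]
      rcases hj.2.eq_or_lt with h | h
      · rw [h, Nat.mod_self] at hv
        rw [if_pos hv, h]
      · rw [Nat.mod_eq_of_lt h] at hv
        rw [if_neg (by omega), hv]
  rw [charge_eq_sum hn, charge_eq_sum hn, ← Finset.add_sum_erase _ _ hj₀,
    ← Finset.add_sum_erase _ _ hj₀]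
  have herase : ∀ j ∈ (Finset.Icc 1 n).erase j₀, (m + eps a) (j : ZMod n) = m (j : ZMod n) := by
    intro j hj
    rw [Finset.mem_erase] at hj
    rw [Pi.add_apply, eps_ne (fun h => hj.1 (huniq j hj.2 h.symm)), add_zero]
  rw [Finset.sum_congr rfl fun j hj => by rw [herase j hj], hj₀', Pi.add_apply, eps_self]
  split_ifs <;> push_cast <;> ring

theorem fund_ket {l : ℤ} {m : ZMod n → ℕ} (h : charge r m = l) : ket m ∈ Fund n r l :=
  Submodule.subset_span ⟨m, h, rfl⟩

theorem up_ket_mem (hn : Admissible n r) {l : ℤ} (a : ZMod n) {v : OscSpace n}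
    (hv : v ∈ Fund n r l) : up r a v ∈ Fund n r (l + 1) := by
  induction hv using Submodule.span_induction with
  | zero => rw [map_zero]; exact Submodule.zero_mem _
  | add _ _ _ _ h1 h2 => rw [map_add]; exact Submodule.add_mem _ h1 h2
  | smul c _ _ h1 => rw [map_smul]; exact Submodule.smul_mem _ _ h1
  | mem _ h =>
    obtain ⟨m, hm, rfl⟩ := h
    unfold up
    split_ifs with ha
    · rw [lower_ket]
      by_cases h0 : m a = 0
      · rw [h0, qInt_zero, zero_smul]; exact Submodule.zero_mem _
      · refine Submodule.smul_mem _ _ (fund_ket ?_)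
        have e1 := charge_add_eps hn a (m - eps a)
        rw [sub_add_eps h0, if_pos ha] at e1
        have e2 : charge r m = l := hm
        linarith
    · rw [raise_ket]
      refine fund_ket ?_
      have e2 : charge r m = l := hm
      rw [charge_add_eps hn, if_neg ha, e2]

theorem down_ket_mem (hn : Admissible n r) {l : ℤ} (a : ZMod n) {v : OscSpace n}
    (hv : v ∈ Fund n r l) : down r a v ∈ Fund n r (l - 1) := by
  induction hv using Submodule.span_induction with
  | zero => rw [map_zero]; exact Submodule.zero_mem _
  | add _ _ _ _ h1 h2 => rw [map_add]; exact Submodule.add_mem _ h1 h2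
  | smul c _ _ h1 => rw [map_smul]; exact Submodule.smul_mem _ _ h1
  | mem _ h =>
    obtain ⟨m, hm, rfl⟩ := h
    unfold down
    split_ifs with ha
    · rw [raise_ket]
      refine fund_ket ?_
      have e2 : charge r m = l := hm
      rw [charge_add_eps hn, if_pos ha, e2]; ring
    · rw [lower_ket]
      by_cases h0 : m a = 0
      · rw [h0, qInt_zero, zero_smul]; exact Submodule.zero_mem _
      · refine Submodule.smul_mem _ _ (fund_ket ?_)
        have e1 := charge_add_eps hn a (m - eps a)
        rw [sub_add_eps h0, if_neg ha] at e1
        have e2 : charge r m = l := hm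
        linarith

/-- `𝓦_l` is invariant. -/
theorem oscRep_mem (hn : Admissible n r) (x : GFˣ) (l : ℤ) (a : Uq n r) :
    ∀ v ∈ Fund n r l, oscRep hn x a v ∈ Fund n r l := by
  induction a using Uq.induction with
  | hs c =>
    intro v hv
    rw [AlgHom.commutes, Module.algebraMap_end_apply]
    exact Submodule.smul_mem _ _ hv
  | hK h =>
    intro v hv
    rw [oscRep, Uq.lift_K]
    induction hv using Submodule.span_induction with
    | zero => rw [map_zero]; exact Submodule.zero_mem _
    | add _ _ _ _ h1 h2 => rw [map_add]; exact Submodule.add_mem _ h1 h2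
    | smul c _ _ h1 => rw [map_smul]; exact Submodule.smul_mem _ _ h1
    | mem _ h =>
      obtain ⟨m, hm, rfl⟩ := h
      rw [oscK_ket]
      exact Submodule.smul_mem _ _ (fund_ket hm)
  | hE i =>
    intro v hv
    rw [oscRep, Uq.lift_E, oscE_eq hn]
    refine Submodule.smul_mem _ _ ?_
    have := up_ket_mem hn i (down_ket_mem hn (i + 1) hv)
    rwa [sub_add_cancel] at this
  | hF i =>
    intro v hv
    rw [oscRep, Uq.lift_F, oscF_eq hn]
    refine Submodule.smul_mem _ _ ?_
    have := down_ket_mem hn i (up_ket_mem hn (i + 1) hv)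
    rwa [add_sub_cancel_right] at this
  | hmul a b ha hb =>
    intro v hv
    rw [map_mul]
    exact ha _ (hb _ hv)
  | hadd a b ha hb =>
    intro v hv
    rw [map_add]
    exact Submodule.add_mem _ (ha _ hv) (hb _ hv)

/-- The restriction of a representation to an invariant subspace. -/
def restrictRep {A V : Type*} [Ring A] [Algebra GF A] [AddCommGroup V] [Module GF V]
    (ρ : A →ₐ[GF] Module.End GF V) (p : Submodule GF V) (h : ∀ a, ∀ v ∈ p, ρ a v ∈ p) :
    A →ₐ[GF] Module.End GF p :=
  AlgHom.ofLinearMap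
    { toFun := fun a => (ρ a).restrict (h a)
      map_add' := fun a b => by ext v; simp
      map_smul' := fun c a => by ext v; simp }
    (by ext v; simp) (fun a b => by ext v; simp)

/-- The fundamental `q`-oscillator representation `𝓦_l(x)`. -/
def fundRep (hn : Admissible n r) (l : ℤ) (x : GFˣ) :
    Uq n r →ₐ[GF] Module.End GF (Fund n r l) :=
  restrictRep (oscRep hn x) (Fund n r l) (oscRep_mem hn x l)

/-! ## Modules as types, and the subalgebra `U_q(gl_n)` -/

/-- The module that belongs to a representation. -/
def RepMod {A V : Type*} [Ring A] [Algebra GF A] [AddCommGroup V] [Module GF V]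
    (_ρ : A →ₐ[GF] Module.End GF V) : Type _ := V

section RepMod

variable {A V : Type*} [Ring A] [Algebra GF A] [AddCommGroup V] [Module GF V]
  (ρ : A →ₐ[GF] Module.End GF V)

instance : AddCommGroup (RepMod ρ) := inferInstanceAs (AddCommGroup V)

/-- `a • v = ρ(a) v`. -/
instance : Module A (RepMod ρ) := Module.compHom V ρ.toRingHom

end RepMod

/-- The generators of `U_q(gl_n)`: all `q^h`, and `e_i`, `f_i` for `i ≠ 0`. -/
def glGenerators (n r : ℕ) : Set (Uq n r) :=
  Set.range (Uq.K r) ∪ (Uq.E r '' {i | i ≠ 0} ∪ Uq.F r '' {i | i ≠ 0})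

/-- The subalgebra `U_q(gl_n)` of the quantum affine algebra. -/
def UqGl (n r : ℕ) : Subalgebra GF (Uq n r) := Algebra.adjoin GF (glGenerators n r)

/-- `q^h` as an element of `U_q(gl_n)`. -/
def UqGl.K (r : ℕ) (h : CoWt n) : UqGl n r :=
  ⟨Uq.K r h, Algebra.subset_adjoin (Or.inl ⟨h, rfl⟩)⟩

/-- `e_i`, `i ≠ 0`, as an element of `U_q(gl_n)`. -/
def UqGl.E (r : ℕ) (i : ZMod n) (hi : i ≠ 0) : UqGl n r :=
  ⟨Uq.E r i, Algebra.subset_adjoin (Or.inr (Or.inl ⟨i, hi, rfl⟩))⟩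

/-! ## Weights -/

/-- A set of weights is finitely dominated if it lies in a finite union of sets
`{μ | μ ≤ γ}`, where `μ ≤ γ` means that `γ - μ` is a sum of the given simple roots. -/
def FinitelyDominated {M : Type*} [AddCommGroup M] (roots : Set M) (wts : Set M) : Prop :=
  ∃ S : Set M, S.Finite ∧ ∀ μ ∈ wts, ∃ γ ∈ S, γ - μ ∈ AddSubmonoid.closure roots

/-- `V` is the direct sum of the spaces `W μ`, these are finite-dimensional, and the set of the
`μ` with `W μ ≠ 0` is finitely dominated. -/
def GoodWeights {M V : Type*} [AddCommGroup M] [AddCommGroup V] [Module GF V] (roots : Set M)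
    (W : M → Submodule GF V) : Prop :=
  iSupIndep W ∧ ⨆ μ, W μ = ⊤ ∧ (∀ μ, FiniteDimensional GF (W μ)) ∧
    FinitelyDominated roots {μ | W μ ≠ ⊥}

/-- The weight space `V_μ = {v | q^h v = q^{⟨μ, h⟩} v for all h ∈ P^∨}`. -/
def weightSpace {V : Type*} [AddCommGroup V] [Module GF V] (ρ : Uq n r →ₐ[GF] Module.End GF V)
    (μ : Wt n) : Submodule GF V where
  carrier := {v | ∀ h : CoWt n, ρ (Uq.K r h) v = q ^ (h μ) • v}
  add_mem' ha hb h := by rw [map_add, ha h, hb h, smul_add]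
  zero_mem' h := by rw [map_zero, smul_zero]
  smul_mem' c v hv h := by rw [map_smul, hv h, smul_comm]

/-- The weight lattice `P_fin = P / ℤ (Λ_r - δ_1 - ⋯ - δ_r)` of `gl_n`, in coordinates with respect
to its basis, the images of `δ_1, …, δ_n`. -/
abbrev WtFin (n : ℕ) : Type := ZMod n → ℤ

/-- The projection from `P` to `P_fin`, which sends `Λ_r` to the image of `δ_1 + ⋯ + δ_r`. -/
def toFin (n r : ℕ) : Wt n →ₗ[ℤ] WtFin n where
  toFun w := fun i => w.2 i + if IsLow r i then w.1 else 0
  map_add' v w := by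
    funext i
    by_cases hi : IsLow r i <;> simp [hi]
    ring
  map_smul' c w := by
    funext i
    by_cases hi : IsLow r i <;> simp [hi]
    ring

/-- The basis of `P_fin^∨ ⊆ P^∨` dual to the basis of `P_fin`: `δ_i^∨ + c` for `1 ≤ i ≤ r` and
`δ_i^∨` for `r < i ≤ n`. -/
def finVee (r : ℕ) (i : ZMod n) : CoWt n := deltaVee i + if IsLow r i then cVee else 0

theorem toFin_apply (w : Wt n) (i : ZMod n) : toFin n r w i = finVee r i w := by
  by_cases hi : IsLow r i <;> simp [toFin, finVee, deltaVee, cVee, hi]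

theorem toFin_surjective : Function.Surjective (toFin n r) :=
  fun v => ⟨(0, v), by funext i; simp [toFin]⟩

theorem toFin_eq_zero_iff (hn : Admissible n r) (w : Wt n) :
    toFin n r w = 0 ↔ ∃ c : ℤ, w = c • (LambdaR - ∑ i ∈ Finset.Icc 1 r, delta (i : ZMod n)) := by
  have h2 := hn.add_two_le
  have := hn.neZero
  have key : ∀ j : ZMod n, ∑ i ∈ Finset.Icc 1 r, (Pi.single (i : ZMod n) (1 : ℤ) : ZMod n → ℤ) j
      = if IsLow r j then 1 else 0 := by
    intro j
    have hval : ∀ i ∈ Finset.Icc 1 r, ((i : ZMod n) = j ↔ i = j.val) := by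
      intro i hi
      rw [Finset.mem_Icc] at hi
      constructor
      · rintro rfl
        rw [ZMod.val_natCast_of_lt (by omega)]
      · rintro rfl
        exact ZMod.natCast_zmod_val j
    rw [Finset.sum_congr rfl (g := fun i => if i = j.val then (1 : ℤ) else 0)
      (fun i hi => by simp only [Pi.single_apply, eq_comm (a := j), hval i hi])]
    rw [Finset.sum_ite_eq']
    have : (j.val ∈ Finset.Icc 1 r) ↔ IsLow r j := by
      rw [Finset.mem_Icc, IsLow, Ne, ← ZMod.val_eq_zero]; omega
    simp only [this]
  have key2 : ∀ j : ZMod n, (∑ i ∈ Finset.Icc 1 r, delta (i : ZMod n)).2 j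
      = if IsLow r j then 1 else 0 := by
    intro j
    rw [Prod.snd_sum, Finset.sum_apply]
    exact key j
  have key1 : (∑ i ∈ Finset.Icc 1 r, delta (i : ZMod n)).1 = 0 := by
    rw [Prod.fst_sum]; simp [delta]
  constructor
  · intro h
    refine ⟨w.1, Prod.ext ?_ (funext fun j => ?_)⟩
    · simp [LambdaR, key1]
    · have hj := congrFun h j
      simp only [toFin, LinearMap.coe_mk, AddHom.coe_mk, Pi.zero_apply] at hj
      simp only [Prod.smul_snd, Prod.snd_sub, Pi.smul_apply, Pi.sub_apply, key2, LambdaR]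
      split_ifs at hj ⊢ <;> simp <;> linarith
  · rintro ⟨c, rfl⟩
    funext j
    simp only [toFin, LinearMap.coe_mk, AddHom.coe_mk, Pi.zero_apply, Prod.smul_snd,
      Prod.snd_sub, Pi.smul_apply, Pi.sub_apply, key2, LambdaR, Prod.smul_fst, Prod.fst_sub, key1]
    split_ifs <;> simp

/-- The elements `finVee` satisfy `δ̄_n^∨ = δ_n^∨` and `δ̄_i^∨ = δ̄_{i+1}^∨ + α_i^∨` for
`1 ≤ i ≤ n - 1`. -/
theorem finVee_eq (hn : Admissible n r) (i : ZMod n) (hi : i ≠ 0) :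
    finVee r (0 : ZMod n) = deltaVee 0 ∧ finVee r i = finVee r (i + 1) + alphaVee r i := by
  refine ⟨by simp [finVee, IsLow], ?_⟩
  rcases hn.cases i with ⟨h, a, b⟩ | ⟨h, h', a, b⟩ | ⟨h, h', h'', a, b⟩ | ⟨h, h', h'', a, b⟩
  · exact absurd h hi
  · simp only [finVee, alphaVee, a, b, if_pos h', if_neg h, if_true, if_false]
    simp; abel
  · simp only [finVee, alphaVee, a, b, if_neg h', if_neg h, if_true]
    simp; abel
  · simp only [finVee, alphaVee, a, b, if_neg h', if_neg h, if_false]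
    simp

/-- The weight space of a `U_q(gl_n)`-module for a weight in `P_fin`: `q^h` acts by
`q^{⟨μ, h⟩}` for all `h` in (equivalently, for the basis of) `P_fin^∨`. -/
def finWeightSpace {V : Type*} [AddCommGroup V] [Module GF V]
    (σ : UqGl n r →ₐ[GF] Module.End GF V) (μ : WtFin n) : Submodule GF V where
  carrier := {v | ∀ i : ZMod n, σ (UqGl.K r (finVee r i)) v = q ^ (μ i) • v}
  add_mem' ha hb h := by rw [map_add, ha h, hb h, smul_add]
  zero_mem' h := by rw [map_zero, smul_zero]
  smul_mem' c v hv h := by rw [map_smul, hv h, smul_comm]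

/-! ## The categories of `q`-oscillator representations -/

/-- `λ = (λ_1 ≥ ⋯ ≥ λ_ℓ)` is a generalized partition of length `ℓ` with at most `r` negative and
at most `n - r` positive parts. The part `λ_{i+1}` is `lam i`. -/
def IsOscPartition (n r : ℕ) {ℓ : ℕ} (lam : Fin ℓ → ℤ) : Prop :=
  Antitone lam ∧ (Finset.univ.filter fun i => lam i < 0).card ≤ r ∧
    (Finset.univ.filter fun i => 0 < lam i).card ≤ n - r

/-- The weight `Λ_λ = -ℓ Λ_r + ∑ λ_i δ_{r+i} + ∑ λ_j δ_{r-ℓ+j}`, where the first sum is over the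
positive parts `λ_i` and the second one over the negative parts `λ_j`. -/
def oscWt (n r : ℕ) {ℓ : ℕ} (lam : Fin ℓ → ℤ) : Wt n :=
  -(ℓ : ℤ) • LambdaR + ∑ i : Fin ℓ,
    if 0 < lam i then lam i • delta (((r : ℤ) + ((i : ℤ) + 1) : ℤ) : ZMod n)
    else if lam i < 0 then lam i • delta (((r : ℤ) - ℓ + ((i : ℤ) + 1) : ℤ) : ZMod n)
    else 0

/-- `M` is the irreducible highest weight `U_q(gl_n)`-module with highest weight `γ` (up to
isomorphism): it is simple and has a highest weight vector of weight `γ`. -/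
def IsIrreducibleHW (n r : ℕ) (M : Type*) [AddCommGroup M] [Module (UqGl n r) M] (γ : Wt n) :
    Prop :=
  IsSimpleModule (UqGl n r) M ∧ ∃ v : M, v ≠ 0 ∧
    (∀ h : CoWt n, UqGl.K r h • v = algebraMap GF (UqGl n r) (q ^ (h γ)) • v) ∧
    ∀ (i : ZMod n) (hi : i ≠ 0), UqGl.E r i hi • v = 0

/-- `N` is a direct sum of irreducible highest weight modules with highest weights `Λ_λ`, for
generalized partitions `λ` of length `ℓ` as above, each with finite multiplicity. -/
def IsLevelSum {M : Type*} [AddCommGroup M] [Module (UqGl n r) M] (ℓ : ℕ)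
    (N : Submodule (UqGl n r) M) : Prop :=
  ∃ S : Set (Submodule (UqGl n r) M), sSupIndep S ∧ sSup S = N ∧
    (∀ L ∈ S, ∃ lam : Fin ℓ → ℤ, IsOscPartition n r lam ∧ IsIrreducibleHW n r L (oscWt n r lam)) ∧
    ∀ lam : Fin ℓ → ℤ, IsOscPartition n r lam →
      {L ∈ S | IsIrreducibleHW n r L (oscWt n r lam)}.Finite

/-- The `U_q(gl_n)`-module given by `σ` lies in the category `𝓞_osc`. -/
def InOsc {V : Type*} [AddCommGroup V] [Module GF V] (σ : UqGl n r →ₐ[GF] Module.End GF V) :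
    Prop :=
  GoodWeights {a | ∃ i : ZMod n, i ≠ 0 ∧ a = toFin n r (alpha i)} (finWeightSpace σ) ∧
  ∃ N : ℕ → Submodule (UqGl n r) (RepMod σ),
    iSupIndep N ∧ ⨆ ℓ, N ℓ = ⊤ ∧ N 0 = ⊥ ∧ (∀ ℓ, 1 ≤ ℓ → IsLevelSum ℓ (N ℓ)) ∧
    ∃ B : ℕ, ∀ ℓ, B ≤ ℓ → N ℓ = ⊥

/-- The module over the quantum affine algebra given by `ρ` lies in the category `\hat{𝓞}_osc`. -/
def InOscHat {V : Type*} [AddCommGroup V] [Module GF V] (ρ : Uq n r →ₐ[GF] Module.End GF V) :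
    Prop :=
  GoodWeights {a | ∃ i : ZMod n, i ≠ 0 ∧ a = alpha i} (weightSpace ρ) ∧
  InOsc (ρ.comp (UqGl n r).val)

end QOsc

end

noncomputable section

open scoped TensorProduct

namespace QOsc

variable {n r : ℕ}

/-! ## A real place of the ground field -/

/-! Two facts carry the proof. The first is a contravariant bilinear form on `𝓦_l ⊗ 𝓦_m` for which
the vectors `|x⟩ ⊗ |y⟩` are orthogonal and the adjoint of `e_i` is a multiple of `f_i k_i⁻¹`.
Sending `q` to a transcendental real number `tau > 1` embeds the ground field into `ℝ`, and there
all square lengths are positive. The form is therefore anisotropic, and since weight spaces are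
finite-dimensional, every submodule, over the affine algebra or over `U_q(gl_n)`, has its orthogonal
complement as a complement (`isCompl_perp`).

The second is a combinatorial description of the `U_q(gl_n)`-highest weight vectors (`hwShape`,
`HWShape.cases`, `HWShape.base`). Annihilation by `e_i`, `i ≠ 0`, gives two-term relations between
coefficients: particles are transported towards the nodes `r` and `r + 1`, and at `r` itself a pair
is exchanged between the two factors. Chains of two transports empty the outer sites, and a
transport next to `r` combined with the pair exchange has non-trivial holonomy around a square
(`Transport.square`). The total occupation numbers thus live on two adjacent sites, and one
particular coefficient of a highest weight vector never vanishes. Hence all highest weights come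
from generalized partitions of length two, with multiplicity one, which together with semisimplicity
gives membership in the category.

For irreducibility, take a vector `v` of maximal height in a non-zero submodule `N`. All vectors of
`𝓦_l ⊗ 𝓦_m` of larger height are orthogonal to `N`, and so is everything that they generate. For `i`
equal to `r - 1`, `r` or `r + 1` and `|x⟩ ⊗ |y⟩` supported on the sites `i`, `i + 1`, the product of
all `e_j` with `j ≠ i`, taken around the cycle in a suitable order starting at `e_0`, has the same
weight as `f_i` and acts by a different combination of the same two terms. Together they apply the
lowering operator to one tensor factor alone (`exists_lowering`). This kills every coefficient of
`v` except that of `|base l⟩ ⊗ |base m⟩` (`eq_base_of_coef_ne_zero`). So every non-zero submodule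
contains this one vector; a proper non-zero submodule and its orthogonal complement would share it,
contradicting anisotropy. -/

theorem exists_transcendental_gt_one : ∃ t : ℝ, 1 < t ∧ Transcendental ℚ t := by
  have hx : Transcendental ℚ (liouvilleNumber (2 : ℕ)) := by
    have h := transcendental_liouvilleNumber (le_refl 2)
    intro halg
    exact h ((IsFractionRing.isAlgebraic_iff ℤ ℚ ℝ).mpr halg)
  obtain ⟨N, hN⟩ := exists_nat_gt (1 - liouvilleNumber (2 : ℕ))
  -- A Liouville number is transcendental, and adding an integer makes it exceed `1` without losing
  -- that.
  refine ⟨liouvilleNumber (2 : ℕ) + N, by linarith, fun halg => hx ?_⟩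
  have h2 : IsAlgebraic ℚ ((N : ℝ)) := by exact_mod_cast isAlgebraic_natCast (R := ℚ) (A := ℝ) N
  simpa using halg.sub h2

/-- A transcendental real number greater than `1`. -/
def tau : ℝ := exists_transcendental_gt_one.choose

theorem one_lt_tau : 1 < tau := exists_transcendental_gt_one.choose_spec.1

theorem transcendental_tau : Transcendental ℚ tau := exists_transcendental_gt_one.choose_spec.2

/-- The real place of `ℚ(q)` that sends `q` to the transcendental number `tau`. -/
def phi : GF →+* ℝ :=
  RatFunc.liftRingHom (Polynomial.aeval tau : Polynomial ℚ →ₐ[ℚ] ℝ).toRingHom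
    (nonZeroDivisors_le_comap_nonZeroDivisors_of_injective _
      (transcendental_iff_injective.mp transcendental_tau))

theorem phi_q : phi q = tau := by
  have := RatFunc.liftRingHom_algebraMap (Polynomial.aeval tau : Polynomial ℚ →ₐ[ℚ] ℝ).toRingHom
    (nonZeroDivisors_le_comap_nonZeroDivisors_of_injective _
      (transcendental_iff_injective.mp transcendental_tau)) Polynomial.X
  rw [RatFunc.algebraMap_X] at this
  exact this.trans (Polynomial.aeval_X tau)

theorem tau_pos : 0 < tau := lt_trans one_pos one_lt_tau

theorem phi_q_zpow_pos (k : ℤ) : 0 < phi (q ^ k) := by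
  rw [map_zpow₀, phi_q]; exact zpow_pos tau_pos k

theorem q_zpow_ne_zero (k : ℤ) : q ^ k ≠ 0 := zpow_ne_zero k q_ne_zero

/-- The powers of `tau > 1` are distinct. Eigenvalues of the `q^h` therefore determine weights,
which is used wherever weight components are separated. -/
theorem q_zpow_injective : Function.Injective fun k : ℤ => q ^ k := by
  intro a b h
  have h2 := congrArg phi h
  simp only [map_zpow₀, phi_q] at h2
  exact zpow_right_injective₀ tau_pos one_lt_tau.ne' h2

theorem q_zpow_inj {a b : ℤ} : q ^ a = q ^ b ↔ a = b := q_zpow_injective.eq_iff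

theorem q_zpow_eq_one_iff {k : ℤ} : q ^ k = 1 ↔ k = 0 := by
  rw [← zpow_zero q, q_zpow_inj]

/-- At the real place `tau ^ k` increases with `k`, `tau⁻¹ ^ k` decreases, and the denominator is
positive. -/
theorem phi_qInt_strictMono : StrictMono fun k : ℕ => phi (qInt k) := by
  have h1 := one_lt_tau
  have h0 := tau_pos
  have hi : tau⁻¹ < 1 := inv_lt_one_of_one_lt₀ h1
  have hd : 0 < tau - tau⁻¹ := by linarith
  refine strictMono_nat_of_lt_succ fun k => ?_
  simp only [qInt, map_div₀, map_sub, map_pow, map_inv₀, phi_q]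
  refine div_lt_div_of_pos_right ?_ hd
  have a : tau ^ k < tau ^ (k + 1) := pow_lt_pow_right₀ h1 (Nat.lt_succ_self k)
  have b : tau⁻¹ ^ (k + 1) ≤ tau⁻¹ ^ k :=
    pow_le_pow_of_le_one (inv_pos.mpr h0).le hi.le (Nat.le_succ k)
  linarith

theorem phi_qInt_pos {k : ℕ} (hk : k ≠ 0) : 0 < phi (qInt k) := by
  have := phi_qInt_strictMono (Nat.pos_of_ne_zero hk)
  simpa [qInt_zero] using this

theorem qInt_ne_zero {k : ℕ} (hk : k ≠ 0) : qInt k ≠ 0 := fun h => by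
  have := phi_qInt_pos hk
  rw [h, map_zero] at this
  exact this.false

theorem qInt_succ_ne_zero (k : ℕ) : qInt (k + 1) ≠ 0 := qInt_ne_zero k.succ_ne_zero

/-- This inequality is the non-trivial holonomy in `Transport.square`; it follows from strict
monotonicity at the real place. -/
theorem qInt_mul_qInt_ne (a b : ℕ) :
    qInt (a + 1) * qInt (b + 1) ≠ qInt (a + 2) * qInt (b + 2) := by
  intro h
  have h2 := congrArg phi h
  rw [map_mul, map_mul] at h2
  exact (mul_lt_mul'' (phi_qInt_strictMono (Nat.lt_succ_self (a + 1)))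
    (phi_qInt_strictMono (Nat.lt_succ_self (b + 1)))
    (phi_qInt_pos a.succ_ne_zero).le (phi_qInt_pos b.succ_ne_zero).le).ne h2

/-! ## Combinatorics of the coefficients of highest weight vectors -/

theorem eps_apply (a c : ZMod n) : eps a c = if c = a then 1 else 0 := by
  simp [eps, Pi.single_apply]

/-- The relations between the coefficients `f x y` of a vector that is annihilated by the
operator which moves a particle from site `a` to site `b`. -/
structure Transport (f : (ZMod n → ℕ) → (ZMod n → ℕ) → GF) (a b : ZMod n) : Prop where
  ne : a ≠ b
  swap : ∀ x y, qInt (y a + 1) * f (x + eps b) (y + eps a)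
    + qInt (x a + 1) * q ^ ((y a : ℤ) - y b - 1) * f (x + eps a) (y + eps b) = 0
  left : ∀ x y, x b = 0 → f x (y + eps a) = 0
  right : ∀ x y, y b = 0 → f (x + eps a) y = 0

/-- The relations between the coefficients `f x y` of a vector that is annihilated by the
operator which removes one particle from site `b` and one from site `d`. -/
structure PairRel (f : (ZMod n → ℕ) → (ZMod n → ℕ) → GF) (b d : ZMod n) : Prop where
  ne : b ≠ d
  rel : ∀ x y, qInt (y b + 1) * qInt (y d + 1) * f x (y + eps b + eps d)
    + qInt (x b + 1) * qInt (x d + 1) * q ^ ((y b : ℤ) + y d + 1) * f (x + eps b + eps d) y = 0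

/-- The relations between the non-vanishing coefficients that follow from `Transport`. -/
structure Moves (N : (ZMod n → ℕ) → (ZMod n → ℕ) → Prop) (a b : ZMod n) : Prop where
  ne : a ≠ b
  swap : ∀ x y, N (x + eps b) (y + eps a) ↔ N (x + eps a) (y + eps b)
  left : ∀ x y, x b = 0 → ¬ N x (y + eps a)
  right : ∀ x y, y b = 0 → ¬ N (x + eps a) y

/-- The coefficients in the two-term relation are non-zero, so one of the two values of `f` vanishes
exactly when the other does. From here on mostly the support matters. -/
theorem Transport.moves {f : (ZMod n → ℕ) → (ZMod n → ℕ) → GF} {a b : ZMod n}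
    (h : Transport f a b) : Moves (fun x y => f x y ≠ 0) a b where
  ne := h.ne
  swap x y := by
    have h1 := h.swap x y
    have h2 := qInt_succ_ne_zero (y a)
    have h3 := mul_ne_zero (qInt_succ_ne_zero (x a)) (q_zpow_ne_zero ((y a : ℤ) - y b - 1))
    refine not_congr ⟨fun h0 => ?_, fun h0 => ?_⟩
    · rw [h0, mul_zero, zero_add] at h1
      exact (mul_eq_zero.mp h1).resolve_left h3
    · rw [h0, mul_zero, add_zero] at h1
      exact (mul_eq_zero.mp h1).resolve_left h2
  left x y hx := not_not.mpr (h.left x y hx)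
  right x y hx := not_not.mpr (h.right x y hx)

theorem PairRel.iff {f : (ZMod n → ℕ) → (ZMod n → ℕ) → GF} {b d : ZMod n}
    (h : PairRel f b d) (x y : ZMod n → ℕ) :
    f (x + eps b + eps d) y ≠ 0 ↔ f x (y + eps b + eps d) ≠ 0 := by
  have h1 := h.rel x y
  have h2 := mul_ne_zero (qInt_succ_ne_zero (y b)) (qInt_succ_ne_zero (y d))
  have h3 := mul_ne_zero (mul_ne_zero (qInt_succ_ne_zero (x b)) (qInt_succ_ne_zero (x d)))
    (q_zpow_ne_zero ((y b : ℤ) + y d + 1))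
  refine not_congr ⟨fun h0 => ?_, fun h0 => ?_⟩
  · rw [h0, mul_zero, add_zero] at h1
    exact (mul_eq_zero.mp h1).resolve_left h2
  · rw [h0, mul_zero, zero_add] at h1
    exact (mul_eq_zero.mp h1).resolve_left h3

/-- The relations of a transport `a → b` and of a pair `{b, d}` are not compatible around a
square. -/
theorem Transport.square {f : (ZMod n → ℕ) → (ZMod n → ℕ) → GF} {a b d : ZMod n}
    (h : Transport f a b) (hp : PairRel f b d) (had : a ≠ d) (x y : ZMod n → ℕ) :
    f (x + eps a) (y + eps b + eps b + eps d) = 0 ∧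
      f (x + eps b + eps b + eps d) (y + eps a) = 0 := by
  have hab := h.ne
  have hbd := hp.ne
  have t1 := h.swap (x + eps b + eps d) y
  have t2 := h.swap x (y + eps b + eps d)
  have p1 := hp.rel (x + eps b) (y + eps a)
  have p2 := hp.rel (x + eps a) (y + eps b)
  simp only [Pi.add_apply, eps_self, eps_ne hab, eps_ne hab.symm, eps_ne hbd, eps_ne hbd.symm,
    eps_ne had, eps_ne had.symm, add_zero, Nat.cast_add, Nat.cast_one] at t1 t2 p1 p2
  have c1 : x + eps b + eps d + eps b = x + eps b + eps b + eps d := by abel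
  have c2 : x + eps b + eps d + eps a = x + eps a + eps b + eps d := by abel
  have c3 : y + eps b + eps d + eps a = y + eps a + eps b + eps d := by abel
  have c4 : y + eps b + eps d + eps b = y + eps b + eps b + eps d := by abel
  rw [c1, c2] at t1
  rw [c3, c4] at t2
  generalize f (x + eps b + eps b + eps d) (y + eps a) = f1 at *
  generalize f (x + eps a + eps b + eps d) (y + eps b) = f2 at *
  generalize f (x + eps b) (y + eps a + eps b + eps d) = f3 at *
  generalize f (x + eps a) (y + eps b + eps b + eps d) = f4 at *
  have hq := q_ne_zero
  have e1 : q ^ ((y a : ℤ) - y b - 1) = q ^ (y a) * (q ^ (y b))⁻¹ * q⁻¹ := by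
    rw [zpow_sub₀ hq, zpow_sub₀ hq, zpow_natCast, zpow_natCast, zpow_one, div_eq_mul_inv,
      div_eq_mul_inv]
  have e2 : q ^ ((y a : ℤ) - (y b + 1) - 1) = q ^ (y a) * (q ^ (y b))⁻¹ * q⁻¹ * q⁻¹ := by
    rw [zpow_sub₀ hq, zpow_sub₀ hq, zpow_add₀ hq, zpow_natCast, zpow_natCast, zpow_one]
    field_simp
  have e3 : q ^ ((y b : ℤ) + y d + 1) = q ^ (y b) * q ^ (y d) * q := by
    rw [zpow_add₀ hq, zpow_add₀ hq, zpow_natCast, zpow_natCast, zpow_one]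
  have e4 : q ^ ((y b : ℤ) + 1 + y d + 1) = q ^ (y b) * q ^ (y d) * q * q := by
    rw [zpow_add₀ hq, zpow_add₀ hq, zpow_add₀ hq, zpow_natCast, zpow_natCast, zpow_one]; ring
  rw [e1] at t1
  rw [e2] at t2
  rw [e3] at p1
  rw [e4] at p2
  have n1 := qInt_succ_ne_zero (y a)
  have n2 := qInt_succ_ne_zero (y b + 1)
  have n3 := qInt_succ_ne_zero (y d)
  have n4 := qInt_succ_ne_zero (x a)
  have n5 := qInt_succ_ne_zero (x d)
  have key := sub_ne_zero.mpr (qInt_mul_qInt_ne (x b) (y b))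
  have hqa : q ^ (y a) ≠ 0 := pow_ne_zero _ hq
  have hqb : q ^ (y b) ≠ 0 := pow_ne_zero _ hq
  have hqd : q ^ (y d) ≠ 0 := pow_ne_zero _ hq
  have e5 : x b + 1 + 1 = x b + 2 := rfl
  have e6 : y b + 1 + 1 = y b + 2 := rfl
  rw [e5] at p1
  rw [e6] at p2 n2
  -- The four relations form a cycle through `f1`, `f2`, `f4`, `f3`. Expressing all values through
  -- `f2` and closing the cycle with `p1` multiplies `f2` by `[x_b + 1][y_b + 1] - [x_b + 2][y_b +
  -- 2]`, up to a unit.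
  have f1e : f1 = -(qInt (x a + 1) * (q ^ (y a) * (q ^ (y b))⁻¹ * q⁻¹) * f2) / qInt (y a + 1) := by
    rw [eq_div_iff n1]; linear_combination t1
  have f4e : f4 = -(qInt (x b + 1) * qInt (x d + 1) * (q ^ (y b) * q ^ (y d) * q * q) * f2)
      / (qInt (y b + 2) * qInt (y d + 1)) := by
    rw [eq_div_iff (mul_ne_zero n2 n3)]; linear_combination p2
  have f3e : f3 = -(qInt (x a + 1) * (q ^ (y a) * (q ^ (y b))⁻¹ * q⁻¹ * q⁻¹) * f4)
      / qInt (y a + 1) := by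
    rw [eq_div_iff n1]; linear_combination t2
  have h2 : f2 = 0 := by
    rw [f3e, f4e, f1e] at p1
    field_simp at p1
    have : (qInt (x b + 1) * qInt (y b + 1) - qInt (x b + 2) * qInt (y b + 2)) * f2 = 0 := by
      refine (mul_eq_zero.mp
        (?_ : (qInt (x a + 1) * q ^ y a * qInt (x d + 1) * q ^ y d) * _ = 0)).resolve_left
        (mul_ne_zero (mul_ne_zero (mul_ne_zero n4 hqa) n5) hqd)
      linear_combination p1
    exact (mul_eq_zero.mp this).resolve_left key
  subst h2
  exact ⟨by rw [f4e]; simp, by rw [f1e]; simp⟩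

/-! ### Propagation of non-vanishing coefficients -/

variable {N : (ZMod n → ℕ) → (ZMod n → ℕ) → Prop} {a b c d : ZMod n}

/-- The powers of `q` break the symmetry between the tensor factors, but the support conditions keep
it; this halves the later arguments. -/
theorem Moves.flip (h : Moves N a b) : Moves (fun x y => N y x) a b where
  ne := h.ne
  swap x y := (h.swap y x).symm
  left x y hx := h.right y x hx
  right x y hx := h.left y x hx

theorem Moves.left_of (h : Moves N a b) {x y : ZMod n → ℕ} (hN : N x y) (hx : x b = 0) :
    y a = 0 := by
  by_contra h0
  rw [← sub_add_eps h0] at hN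
  exact h.left _ _ hx hN

theorem Moves.right_of (h : Moves N a b) {x y : ZMod n → ℕ} (hN : N x y) (hy : y b = 0) :
    x a = 0 :=
  h.flip.left_of hN hy

/-- Move all particles of `x` at the source `a` to the target `b`. -/
theorem Moves.clear_source (h : Moves N a b) {x y : ZMod n → ℕ} (hN : N x y) :
    ∃ x' y', N x' y' ∧ x' a = 0 ∧ x' b = x b + x a ∧ y' a = y a + x a ∧ y' b + x a = y b ∧
      ∀ i, i ≠ a → i ≠ b → x' i = x i ∧ y' i = y i := by
  have hab := h.ne
  induction hk : x a generalizing x y with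
  | zero => exact ⟨x, y, hN, hk, rfl, rfl, rfl, fun i _ _ => ⟨rfl, rfl⟩⟩
  | succ k ih =>
    have hxa : x a ≠ 0 := by omega
    have hyb : y b ≠ 0 := fun h0 => hxa (h.right_of hN h0)
    rw [← sub_add_eps hxa, ← sub_add_eps hyb] at hN
    have hN' := (h.swap _ _).mpr hN
    obtain ⟨x', y', g1, g2, g3, g4, g5, g6⟩ := ih hN' (by simp [eps_self, eps_ne hab.symm, hk])
    simp only [Pi.add_apply, Pi.sub_apply, eps_self, eps_ne hab, eps_ne hab.symm] at g3 g4 g5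
    refine ⟨x', y', g1, g2, by omega, by omega, by omega, fun i hi hi' => ?_⟩
    have := g6 i hi hi'
    simpa [eps_ne hi.symm, eps_ne hi'.symm] using this

/-- Clearing site `a` of `x` takes `x a` particles away from site `b` of `y`, so they must have been
there. -/
theorem Moves.le_left (h : Moves N a b) {x y : ZMod n → ℕ} (hN : N x y) : x a ≤ y b := by
  obtain ⟨x', y', -, -, -, -, h5, -⟩ := h.clear_source hN
  omega

theorem Moves.total_le (h : Moves N a b) {x y : ZMod n → ℕ} (hN : N x y) :
    x a + y a ≤ x b + y b := by
  have h1 := h.le_left hN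
  have h2 := h.flip.le_left hN
  omega

/-- Two successive transports `a → b → c` force the site `a` to be empty. -/
theorem Moves.source_eq_zero (h : Moves N a b) (h' : Moves N b c) (hac : a ≠ c)
    {x y : ZMod n → ℕ} (hN : N x y) : x a + y a = 0 := by
  have key : ∀ {N : (ZMod n → ℕ) → (ZMod n → ℕ) → Prop}, Moves N a b → Moves N b c →
      ∀ {x y}, N x y → y a = 0 := by
    intro N h h' x y hN
    -- Emptying `b` in the first factor leaves site `a` untouched. With `b` empty there, the
    -- transport from `a` to `b` forbids particles at `a` in the second factor.
    obtain ⟨x', y', g1, g2, -, -, -, g6⟩ := h'.clear_source hN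
    rw [← (g6 a h.ne hac).2]
    exact h.left_of g1 g2
  rw [key h h' hN, key h.flip h'.flip hN]

/-- Non-vanishing is invariant under moving the pair `{b, d}`, and there is no square
`a → b`, `{b, d}`. -/
theorem Moves.source_or_partner_eq_zero (h : Moves N a b)
    (hp : ∀ x y, N (x + eps b + eps d) y ↔ N x (y + eps b + eps d)) (hbd : b ≠ d) (had : a ≠ d)
    (hs : ∀ x y, ¬ N (x + eps a) (y + eps b + eps b + eps d) ∧
      ¬ N (x + eps b + eps b + eps d) (y + eps a))
    {x y : ZMod n → ℕ} (hN : N x y) (ha : x a + y a ≠ 0) : x d + y d = 0 := by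
  have key : ∀ {N : (ZMod n → ℕ) → (ZMod n → ℕ) → Prop}, Moves N a b →
      (∀ x y, N (x + eps b + eps d) y ↔ N x (y + eps b + eps d)) →
      (∀ x y, ¬ N (x + eps b + eps b + eps d) (y + eps a)) →
      ∀ {x y}, N x y → x a + y a ≠ 0 → x d = 0 := by
    intro N h hp hs x y hN ha
    have hab := h.ne
    by_contra hd
    obtain ⟨x', y', g1, g2, g3, g4, -, g6⟩ := h.clear_source hN
    have hd' : x' d ≠ 0 := by rw [(g6 d had.symm hbd.symm).1]; exact hd
    have hya : y' a ≠ 0 := by omega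
    have hxb : x' b ≠ 0 := fun h0 => hya (h.left_of g1 h0)
    have hx1 : (x' - eps d) b ≠ 0 := by simpa [eps_ne hbd.symm] using hxb
    -- With a single particle at `b`, moving the pair `{b, d}` to the other factor empties `b` while
    -- `a` is still occupied there, against `left`. With at least two, the configuration is a corner
    -- excluded by `hs`.
    by_cases hb : x' b = 1
    · rw [← sub_add_eps hd', ← sub_add_eps hx1, hp] at g1
      have := h.left_of g1 (by simp [eps_self, eps_ne hbd.symm, hb])
      rw [Pi.add_apply, Pi.add_apply] at this
      omega
    · have hx2 : (x' - eps d - eps b) b ≠ 0 := by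
        simp only [Pi.sub_apply, eps_self, eps_ne hbd.symm]; omega
      rw [← sub_add_eps hd', ← sub_add_eps hx1, ← sub_add_eps hx2, ← sub_add_eps hya] at g1
      exact hs _ _ g1
  rw [key h hp (fun x y => (hs x y).2) hN ha,
    key h.flip (fun x y => (hp y x).symm) (fun x y => (hs y x).1) hN (by omega)]

/-- Move pairs `{b, d}` from `x` to `y` as long as possible. -/
theorem clear_pair (hp : ∀ x y, N (x + eps b + eps d) y ↔ N x (y + eps b + eps d)) (hbd : b ≠ d)
    {x y : ZMod n → ℕ} (hN : N x y) :
    ∃ x' y', N x' y' ∧ (x' b = 0 ∨ x' d = 0) ∧ ∀ i, i ≠ b → i ≠ d → x' i = x i := by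
  induction hk : x b generalizing x y with
  | zero => exact ⟨x, y, hN, Or.inl hk, fun i _ _ => rfl⟩
  | succ k ih =>
    by_cases hd : x d = 0
    · exact ⟨x, y, hN, Or.inr hd, fun i _ _ => rfl⟩
    have hx1 : (x - eps d) b ≠ 0 := by simp only [Pi.sub_apply, eps_ne hbd.symm]; omega
    rw [← sub_add_eps hd, ← sub_add_eps hx1, hp] at hN
    obtain ⟨x', y', g1, g2, g3⟩ := ih hN (by simp [eps_self, eps_ne hbd.symm, hk])
    refine ⟨x', y', g1, g2, fun i hi hi' => ?_⟩
    rw [g3 i hi hi']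
    simp [eps_ne hi.symm, eps_ne hi'.symm]

/-! ## The nodes next to `r` -/

theorem Admissible.isLow_r (hn : Admissible n r) : IsLow r (r : ZMod n) :=
  ⟨hn.r_ne_zero, hn.val_r.le⟩

theorem Admissible.not_isLow_zero : ¬ IsLow r (0 : ZMod n) := fun h => h.1 rfl

theorem Admissible.isLow_one (hn : Admissible n r) : IsLow r (1 : ZMod n) := by
  have h1 := hn.two_le
  have h2 := hn.add_two_le
  have : Fact (1 < n) := ⟨by omega⟩
  exact ⟨hn.one_ne_zero, by rw [ZMod.val_one]; omega⟩

theorem Admissible.not_isLow_r_add_one (hn : Admissible n r) : ¬ IsLow r ((r : ZMod n) + 1) := by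
  have h2 := hn.add_two_le
  intro h
  have h3 := h.2
  rw [hn.val_add_one, hn.val_r] at h3
  split_ifs at h3 <;> omega

theorem Admissible.isLow_r_sub_one (hn : Admissible n r) : IsLow r ((r : ZMod n) - 1) := by
  have h1 := hn.two_le
  have h2 := hn.add_two_le
  have hv := hn.val_add_one ((r : ZMod n) - 1)
  rw [sub_add_cancel, hn.val_r] at hv
  have hv' : ((r : ZMod n) - 1).val + 1 = r := by split_ifs at hv <;> omega
  refine ⟨fun h => ?_, by omega⟩
  rw [h, ZMod.val_zero] at hv'
  omega

theorem Admissible.not_isLow_r_add_two (hn : Admissible n r) :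
    ¬ IsLow r ((r : ZMod n) + 1 + 1) := by
  have h2 := hn.add_two_le
  intro h
  have h3 := h.2
  have h4 := h.1
  rw [Ne, ← ZMod.val_eq_zero] at h4
  rw [hn.val_add_one, hn.val_add_one, hn.val_r] at h3 h4
  split_ifs at h3 h4 <;> omega

theorem Admissible.isLow_succ (hn : Admissible n r) {i : ZMod n} (h : IsLow r i)
    (hi : i ≠ (r : ZMod n)) : IsLow r (i + 1) := by
  rcases hn.cases i with h' | h' | h' | h' <;> tauto

theorem Admissible.not_isLow_pred (hn : Admissible n r) {i : ZMod n} (h : ¬ IsLow r i)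
    (hi : i ≠ (r : ZMod n) + 1) : ¬ IsLow r (i - 1) ∧ i - 1 ≠ 0 := by
  have hi' : i - 1 ≠ (r : ZMod n) := fun h' => hi (by rw [← h']; ring)
  rcases hn.cases (i - 1) with h' | h' | h' | h' <;> simp only [sub_add_cancel] at h' <;> tauto

/-! ## The charge -/

theorem charge_zero : charge r (0 : ZMod n → ℕ) = 0 := by simp [charge]

theorem charge_add (x y : ZMod n → ℕ) : charge r (x + y) = charge r x + charge r y := by
  simp only [charge, Pi.add_apply, Nat.cast_add, Finset.sum_add_distrib]
  ring

theorem charge_nsmul (k : ℕ) (x : ZMod n → ℕ) : charge r (k • x) = k * charge r x := by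
  induction k with
  | zero => simp [charge_zero]
  | succ k ih => rw [succ_nsmul, charge_add, ih]; push_cast; ring

theorem charge_eps (hn : Admissible n r) (a : ZMod n) :
    charge r (eps a) = if IsLow r a then -1 else 1 := by
  have := charge_add_eps hn a 0
  rwa [zero_add, charge_zero, zero_add] at this

theorem eq_sum_eps [NeZero n] (x : ZMod n → ℕ) : x = ∑ a, x a • eps a := by
  funext c
  simp [Finset.sum_apply, eps_apply]

theorem charge_eq_univ_sum [NeZero n] (hn : Admissible n r) (x : ZMod n → ℕ) :
    charge r x = ∑ a, if IsLow r a then -(x a : ℤ) else (x a : ℤ) := by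
  have h : ∀ s : Finset (ZMod n), charge r (∑ a ∈ s, x a • eps a)
      = ∑ a ∈ s, if IsLow r a then -(x a : ℤ) else (x a : ℤ) := by
    intro s
    induction s using Finset.induction_on with
    | empty => simp [charge_zero]
    | insert a s ha ih =>
      rw [Finset.sum_insert ha, Finset.sum_insert ha, charge_add, ih, charge_nsmul, charge_eps hn]
      split_ifs <;> ring
  conv_lhs => rw [eq_sum_eps x]
  exact h _

/-- The vector of charge `l` supported on one of the nodes `r`, `r + 1`. -/
def base (n r : ℕ) (l : ℤ) : ZMod n → ℕ :=
  l.toNat • eps ((r : ZMod n) + 1) + (-l).toNat • eps (r : ZMod n)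

theorem charge_base (hn : Admissible n r) (l : ℤ) : charge r (base n r l) = l := by
  rw [base, charge_add, charge_nsmul, charge_nsmul, charge_eps hn, charge_eps hn,
    if_neg hn.not_isLow_r_add_one, if_pos hn.isLow_r]
  omega

/-- The charge is now `x (r + 1) - x r` with one of the two terms zero, so these are the positive
and the negative part of `l`. -/
theorem eq_base (hn : Admissible n r) {x : ZMod n → ℕ} {l : ℤ} (hl : charge r x = l)
    (hx : ∀ i, i ≠ (r : ZMod n) → i ≠ (r : ZMod n) + 1 → x i = 0)
    (h0 : x (r : ZMod n) = 0 ∨ x ((r : ZMod n) + 1) = 0) : x = base n r l := by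
  have hne := hn.add_one_ne (r : ZMod n)
  have e : x = x ((r : ZMod n) + 1) • eps ((r : ZMod n) + 1)
      + x (r : ZMod n) • eps (r : ZMod n) := by
    funext c
    by_cases h1 : c = (r : ZMod n)
    · subst h1; simp [eps_self, eps_ne hne]
    by_cases h2 : c = (r : ZMod n) + 1
    · subst h2; simp [eps_self, eps_ne hne.symm]
    rw [hx c h1 h2]; simp [eps_ne (Ne.symm h1), eps_ne (Ne.symm h2)]
  have hc := hl
  rw [e, charge_add, charge_nsmul, charge_nsmul, charge_eps hn, charge_eps hn,
    if_neg hn.not_isLow_r_add_one, if_pos hn.isLow_r] at hc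
  have a1 : l.toNat = x ((r : ZMod n) + 1) := by omega
  have a2 : (-l).toNat = x (r : ZMod n) := by omega
  rw [base, a1, a2]
  exact e

/-! ## The shape of highest weight vectors -/

/-- The properties of the non-vanishing coefficients of a highest weight vector of
`𝓦_l ⊗ 𝓦_m`, whose total occupation numbers are `t`. -/
structure HWShape (r : ℕ) (N : (ZMod n → ℕ) → (ZMod n → ℕ) → Prop) (l m : ℤ)
    (t : ZMod n → ℕ) : Prop where
  total : ∀ {x y}, N x y → x + y = t
  charge_left : ∀ {x y}, N x y → charge r x = l
  charge_right : ∀ {x y}, N x y → charge r y = m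
  low : ∀ i, IsLow r i → IsLow r (i + 1) → Moves N i (i + 1)
  high : ∀ i, i ≠ 0 → ¬ IsLow r i → ¬ IsLow r (i + 1) → Moves N (i + 1) i
  pair : ∀ x y, N (x + eps (r : ZMod n) + eps ((r : ZMod n) + 1)) y
    ↔ N x (y + eps (r : ZMod n) + eps ((r : ZMod n) + 1))
  square_low : ∀ x y,
    ¬ N (x + eps ((r : ZMod n) - 1)) (y + eps (r : ZMod n) + eps (r : ZMod n)
      + eps ((r : ZMod n) + 1)) ∧
    ¬ N (x + eps (r : ZMod n) + eps (r : ZMod n) + eps ((r : ZMod n) + 1))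
      (y + eps ((r : ZMod n) - 1))
  square_high : ∀ x y,
    ¬ N (x + eps ((r : ZMod n) + 1 + 1)) (y + eps ((r : ZMod n) + 1) + eps ((r : ZMod n) + 1)
      + eps (r : ZMod n)) ∧
    ¬ N (x + eps ((r : ZMod n) + 1) + eps ((r : ZMod n) + 1) + eps (r : ZMod n))
      (y + eps ((r : ZMod n) + 1 + 1))

section shape

variable {N : (ZMod n → ℕ) → (ZMod n → ℕ) → Prop} {l m : ℤ} {t : ZMod n → ℕ}

theorem HWShape.low_r (hn : Admissible n r) (h : HWShape r N l m t) :
    Moves N ((r : ZMod n) - 1) (r : ZMod n) := by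
  have := h.low _ hn.isLow_r_sub_one (by rw [sub_add_cancel]; exact hn.isLow_r)
  rwa [sub_add_cancel] at this

theorem HWShape.high_r (hn : Admissible n r) (h : HWShape r N l m t) :
    Moves N ((r : ZMod n) + 1 + 1) ((r : ZMod n) + 1) := by
  refine h.high _ (fun h0 => ?_) hn.not_isLow_r_add_one hn.not_isLow_r_add_two
  have h2 := hn.add_two_le
  have := hn.val_add_one (r : ZMod n)
  rw [h0, hn.val_r, ZMod.val_zero] at this
  split_ifs at this; omega

theorem Admissible.r_sub_one_ne (hn : Admissible n r) : (r : ZMod n) - 1 ≠ (r : ZMod n) := by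
  simpa using hn.one_ne_zero

theorem Admissible.add_two_ne (hn : Admissible n r) (i : ZMod n) : i + 1 + 1 ≠ i := by
  intro h
  exact hn.two_ne_zero (by rw [add_assoc] at h; simpa using h)

/-- The total occupation numbers of a highest weight vector are concentrated on two adjacent
nodes. -/
theorem HWShape.cases (hn : Admissible n r) (h : HWShape r N l m t) {x y : ZMod n → ℕ}
    (hN : N x y) :
    ((∀ i, i ≠ (r : ZMod n) + 1 → i ≠ (r : ZMod n) + 1 + 1 → t i = 0) ∧
      t ((r : ZMod n) + 1 + 1) ≤ t ((r : ZMod n) + 1)) ∨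
    (∀ i, i ≠ (r : ZMod n) → i ≠ (r : ZMod n) + 1 → t i = 0) ∨
    ((∀ i, i ≠ (r : ZMod n) - 1 → i ≠ (r : ZMod n) → t i = 0) ∧
      t ((r : ZMod n) - 1) ≤ t (r : ZMod n)) := by
  have ht : ∀ i, t i = x i + y i := fun i => by rw [← h.total hN]; rfl
  have hne := hn.add_one_ne (r : ZMod n)
  have d1 := hn.isLow_r_sub_one
  have d2 := hn.not_isLow_r_add_one
  have d3 := hn.not_isLow_r_add_two
  have n1 : (r : ZMod n) - 1 ≠ (r : ZMod n) + 1 := fun h' => d2 (h' ▸ d1)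
  have n2 : (r : ZMod n) + 1 + 1 ≠ (r : ZMod n) := hn.add_two_ne _
  -- Every other site starts a chain of two transports: upwards for low sites, downwards for high
  -- ones.
  have h0 : ∀ i, i ≠ (r : ZMod n) - 1 → i ≠ (r : ZMod n) → i ≠ (r : ZMod n) + 1 →
      i ≠ (r : ZMod n) + 1 + 1 → t i = 0 := by
    intro i i1 i2 i3 i4
    rw [ht]
    by_cases hi : IsLow r i
    · have hi1 := hn.isLow_succ hi i2
      have i1' : i + 1 ≠ (r : ZMod n) := fun h' => i1 (by rw [← h']; ring)
      have hi2 := hn.isLow_succ hi1 i1'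
      exact (h.low i hi hi1).source_eq_zero (h.low (i + 1) hi1 hi2) (hn.add_two_ne i).symm hN
    · obtain ⟨hi1, z1⟩ := hn.not_isLow_pred hi i3
      have i4' : i - 1 ≠ (r : ZMod n) + 1 := fun h' => i4 (by rw [← h']; ring)
      obtain ⟨hi2, z2⟩ := hn.not_isLow_pred hi1 i4'
      have m1 := h.high (i - 1) z1 hi1 (by rwa [sub_add_cancel])
      have m2 := h.high (i - 1 - 1) z2 hi2 (by rwa [sub_add_cancel])
      rw [sub_add_cancel] at m1 m2
      refine m1.source_eq_zero m2 (fun h' => ?_) hN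
      have := hn.add_two_ne (i - 1 - 1)
      rw [sub_add_cancel, sub_add_cancel] at this
      exact this h'
  have le1 := (h.low_r hn).total_le hN
  have le2 := (h.high_r hn).total_le hN
  -- Occupation of `r - 1` excludes that of `r + 1`, and occupation of `r + 2` excludes that of `r`.
  -- With `le2` this leaves only two adjacent sites.
  have s1 := (h.low_r hn).source_or_partner_eq_zero h.pair hne.symm n1 h.square_low hN
  have s2 := (h.high_r hn).source_or_partner_eq_zero
    (fun x y => by
      have := h.pair x y
      rwa [add_right_comm x, add_right_comm y] at this) hne n2 h.square_high hN
  rw [← ht, ← ht] at le1 le2 s1 s2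
  by_cases c1 : t ((r : ZMod n) - 1) = 0
  · by_cases c2 : t ((r : ZMod n) + 1 + 1) = 0
    · right; left
      intro i i1 i2
      by_cases i3 : i = (r : ZMod n) - 1
      · rw [i3, c1]
      by_cases i4 : i = (r : ZMod n) + 1 + 1
      · rw [i4, c2]
      exact h0 i i3 i1 i2 i4
    · left
      refine ⟨fun i i1 i2 => ?_, le2⟩
      by_cases i3 : i = (r : ZMod n) - 1
      · rw [i3, c1]
      by_cases i4 : i = (r : ZMod n)
      · rw [i4, s2 c2]
      exact h0 i i3 i4 i1 i2
  · right; right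
    refine ⟨fun i i1 i2 => ?_, le1⟩
    by_cases i3 : i = (r : ZMod n) + 1
    · rw [i3, s1 c1]
    by_cases i4 : i = (r : ZMod n) + 1 + 1
    · rw [i4]
      have := s1 c1
      omega
    exact h0 i i1 i2 i3 i4

theorem HWShape.left_eq_zero (h : HWShape r N l m t) {x y : ZMod n → ℕ} (hN : N x y) {i : ZMod n}
    (hi : t i = 0) : x i = 0 := by
  have h2 := h.total hN
  rw [← h2, Pi.add_apply] at hi
  omega

theorem HWShape.right_eq_zero (h : HWShape r N l m t) {x y : ZMod n → ℕ} (hN : N x y)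
    {i : ZMod n} (hi : t i = 0) : y i = 0 := by
  have h2 := h.total hN
  rw [← h2, Pi.add_apply] at hi
  omega

/-- The coefficient of `|base l⟩ ⊗ |t - base l⟩` does not vanish. -/
theorem HWShape.base (hn : Admissible n r) (h : HWShape r N l m t) {x y : ZMod n → ℕ}
    (hN : N x y) : N (base n r l) (t - base n r l) := by
  have hne := hn.add_one_ne (r : ZMod n)
  -- The second factor is determined by the total `t`. The first one is brought to the base vector
  -- by clearing its outer site, or by giving away pairs until one of the sites `r`, `r + 1` is
  -- empty.
  suffices hs : ∃ x' y', N x' y' ∧ x' = QOsc.base n r l by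
    obtain ⟨x', y', h1, rfl⟩ := hs
    have h2 := h.total h1
    rw [← h2, add_tsub_cancel_left]
    exact h1
  rcases h.cases hn hN with ⟨h1, -⟩ | h1 | ⟨h1, -⟩
  · obtain ⟨x', y', g1, g2, -⟩ := (h.high_r hn).clear_source hN
    refine ⟨x', y', g1, eq_base hn (h.charge_left g1) (fun i _ i2 => ?_) (Or.inl ?_)⟩
    · by_cases i3 : i = (r : ZMod n) + 1 + 1
      · rw [i3, g2]
      · exact h.left_eq_zero g1 (h1 i i2 i3)
    · exact h.left_eq_zero g1 (h1 _ hne.symm (hn.add_two_ne _).symm)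
  · obtain ⟨x', y', g1, g2, -⟩ := clear_pair h.pair hne.symm hN
    exact ⟨x', y', g1, eq_base hn (h.charge_left g1)
      (fun i i1 i2 => h.left_eq_zero g1 (h1 i i1 i2)) g2⟩
  · obtain ⟨x', y', g1, g2, -⟩ := (h.low_r hn).clear_source hN
    refine ⟨x', y', g1, eq_base hn (h.charge_left g1) (fun i i1 i2 => ?_) (Or.inr ?_)⟩
    · by_cases i3 : i = (r : ZMod n) - 1
      · rw [i3, g2]
      · exact h.left_eq_zero g1 (h1 i i3 i1)
    · refine h.left_eq_zero g1 (h1 _ (fun h' => hn.not_isLow_r_add_one ?_) hne)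
      rw [h']; exact hn.isLow_r_sub_one

end shape

/-! ## The action on tensor products -/

theorem endTensorEnd_tmul {V W : Type*} [AddCommGroup V] [Module GF V] [AddCommGroup W]
    [Module GF W] (f : Module.End GF V) (g : Module.End GF W) (v : V) (w : W) :
    Module.endTensorEndAlgHom (R := GF) (S := GF) (A := GF) (f ⊗ₜ[GF] g) (v ⊗ₜ[GF] w)
      = f v ⊗ₜ g w := rfl

section tensorRep

variable {V W : Type*} [AddCommGroup V] [Module GF V] [AddCommGroup W] [Module GF W]
  (hn : Admissible n r) (ρ : Uq n r →ₐ[GF] Module.End GF V) (σ : Uq n r →ₐ[GF] Module.End GF W)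

theorem tensorRep_K (h : CoWt n) (v : V) (w : W) :
    tensorRep hn ρ σ (Uq.K r h) (v ⊗ₜ w) = ρ (Uq.K r h) v ⊗ₜ σ (Uq.K r h) w := by
  simp [tensorRep, Uq.comul, endTensorEnd_tmul]

theorem tensorRep_E (i : ZMod n) (v : V) (w : W) :
    tensorRep hn ρ σ (Uq.E r i) (v ⊗ₜ w) = v ⊗ₜ σ (Uq.E r i) w
      + ρ (Uq.E r i) v ⊗ₜ σ (Uq.K r (-(alphaVee r i))) w := by
  simp [tensorRep, Uq.comul, endTensorEnd_tmul]

theorem tensorRep_F (i : ZMod n) (v : V) (w : W) :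
    tensorRep hn ρ σ (Uq.F r i) (v ⊗ₜ w) = ρ (Uq.F r i) v ⊗ₜ w
      + ρ (Uq.K r (alphaVee r i)) v ⊗ₜ σ (Uq.F r i) w := by
  simp [tensorRep, Uq.comul, endTensorEnd_tmul]

/-- Tensor products of intertwining maps are intertwining maps. -/
theorem map_tensorRep {V' W' : Type*} [AddCommGroup V'] [Module GF V'] [AddCommGroup W']
    [Module GF W'] {ρ' : Uq n r →ₐ[GF] Module.End GF V'} {σ' : Uq n r →ₐ[GF] Module.End GF W'}
    (f : V →ₗ[GF] V') (g : W →ₗ[GF] W') (hf : ∀ a v, f (ρ a v) = ρ' a (f v))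
    (hg : ∀ a w, g (σ a w) = σ' a (g w)) (a : Uq n r) (z : V ⊗[GF] W) :
    TensorProduct.map f g (tensorRep hn ρ σ a z)
      = tensorRep hn ρ' σ' a (TensorProduct.map f g z) := by
  simp only [tensorRep, AlgHom.comp_apply]
  generalize Uq.comul hn a = c
  induction c using TensorProduct.induction_on with
  | zero => simp
  | add c d hc hd => simp only [map_add, LinearMap.add_apply, hc, hd]
  | tmul c d =>
    induction z using TensorProduct.induction_on with
    | zero => simp
    | add v w hv hw => simp only [map_add, hv, hw]
    | tmul v w => simp [hf, hg, endTensorEnd_tmul]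

end tensorRep

/-! ## Coordinates -/

/-- The coefficient of `|x⟩`. -/
def oscCoord (x : ZMod n → ℕ) : OscSpace n →ₗ[GF] GF := (oscBasis n).coord x

open Classical in
theorem oscCoord_ket (x m : ZMod n → ℕ) : oscCoord x (ket m) = if m = x then 1 else 0 := by
  simp [oscCoord, ket, Finsupp.single_apply]

theorem oscCoord_ext {f g : OscSpace n →ₗ[GF] GF} (h : ∀ m, f (ket m) = g (ket m)) : f = g :=
  (oscBasis n).ext h

theorem oscCoord_lower (a : ZMod n) (x : ZMod n → ℕ) (u : OscSpace n) :
    oscCoord x (lower a u) = qInt (x a + 1) * oscCoord (x + eps a) u := by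
  suffices h : (oscCoord x).comp (lower a) = qInt (x a + 1) • oscCoord (x + eps a) from
    LinearMap.congr_fun h u
  refine oscCoord_ext fun m => ?_
  simp only [LinearMap.comp_apply, lower_ket, map_smul, LinearMap.smul_apply, oscCoord_ket,
    smul_eq_mul]
  by_cases h0 : m a = 0
  · have : m ≠ x + eps a := fun h => by rw [h] at h0; simp [eps_self] at h0
    simp [h0, qInt_zero, this]
  · have : m - eps a = x ↔ m = x + eps a := by
      constructor
      · rintro rfl; rw [sub_add_eps h0]
      · rintro rfl; rw [add_tsub_cancel_right]
    by_cases h : m = x + eps a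
    · rw [if_pos h, if_pos (this.mpr h), h]; simp [eps_self]
    · rw [if_neg h, if_neg (mt this.mp h)]; simp

theorem oscCoord_raise (a : ZMod n) (x : ZMod n → ℕ) (u : OscSpace n) :
    oscCoord x (raise a u) = if x a = 0 then 0 else oscCoord (x - eps a) u := by
  suffices h : (oscCoord x).comp (raise a) = if x a = 0 then 0 else oscCoord (x - eps a) by
    have := LinearMap.congr_fun h u
    simp only [LinearMap.comp_apply] at this
    rw [this]; split_ifs <;> rfl
  refine oscCoord_ext fun m => ?_
  simp only [LinearMap.comp_apply, raise_ket, oscCoord_ket]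
  split_ifs with h1 h2 h2
  · rw [← h1] at h2; simp [eps_self] at h2
  · rw [oscCoord_ket, if_pos]; rw [← h1, add_tsub_cancel_right]
  · rfl
  · rw [oscCoord_ket, if_neg]
    rintro rfl
    exact h1 (sub_add_eps h2)

theorem oscCoord_K (h : CoWt n) (x : ZMod n → ℕ) (u : OscSpace n) :
    oscCoord x (oscK r h u) = q ^ (h (ketWt r x)) * oscCoord x u := by
  suffices h : (oscCoord x).comp (oscK r h) = q ^ (h (ketWt r x)) • oscCoord x from
    LinearMap.congr_fun h u
  refine oscCoord_ext fun m => ?_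
  simp only [LinearMap.comp_apply, oscK_ket, map_smul, LinearMap.smul_apply, oscCoord_ket,
    smul_eq_mul]
  split_ifs with h1
  · rw [h1]
  · simp

/-- The basis `|x⟩ ⊗ |y⟩` of `𝓦 ⊗ 𝓦`. -/
def pairBasis (n : ℕ) :
    Module.Basis ((ZMod n → ℕ) × (ZMod n → ℕ)) GF (OscSpace n ⊗[GF] OscSpace n) :=
  (oscBasis n).tensorProduct (oscBasis n)

theorem pairBasis_apply (x y : ZMod n → ℕ) : pairBasis n (x, y) = ket x ⊗ₜ ket y := by
  simp [pairBasis, ket]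

/-- The coefficient of `|x⟩ ⊗ |y⟩`. -/
def coef (x y : ZMod n → ℕ) : OscSpace n ⊗[GF] OscSpace n →ₗ[GF] GF := (pairBasis n).coord (x, y)

theorem coef_tmul (x y : ZMod n → ℕ) (u v : OscSpace n) :
    coef x y (u ⊗ₜ v) = oscCoord x u * oscCoord y v := by
  simp [coef, pairBasis, oscCoord, Module.Basis.tensorProduct_repr_tmul_apply, mul_comm]

theorem coef_ext_zero {z : OscSpace n ⊗[GF] OscSpace n} (h : ∀ x y, coef x y z = 0) : z = 0 := by
  refine (pairBasis n).repr.map_eq_zero_iff.mp (Finsupp.ext fun p => h p.1 p.2)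

/-- Used to turn an equation between tensors into scalar relations, each operator here reading off a
multiple of one coefficient. -/
theorem coef_map {A B : Module.End GF (OscSpace n)} {c d : GF} {x y x' y' : ZMod n → ℕ}
    (hA : ∀ u, oscCoord x (A u) = c * oscCoord x' u)
    (hB : ∀ u, oscCoord y (B u) = d * oscCoord y' u) (z : OscSpace n ⊗[GF] OscSpace n) :
    coef x y (TensorProduct.map A B z) = c * d * coef x' y' z := by
  induction z using TensorProduct.induction_on with
  | zero => simp
  | add v w hv hw => simp only [map_add, hv, hw, mul_add]
  | tmul v w => rw [TensorProduct.map_tmul, coef_tmul, coef_tmul, hA, hB]; ring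

/-- The tensor square of `𝓦`. -/
def pairRep (hn : Admissible n r) :
    Uq n r →ₐ[GF] Module.End GF (OscSpace n ⊗[GF] OscSpace n) :=
  tensorRep hn (oscRep hn 1) (oscRep hn 1)

theorem oscRep_K (hn : Admissible n r) (x : GFˣ) (h : CoWt n) :
    oscRep hn x (Uq.K r h) = oscK r h := by rw [oscRep, Uq.lift_K]

theorem oscRep_E (hn : Admissible n r) (x : GFˣ) (i : ZMod n) :
    oscRep hn x (Uq.E r i) = scalE r x i • (up r i * down r (i + 1)) := by
  rw [oscRep, Uq.lift_E, oscE_eq hn]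

theorem oscRep_F (hn : Admissible n r) (x : GFˣ) (i : ZMod n) :
    oscRep hn x (Uq.F r i) = scalF x i • (down r i * up r (i + 1)) := by
  rw [oscRep, Uq.lift_F, oscF_eq hn]

theorem coef_pairRep_K (hn : Admissible n r) (h : CoWt n) (x y : ZMod n → ℕ)
    (z : OscSpace n ⊗[GF] OscSpace n) :
    coef x y (pairRep hn (Uq.K r h) z) = q ^ (h (ketWt r x + ketWt r y)) * coef x y z := by
  have e : pairRep hn (Uq.K r h) z = TensorProduct.map (oscK r h) (oscK r h) z := by
    suffices h : pairRep hn (Uq.K r h) = TensorProduct.map (oscK r h) (oscK r h) from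
      LinearMap.congr_fun h z
    refine TensorProduct.ext' fun u v => ?_
    rw [pairRep, tensorRep_K, oscRep_K, TensorProduct.map_tmul]
  rw [e, coef_map (oscCoord_K h x) (oscCoord_K h y), ← zpow_add₀ q_ne_zero, map_add]

theorem pairRep_E (hn : Admissible n r) (i : ZMod n) (z : OscSpace n ⊗[GF] OscSpace n) :
    pairRep hn (Uq.E r i) z = scalE r 1 i •
      (TensorProduct.map 1 (up r i * down r (i + 1)) z
        + TensorProduct.map (up r i * down r (i + 1)) (oscK r (-(alphaVee r i))) z) := by
  suffices h : pairRep hn (Uq.E r i) = scalE r 1 i •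
      (TensorProduct.map 1 (up r i * down r (i + 1))
        + TensorProduct.map (up r i * down r (i + 1)) (oscK r (-(alphaVee r i)))) from
    LinearMap.congr_fun h z
  refine TensorProduct.ext' fun u v => ?_
  rw [pairRep, tensorRep_E, oscRep_K, oscRep_E]
  simp [TensorProduct.smul_tmul']

theorem scalE_ne_zero (x : GFˣ) (i : ZMod n) : scalE r x i ≠ 0 := by
  unfold scalE
  split_ifs
  · exact x.ne_zero
  · exact neg_ne_zero.mpr one_ne_zero
  · exact one_ne_zero

theorem scalF_ne_zero (x : GFˣ) (i : ZMod n) : scalF x i ≠ 0 := by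
  unfold scalF
  split_ifs
  · exact neg_ne_zero.mpr (inv_ne_zero x.ne_zero)
  · exact one_ne_zero

theorem oscCoord_one (x : ZMod n → ℕ) (u : OscSpace n) :
    oscCoord x ((1 : Module.End GF (OscSpace n)) u) = 1 * oscCoord x u := by
  rw [one_mul, Module.End.one_apply]

theorem oscCoord_lower_raise (a b : ZMod n) (x : ZMod n → ℕ) (u : OscSpace n) :
    oscCoord x ((lower a * raise b) u)
      = (qInt (x a + 1) * if (x + eps a) b = 0 then 0 else 1) * oscCoord (x + eps a - eps b) u := by
  rw [Module.End.mul_apply, oscCoord_lower, oscCoord_raise]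
  split_ifs <;> simp

theorem oscCoord_lower_lower (a b : ZMod n) (x : ZMod n → ℕ) (u : OscSpace n) :
    oscCoord x ((lower a * lower b) u)
      = (qInt (x a + 1) * qInt ((x + eps a) b + 1)) * oscCoord (x + eps a + eps b) u := by
  rw [Module.End.mul_apply, oscCoord_lower, oscCoord_lower, mul_assoc]

/-- A vector annihilated by an operator that moves one particle from `a` to `b`. -/
theorem transport_of_annihilated {a b : ZMod n} (hab : a ≠ b) {h : CoWt n}
    (hh : ∀ y : ZMod n → ℕ, h (ketWt r y) = (y a : ℤ) - y b) {z : OscSpace n ⊗[GF] OscSpace n}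
    (hz : TensorProduct.map 1 (lower a * raise b) z
      + TensorProduct.map (lower a * raise b) (oscK r h) z = 0) :
    Transport (fun x y => coef x y z) a b := by
  have key : ∀ x y, (qInt (y a + 1) * if (y + eps a) b = 0 then 0 else 1)
        * coef x (y + eps a - eps b) z
      + (qInt (x a + 1) * if (x + eps a) b = 0 then 0 else 1) * q ^ ((y a : ℤ) - y b)
        * coef (x + eps a - eps b) y z = 0 := by
    intro x y
    have := congrArg (coef x y) hz
    rw [map_add, map_zero, coef_map (oscCoord_one x) (oscCoord_lower_raise a b y),
      coef_map (oscCoord_lower_raise a b x) (oscCoord_K h y), hh, one_mul] at this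
    exact this
  have e : ∀ x : ZMod n → ℕ, x + eps b + eps a - eps b = x + eps a := fun x => by
    rw [add_right_comm, add_tsub_cancel_right]
  -- The shift by `eps b` in both arguments, or in only one, undoes the truncated subtraction. In
  -- the last two cases the factor with nothing at `b` contributes zero, and a single term remains.
  refine ⟨hab, fun x y => ?_, fun x y hx => ?_, fun x y hy => ?_⟩
  · have := key (x + eps b) (y + eps b)
    rw [e, e] at this
    simpa [eps_self, eps_ne hab, eps_ne hab.symm, sub_add_eq_sub_sub] using this
  · have := key x (y + eps b)
    rw [e] at this
    simpa [eps_self, eps_ne hab, eps_ne hab.symm, hx, qInt_succ_ne_zero] using this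
  · have := key (x + eps b) y
    rw [e] at this
    simpa [eps_self, eps_ne hab, eps_ne hab.symm, hy, qInt_succ_ne_zero, q_ne_zero] using this

/-- A vector annihilated by an operator that removes one particle from `b` and one from `d`. -/
theorem pairRel_of_annihilated {b d : ZMod n} (hbd : b ≠ d) {h : CoWt n}
    (hh : ∀ y : ZMod n → ℕ, h (ketWt r y) = (y b : ℤ) + y d + 1)
    {z : OscSpace n ⊗[GF] OscSpace n}
    (hz : TensorProduct.map 1 (lower b * lower d) z
      + TensorProduct.map (lower b * lower d) (oscK r h) z = 0) :
    PairRel (fun x y => coef x y z) b d := by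
  refine ⟨hbd, fun x y => ?_⟩
  have := congrArg (coef x y) hz
  rw [map_add, map_zero, coef_map (oscCoord_one x) (oscCoord_lower_lower b d y),
    coef_map (oscCoord_lower_lower b d x) (oscCoord_K h y), hh, one_mul] at this
  simpa [eps_ne hbd] using this

/-! ### Annihilation by `e_i` as relations between coefficients -/

section annihilated

variable (hn : Admissible n r) {z : OscSpace n ⊗[GF] OscSpace n}

theorem annihilated_E {i : ZMod n} (hz : pairRep hn (Uq.E r i) z = 0) :
    TensorProduct.map 1 (up r i * down r (i + 1)) z
        + TensorProduct.map (up r i * down r (i + 1)) (oscK r (-(alphaVee r i))) z = 0 := by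
  rw [pairRep_E] at hz
  exact (smul_eq_zero.mp hz).resolve_left (scalE_ne_zero 1 i)

/-- At a low site `up` removes a particle and `down` creates one, so `e_i` moves particles upwards,
towards `r`. -/
theorem transport_low {i : ZMod n} (h1 : IsLow r i) (h2 : IsLow r (i + 1))
    (hz : pairRep hn (Uq.E r i) z = 0) : Transport (fun x y => coef x y z) i (i + 1) := by
  have h := annihilated_E hn hz
  rw [up, if_pos h1, down, if_pos h2] at h
  refine transport_of_annihilated (hn.add_one_ne i).symm (fun y => ?_) h
  rw [LinearMap.neg_apply, alphaVee_ketWt hn, if_pos h1, if_pos h2]; ring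

/-- At a high site the roles of `up` and `down` are exchanged, so `e_i` moves particles from `i + 1`
to `i`, towards `r + 1`. -/
theorem transport_high {i : ZMod n} (h1 : ¬ IsLow r i) (h2 : ¬ IsLow r (i + 1))
    (hz : pairRep hn (Uq.E r i) z = 0) : Transport (fun x y => coef x y z) (i + 1) i := by
  have h := annihilated_E hn hz
  rw [up, if_neg h1, down, if_neg h2, ← lower_raise (hn.add_one_ne i)] at h
  refine transport_of_annihilated (hn.add_one_ne i) (fun y => ?_) h
  rw [LinearMap.neg_apply, alphaVee_ketWt hn, if_neg h1, if_neg h2]; ring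

theorem pairRel_r (hz : pairRep hn (Uq.E r (r : ZMod n)) z = 0) :
    PairRel (fun x y => coef x y z) (r : ZMod n) ((r : ZMod n) + 1) := by
  have h := annihilated_E hn hz
  have h1 := hn.isLow_r
  have h2 := hn.not_isLow_r_add_one
  rw [up, if_pos h1, down, if_neg h2] at h
  refine pairRel_of_annihilated (hn.add_one_ne _).symm (fun y => ?_) h
  rw [LinearMap.neg_apply, alphaVee_ketWt hn, if_pos h1, if_neg h2]; ring

theorem PairRel.symm {f : (ZMod n → ℕ) → (ZMod n → ℕ) → GF} {b d : ZMod n} (h : PairRel f b d) :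
    PairRel f d b := by
  refine ⟨h.ne.symm, fun x y => ?_⟩
  rw [add_right_comm x, add_right_comm y, add_comm (y d : ℤ), mul_comm (qInt (y d + 1)),
    mul_comm (qInt (x d + 1))]
  exact h.rel x y

/-- Highest weight vectors have the shape that is described by `HWShape`. -/
theorem hwShape {l m : ℤ} {t : ZMod n → ℕ}
    (h1 : ∀ x y, coef x y z ≠ 0 → x + y = t ∧ charge r x = l ∧ charge r y = m)
    (h2 : ∀ i, i ≠ 0 → pairRep hn (Uq.E r i) z = 0) :
    HWShape r (fun x y => coef x y z ≠ 0) l m t where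
  total h := (h1 _ _ h).1
  charge_left h := (h1 _ _ h).2.1
  charge_right h := (h1 _ _ h).2.2
  low i hi hi' := (transport_low hn hi hi' (h2 i hi.1)).moves
  high i h0 hi hi' := (transport_high hn hi hi' (h2 i h0)).moves
  pair := (pairRel_r hn (h2 _ hn.r_ne_zero)).iff
  square_low x y := by
    have hr : IsLow r ((r : ZMod n) - 1 + 1) := by rw [sub_add_cancel]; exact hn.isLow_r
    have a := transport_low hn hn.isLow_r_sub_one hr (h2 _ hn.isLow_r_sub_one.1)
    rw [sub_add_cancel] at a
    have b := a.square (pairRel_r hn (h2 _ hn.r_ne_zero))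
      (fun h' => hn.not_isLow_r_add_one (h' ▸ hn.isLow_r_sub_one)) x y
    exact ⟨not_not.mpr b.1, not_not.mpr b.2⟩
  square_high x y := by
    have h0 : (r : ZMod n) + 1 ≠ 0 := by
      intro h0
      have h2 := hn.add_two_le
      have := hn.val_add_one (r : ZMod n)
      rw [h0, hn.val_r, ZMod.val_zero] at this
      split_ifs at this; omega
    have a := transport_high hn hn.not_isLow_r_add_one hn.not_isLow_r_add_two (h2 _ h0)
    have b := a.square (pairRel_r hn (h2 _ hn.r_ne_zero)).symm (hn.add_two_ne _) x y
    exact ⟨not_not.mpr b.1, not_not.mpr b.2⟩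

end annihilated

/-! ## The contravariant form -/

/-- The square length of `|k⟩` at one node. -/
def siteNorm : ℕ → GF
  | 0 => 1
  | k + 1 => qInt (k + 1) * q ^ (-(k : ℤ)) * siteNorm k

/-- Each factor in the recursion is positive at the real place. This is the origin of anisotropy. -/
theorem phi_siteNorm_pos (k : ℕ) : 0 < phi (siteNorm k) := by
  induction k with
  | zero => simp [siteNorm]
  | succ k ih =>
    rw [siteNorm, map_mul, map_mul]
    exact mul_pos (mul_pos (phi_qInt_pos k.succ_ne_zero) (phi_q_zpow_pos _)) ih

theorem oscBilin_ext {f g : OscSpace n →ₗ[GF] OscSpace n →ₗ[GF] GF}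
    (h : ∀ m v, f (ket m) v = g (ket m) v) (u v : OscSpace n) : f u v = g u v := by
  have : f = g := (oscBasis n).ext fun m => LinearMap.ext (h m)
  rw [this]

theorem deltaVee_ketWt (a : ZMod n) (m : ZMod n → ℕ) :
    deltaVee a (ketWt r m) = if IsLow r a then -(m a : ℤ) else m a := by
  simp [deltaVee, ketWt]

section form

variable [NeZero n]

/-- The square length of `|m⟩`. -/
def oscNorm (m : ZMod n → ℕ) : GF := ∏ a, siteNorm (m a)

theorem phi_oscNorm_pos (m : ZMod n → ℕ) : 0 < phi (oscNorm m) := by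
  rw [oscNorm, map_prod]
  exact Finset.prod_pos fun a _ => phi_siteNorm_pos _

theorem oscNorm_add_eps (m : ZMod n → ℕ) (a : ZMod n) :
    oscNorm (m + eps a) = qInt (m a + 1) * q ^ (-(m a : ℤ)) * oscNorm m := by
  have h : ∏ b ∈ Finset.univ.erase a, siteNorm ((m + eps a) b)
      = ∏ b ∈ Finset.univ.erase a, siteNorm (m b) :=
    Finset.prod_congr rfl fun b hb => by
      rw [Pi.add_apply, eps_ne (Finset.ne_of_mem_erase hb).symm, add_zero]
  rw [oscNorm, oscNorm, ← Finset.mul_prod_erase _ _ (Finset.mem_univ a), h,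
    ← Finset.mul_prod_erase _ (fun b => siteNorm (m b)) (Finset.mem_univ a), Pi.add_apply, eps_self,
    siteNorm]
  ring

/-- The bilinear form on `𝓦` for which the vectors `|m⟩` are orthogonal. -/
def oscForm (n : ℕ) [NeZero n] : LinearMap.BilinForm GF (OscSpace n) :=
  (oscBasis n).constr GF fun m => oscNorm m • oscCoord m

theorem oscForm_ket (m : ZMod n → ℕ) (v : OscSpace n) :
    oscForm n (ket m) v = oscNorm m * oscCoord m v := by
  have : oscForm n (ket m) = oscNorm m • oscCoord m := (oscBasis n).constr_basis GF _ m
  rw [this, LinearMap.smul_apply, smul_eq_mul]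

theorem oscForm_symm (u v : OscSpace n) : oscForm n u v = oscForm n v u := by
  refine oscBilin_ext (f := oscForm n) (g := LinearMap.flip (oscForm n)) (fun m w => ?_) u v
  suffices h : oscForm n (ket m) = LinearMap.flip (oscForm n) (ket m) from LinearMap.congr_fun h w
  refine oscCoord_ext fun k => ?_
  rw [LinearMap.flip_apply, oscForm_ket, oscForm_ket, oscCoord_ket, oscCoord_ket]
  by_cases h : k = m
  · rw [h]
  · rw [if_neg h, if_neg (Ne.symm h), mul_zero, mul_zero]

theorem oscForm_K (h : CoWt n) (u v : OscSpace n) :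
    oscForm n (oscK r h u) v = oscForm n u (oscK r h v) := by
  refine oscBilin_ext (f := LinearMap.comp (oscForm n) (oscK r h))
    (g := (oscForm n).compl₂ (oscK r h))
    (fun m w => ?_) u v
  simp only [LinearMap.comp_apply, LinearMap.compl₂_apply, oscK_ket, map_smul,
    LinearMap.smul_apply, oscForm_ket, oscCoord_K, smul_eq_mul]
  ring

/-- The adjoint of `up a` is, up to a scalar, `down a q^{-δ_a^∨}`. -/
theorem oscForm_up (a : ZMod n) (u v : OscSpace n) :
    oscForm n (up r a u) v
      = (if IsLow r a then 1 else q) * oscForm n u (down r a (oscK r (-(deltaVee a)) v)) := by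
  refine oscBilin_ext (f := LinearMap.comp (oscForm n) (up r a))
    (g := (if IsLow r a then (1 : GF) else q) •
      (oscForm n).compl₂ (down r a * oscK r (-(deltaVee a)))) (fun m w => ?_) u v
  simp only [LinearMap.comp_apply, LinearMap.compl₂_apply, LinearMap.smul_apply,
    Module.End.mul_apply, smul_eq_mul]
  unfold up down
  split_ifs with ha
  · rw [lower_ket, map_smul, LinearMap.smul_apply, oscForm_ket, oscForm_ket, oscCoord_raise]
    by_cases h0 : m a = 0
    · simp [h0, qInt_zero]
    · rw [if_neg h0, oscCoord_K]
      obtain ⟨m', rfl⟩ : ∃ m', m = m' + eps a := ⟨m - eps a, (sub_add_eps h0).symm⟩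
      rw [add_tsub_cancel_right, oscNorm_add_eps, LinearMap.neg_apply, deltaVee_ketWt, if_pos ha,
        neg_neg, zpow_neg, smul_eq_mul, Pi.add_apply, eps_self, one_mul]
      have := q_zpow_ne_zero (m' a)
      field_simp
  · rw [raise_ket, oscForm_ket, oscForm_ket, oscCoord_lower, oscCoord_K, oscNorm_add_eps,
      LinearMap.neg_apply, deltaVee_ketWt, if_neg ha, Pi.add_apply, eps_self, zpow_neg, zpow_neg]
    have := q_zpow_ne_zero (m a)
    have := q_ne_zero
    push_cast
    rw [zpow_add₀ q_ne_zero, zpow_one]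
    field_simp

end form

/-- A bilinear form is contravariant if the adjoint of `q^h` is `q^h` and the adjoint of `e_i` is
a multiple of `f_i k_i^{-1}`. -/
structure Contravariant {V : Type*} [AddCommGroup V] [Module GF V]
    (ρ : Uq n r →ₐ[GF] Module.End GF V) (B : LinearMap.BilinForm GF V) (θ : ZMod n → GF) :
    Prop where
  symm : ∀ u v, B u v = B v u
  K : ∀ h u v, B (ρ (Uq.K r h) u) v = B u (ρ (Uq.K r h) v)
  E : ∀ i u v, B (ρ (Uq.E r i) u) v
    = θ i * B u (ρ (Uq.F r i) (ρ (Uq.K r (-(alphaVee r i))) v))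

/-! ### Adjoints, tensor products and restrictions of contravariant forms -/

section contravariant

variable {V : Type*} [AddCommGroup V] [Module GF V] {ρ : Uq n r →ₐ[GF] Module.End GF V}
  {B : LinearMap.BilinForm GF V} {θ : ZMod n → GF}

theorem rep_K_neg_K (ρ : Uq n r →ₐ[GF] Module.End GF V) (h : CoWt n) (v : V) :
    ρ (Uq.K r (-h)) (ρ (Uq.K r h) v) = v := by
  rw [← Module.End.mul_apply, ← map_mul, (Uq.relations n r).neg_mul_self, map_one,
    Module.End.one_apply]

theorem rep_K_K_neg (ρ : Uq n r →ₐ[GF] Module.End GF V) (h : CoWt n) (v : V) :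
    ρ (Uq.K r h) (ρ (Uq.K r (-h)) v) = v := by
  have := rep_K_neg_K ρ (-h) v
  rwa [neg_neg] at this

/-- Inserting `k_i u` into the adjunction for `e_i` removes the factor `k_i⁻¹`; symmetry then
exchanges the arguments. -/
theorem Contravariant.F (H : Contravariant ρ B θ) (hθ : ∀ i, θ i ≠ 0) (i : ZMod n) (u v : V) :
    B (ρ (Uq.F r i) u) v
      = (θ i)⁻¹ * B u (ρ (Uq.K r (alphaVee r i)) (ρ (Uq.E r i) v)) := by
  have h := H.E i v (ρ (Uq.K r (alphaVee r i)) u)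
  rw [rep_K_neg_K] at h
  rw [H.symm, eq_inv_mul_iff_mul_eq₀ (hθ i), ← h, H.symm, H.K]

/-- Every element of the quantum affine algebra has an adjoint. -/
theorem Contravariant.exists_adjoint (H : Contravariant ρ B θ) (hθ : ∀ i, θ i ≠ 0) (a : Uq n r) :
    ∃ a' : Uq n r, ∀ u v, B (ρ a u) v = B u (ρ a' v) := by
  induction a using Uq.induction with
  | hs c =>
    refine ⟨algebraMap GF _ c, fun u v => ?_⟩
    simp [AlgHom.commutes, Module.algebraMap_end_apply]
  | hK h => exact ⟨_, H.K h⟩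
  | hE i =>
    refine ⟨θ i • (Uq.F r i * Uq.K r (-(alphaVee r i))), fun u v => ?_⟩
    rw [H.E]; simp
  | hF i =>
    refine ⟨(θ i)⁻¹ • (Uq.K r (alphaVee r i) * Uq.E r i), fun u v => ?_⟩
    rw [H.F hθ]; simp
  | hmul a b ha hb =>
    obtain ⟨a', ha⟩ := ha
    obtain ⟨b', hb⟩ := hb
    refine ⟨b' * a', fun u v => ?_⟩
    rw [map_mul, map_mul, Module.End.mul_apply, Module.End.mul_apply, ha, hb]
  | hadd a b ha hb =>
    obtain ⟨a', ha⟩ := ha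
    obtain ⟨b', hb⟩ := hb
    refine ⟨a' + b', fun u v => ?_⟩
    rw [map_add, map_add, LinearMap.add_apply, LinearMap.add_apply, map_add, LinearMap.add_apply,
      ha, hb, map_add]

theorem Uq.K_mem_UqGl (h : CoWt n) : Uq.K r h ∈ UqGl n r :=
  Algebra.subset_adjoin (Or.inl ⟨h, rfl⟩)

theorem Uq.E_mem_UqGl {i : ZMod n} (hi : i ≠ 0) : Uq.E r i ∈ UqGl n r :=
  Algebra.subset_adjoin (Or.inr (Or.inl ⟨i, hi, rfl⟩))

theorem Uq.F_mem_UqGl {i : ZMod n} (hi : i ≠ 0) : Uq.F r i ∈ UqGl n r :=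
  Algebra.subset_adjoin (Or.inr (Or.inr ⟨i, hi, rfl⟩))

/-- Every element of `U_q(gl_n)` has an adjoint in `U_q(gl_n)`. -/
theorem Contravariant.exists_adjoint_gl (H : Contravariant ρ B θ) (hθ : ∀ i, θ i ≠ 0)
    {a : Uq n r} (ha : a ∈ UqGl n r) :
    ∃ a' ∈ UqGl n r, ∀ u v, B (ρ a u) v = B u (ρ a' v) := by
  induction ha using Algebra.adjoin_induction with
  | mem a ha =>
    rcases ha with ⟨h, rfl⟩ | ⟨i, hi, rfl⟩ | ⟨i, hi, rfl⟩
    · exact ⟨_, Uq.K_mem_UqGl h, H.K h⟩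
    · refine ⟨θ i • (Uq.F r i * Uq.K r (-(alphaVee r i))), Subalgebra.smul_mem _
        (mul_mem (Uq.F_mem_UqGl hi) (Uq.K_mem_UqGl _)) _, fun u v => ?_⟩
      rw [H.E]; simp
    · refine ⟨(θ i)⁻¹ • (Uq.K r (alphaVee r i) * Uq.E r i), Subalgebra.smul_mem _
        (mul_mem (Uq.K_mem_UqGl _) (Uq.E_mem_UqGl hi)) _, fun u v => ?_⟩
      rw [H.F hθ]; simp
  | algebraMap c =>
    refine ⟨algebraMap GF _ c, Subalgebra.algebraMap_mem _ c, fun u v => ?_⟩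
    simp [AlgHom.commutes, Module.algebraMap_end_apply]
  | mul a b _ _ ha hb =>
    obtain ⟨a', ma, ha⟩ := ha
    obtain ⟨b', mb, hb⟩ := hb
    refine ⟨b' * a', mul_mem mb ma, fun u v => ?_⟩
    rw [map_mul, map_mul, Module.End.mul_apply, Module.End.mul_apply, ha, hb]
  | add a b _ _ ha hb =>
    obtain ⟨a', ma, ha⟩ := ha
    obtain ⟨b', mb, hb⟩ := hb
    refine ⟨a' + b', add_mem ma mb, fun u v => ?_⟩
    rw [map_add, map_add, LinearMap.add_apply, LinearMap.add_apply, map_add, LinearMap.add_apply,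
      ha, hb, map_add]

theorem bilin_tmul_apply {W : Type*} [AddCommGroup W] [Module GF W]
    (B : LinearMap.BilinForm GF V) (C : LinearMap.BilinForm GF W) (v v' : V) (w w' : W) :
    (B.tmul C) (v ⊗ₜ w) (v' ⊗ₜ w') = B v v' * C w w' := by
  simp [LinearMap.BilinForm.tmul, mul_comm]

theorem tensor_form_ext {W : Type*} [AddCommGroup W] [Module GF W]
    {f g : V ⊗[GF] W →ₗ[GF] V ⊗[GF] W →ₗ[GF] GF}
    (h : ∀ v w v' w', f (v ⊗ₜ w) (v' ⊗ₜ w') = g (v ⊗ₜ w) (v' ⊗ₜ w')) (z z' : V ⊗[GF] W) :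
    f z z' = g z z' := by
  have : f = g := TensorProduct.ext' fun v w => TensorProduct.ext' fun v' w' => h v w v' w'
  rw [this]

/-- The twist by `k_i⁻¹` makes the adjunction compatible with `Δ`: the product of `f_i ⊗ 1 + k_i ⊗
f_i` with `k_i⁻¹ ⊗ k_i⁻¹` is `f_i k_i⁻¹ ⊗ k_i⁻¹ + 1 ⊗ f_i k_i⁻¹`, which up to `θ i` is the adjoint
of `Δ(e_i)`. -/
theorem Contravariant.tensor (hn : Admissible n r) {W : Type*} [AddCommGroup W] [Module GF W]
    {σ : Uq n r →ₐ[GF] Module.End GF W} {C : LinearMap.BilinForm GF W}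
    (H : Contravariant ρ B θ) (H' : Contravariant σ C θ) :
    Contravariant (tensorRep hn ρ σ) (B.tmul C) θ where
  symm := tensor_form_ext (f := B.tmul C) (g := (B.tmul C).flip) fun v w v' w' => by
    rw [LinearMap.flip_apply, bilin_tmul_apply, bilin_tmul_apply, H.symm, H'.symm]
  K h := tensor_form_ext (f := (B.tmul C).comp (tensorRep hn ρ σ (Uq.K r h)))
      (g := (B.tmul C).compl₂ (tensorRep hn ρ σ (Uq.K r h))) fun v w v' w' => by
    rw [LinearMap.comp_apply, LinearMap.compl₂_apply, tensorRep_K, tensorRep_K, bilin_tmul_apply,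
      bilin_tmul_apply, H.K, H'.K]
  E i := tensor_form_ext (f := (B.tmul C).comp (tensorRep hn ρ σ (Uq.E r i)))
      (g := θ i • (B.tmul C).compl₂ (tensorRep hn ρ σ (Uq.F r i)
        * tensorRep hn ρ σ (Uq.K r (-(alphaVee r i))))) fun v w v' w' => by
    rw [LinearMap.comp_apply, LinearMap.smul_apply, LinearMap.smul_apply, LinearMap.compl₂_apply,
      Module.End.mul_apply, tensorRep_K, tensorRep_E, tensorRep_F, map_add, map_add,
      LinearMap.add_apply, bilin_tmul_apply, bilin_tmul_apply, bilin_tmul_apply, bilin_tmul_apply,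
      rep_K_K_neg, H.E, H'.E, H'.K, smul_eq_mul]
    ring

/-- The restriction of a contravariant form along an intertwining map. -/
theorem Contravariant.pullback {W : Type*} [AddCommGroup W] [Module GF W]
    {σ : Uq n r →ₐ[GF] Module.End GF W} (H : Contravariant ρ B θ) (f : W →ₗ[GF] V)
    (hf : ∀ a w, f (σ a w) = ρ a (f w)) :
    Contravariant σ (B.compl₁₂ f f) θ where
  symm u v := by simp only [LinearMap.compl₁₂_apply]; exact H.symm _ _
  K h u v := by simp only [LinearMap.compl₁₂_apply, hf]; exact H.K _ _ _
  E i u v := by simp only [LinearMap.compl₁₂_apply, hf]; exact H.E _ _ _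

end contravariant

theorem oscK_c (u : OscSpace n) (k : ℤ) : oscK r (k • cVee) u = q ^ (-k) • u := by
  suffices h : oscK r (k • cVee) = q ^ (-k) • (1 : Module.End GF (OscSpace n)) by
    rw [h]; rfl
  refine osc_ext fun m => ?_
  rw [oscK_ket]
  simp [cVee, ketWt]

theorem oscForm_down [NeZero n] (a : ZMod n) (u v : OscSpace n) :
    oscForm n (down r a u) v
      = (if IsLow r a then 1 else q)⁻¹ * oscForm n u (oscK r (deltaVee a) (up r a v)) := by
  have h := oscForm_up (r := r) a v (oscK r (deltaVee a) u)
  have e : oscK r (-(deltaVee a)) (oscK r (deltaVee a) u) = u := by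
    rw [← Module.End.mul_apply, ← oscK_add, neg_add_cancel, oscK_zero, Module.End.one_apply]
  have hκ : (if IsLow r a then (1 : GF) else q) ≠ 0 := by
    split_ifs
    · exact one_ne_zero
    · exact q_ne_zero
  rw [e] at h
  rw [oscForm_symm, eq_inv_mul_iff_mul_eq₀ hκ, ← h, oscForm_symm, oscForm_K]

/-- The form on `𝓦` is contravariant. -/
theorem oscForm_contravariant [NeZero n] (hn : Admissible n r) :
    ∃ θ : ZMod n → GF, (∀ i, θ i ≠ 0) ∧ Contravariant (oscRep hn 1) (oscForm n) θ := by
  have key : ∀ i : ZMod n, ∃ θ : GF, θ ≠ 0 ∧ ∀ u v, oscForm n (oscRep hn 1 (Uq.E r i) u) v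
      = θ * oscForm n u (oscRep hn 1 (Uq.F r i) (oscRep hn 1 (Uq.K r (-(alphaVee r i))) v)) := by
    intro i
    have hκ : ∀ a : ZMod n, (if IsLow r a then (1 : GF) else q) ≠ 0 := fun a => by
      split_ifs
      · exact one_ne_zero
      · exact q_ne_zero
    obtain ⟨k, hk⟩ : ∃ k : ℤ, alphaVee r i = deltaVee i - deltaVee (i + 1) + k • cVee := ⟨_, rfl⟩
    -- The scalars come from `e_i` and `f_i`, from the two one-site adjunctions, and from moving
    -- `q^{δ_{i+1}^∨}` past `up`. The power `q ^ (-k)` cancels the action of the central part of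
    -- `-α_i^∨`.
    refine ⟨scalE r 1 i * (if IsLow r i then 1 else q) * (if IsLow r (i + 1) then 1 else q)⁻¹
      * q * q ^ (-k) * (scalF 1 i)⁻¹,
      mul_ne_zero (mul_ne_zero (mul_ne_zero (mul_ne_zero (mul_ne_zero (scalE_ne_zero _ _) (hκ _))
        (inv_ne_zero (hκ _))) q_ne_zero) (q_zpow_ne_zero _)) (inv_ne_zero (scalF_ne_zero _ _)),
      fun u v => ?_⟩
    have e1 : oscK r (deltaVee (i + 1)) (up r (i + 1) (down r i (oscK r (-(deltaVee i)) v)))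
        = (q * q ^ (-k)) • down r i (up r (i + 1) (oscK r (-(alphaVee r i)) v)) := by
      have a1 : -(alphaVee r i) = deltaVee (i + 1) + (-(deltaVee i) + (-k) • cVee) := by
        rw [hk, neg_smul]; abel
      have a2 := LinearMap.congr_fun (oscK_up (r := r) (deltaVee (i + 1)) (i + 1))
        (down r i (oscK r (-(deltaVee i)) v))
      have a3 := LinearMap.congr_fun (oscK_down (r := r) (deltaVee (i + 1)) i)
        (oscK r (-(deltaVee i)) v)
      have a4 := LinearMap.congr_fun (up_down (r := r) (hn.add_one_ne i)).eq
        (oscK r (deltaVee (i + 1)) (oscK r (-(deltaVee i)) v))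
      have b1 : deltaVee (i + 1) (delta (i + 1)) = 1 := by simp [deltaVee, delta]
      have b2 : deltaVee (i + 1) (delta i) = 0 := by
        simp [deltaVee, delta, hn.one_ne_zero]
      simp only [Module.End.mul_apply, LinearMap.smul_apply, b1, b2, zpow_one, neg_zero, zpow_zero,
        one_smul] at a2 a3 a4
      rw [a2, a3, a4, a1, oscK_add, oscK_add, Module.End.mul_apply, Module.End.mul_apply, oscK_c,
        neg_neg]
      simp only [map_smul, smul_smul]
      rw [mul_assoc, ← zpow_add₀ q_ne_zero, neg_add_cancel, zpow_zero, mul_one]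
    rw [oscRep_E, oscRep_F, oscRep_K]
    simp only [LinearMap.smul_apply, Module.End.mul_apply, map_smul, smul_eq_mul]
    rw [oscForm_up, oscForm_down, e1, map_smul, smul_eq_mul]
    have := scalF_ne_zero 1 i
    field_simp
  choose θ h1 h2 using key
  exact ⟨θ, h1, oscForm_symm, fun h u v => by rw [oscRep_K]; exact oscForm_K h u v, h2⟩

/-! ### Positivity of the form on `𝓦 ⊗ 𝓦` -/

section pairForm

variable [NeZero n]

/-- The form on `𝓦 ⊗ 𝓦`. -/
def pairForm (n : ℕ) [NeZero n] : LinearMap.BilinForm GF (OscSpace n ⊗[GF] OscSpace n) :=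
  (oscForm n).tmul (oscForm n)

theorem pairForm_ket (x y : ZMod n → ℕ) (z : OscSpace n ⊗[GF] OscSpace n) :
    pairForm n (ket x ⊗ₜ ket y) z = oscNorm x * oscNorm y * coef x y z := by
  induction z using TensorProduct.induction_on with
  | zero => simp
  | add v w hv hw => rw [map_add, hv, hw, map_add, mul_add]
  | tmul v w =>
    rw [pairForm, bilin_tmul_apply, oscForm_ket, oscForm_ket, coef_tmul]; ring

/-- In the orthogonal basis the value is a sum of squares with weights that are positive at the real
place. -/
theorem phi_pairForm_pos {z : OscSpace n ⊗[GF] OscSpace n} (hz : z ≠ 0) :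
    0 < phi (pairForm n z z) := by
  have e : pairForm n z z = ∑ p ∈ ((pairBasis n).repr z).support,
      (pairBasis n).repr z p * (oscNorm p.1 * oscNorm p.2 * (pairBasis n).repr z p) := by
    conv_lhs => enter [1]; rw [← (pairBasis n).linearCombination_repr z]
    rw [Finsupp.linearCombination_apply, Finsupp.sum, map_sum, LinearMap.sum_apply]
    refine Finset.sum_congr rfl fun p _ => ?_
    rw [map_smul, LinearMap.smul_apply, smul_eq_mul, pairBasis_apply, pairForm_ket]
    rfl
  rw [e, map_sum]
  refine Finset.sum_pos (fun p hp => ?_) ?_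
  · rw [Finsupp.mem_support_iff] at hp
    have h1 : phi ((pairBasis n).repr z p) ≠ 0 := (map_ne_zero phi).mpr hp
    simp only [map_mul]
    have h2 := phi_oscNorm_pos p.1
    have h3 := phi_oscNorm_pos p.2
    have h4 := mul_self_pos.mpr h1
    calc (0 : ℝ) < (phi (oscNorm p.1) * phi (oscNorm p.2)) *
          (phi ((pairBasis n).repr z p) * phi ((pairBasis n).repr z p)) := by positivity
      _ = _ := by ring
  · rw [Finsupp.support_nonempty_iff]
    exact fun h => hz ((pairBasis n).repr.map_eq_zero_iff.mp h)

end pairForm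

/-! ## Orthogonal complements of submodules -/

/-- Orthogonal projection onto a finite-dimensional subspace, for an anisotropic form. -/
theorem exists_orthogonal_projection {V : Type*} [AddCommGroup V] [Module GF V]
    {B : LinearMap.BilinForm GF V} (hB : ∀ v, v ≠ 0 → B v v ≠ 0) (L : Submodule GF V)
    [FiniteDimensional GF L] (v : V) : ∃ a ∈ L, ∀ w ∈ L, B (v - a) w = 0 := by
  -- Anisotropy makes the map from `L` to its dual injective, finite dimension makes it surjective,
  -- and the functional `B v` on `L` is then represented by some `a`.
  let f : L →ₗ[GF] Module.Dual GF L := (B.compl₁₂ L.subtype L.subtype)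
  have hf : Function.Injective f := by
    rw [← LinearMap.ker_eq_bot, LinearMap.ker_eq_bot']
    intro x hx
    by_contra h0
    exact hB x (fun h => h0 (Subtype.ext h)) (LinearMap.congr_fun hx x)
  have hs : Function.Surjective f :=
    (LinearMap.injective_iff_surjective_of_finrank_eq_finrank
      (Subspace.dual_finrank_eq (K := GF) (V := L)).symm).mp hf
  obtain ⟨a, ha⟩ := hs ((B v).comp L.subtype)
  refine ⟨a, a.2, fun w hw => ?_⟩
  have := LinearMap.congr_fun ha ⟨w, hw⟩
  simp only [f, LinearMap.compl₁₂_apply, Submodule.subtype_apply, LinearMap.comp_apply] at this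
  rw [map_sub, LinearMap.sub_apply, this, sub_self]

theorem exists_coWt_ne {μ ν : Wt n} (h : μ ≠ ν) : ∃ f : CoWt n, f μ ≠ f ν := by
  by_contra! hc
  refine h (Prod.ext ?_ (funext fun i => ?_))
  · simpa [cVee] using hc cVee
  · simpa [deltaVee] using hc (deltaVee i)

section RepMod

variable {A V : Type*} [Ring A] [Algebra GF A] [AddCommGroup V] [Module GF V]
  {ρ : A →ₐ[GF] Module.End GF V}

theorem RepMod.rep_mem (N : Submodule A (RepMod ρ)) (a : A) {v : V}
    (hv : (v : RepMod ρ) ∈ N) : (ρ a v : RepMod ρ) ∈ N :=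
  N.smul_mem a hv

/-- A submodule of `RepMod ρ` as a subspace. -/
def RepMod.toSubspace (N : Submodule A (RepMod ρ)) : Submodule GF V where
  carrier := {v : V | (v : RepMod ρ) ∈ N}
  add_mem' ha hb := N.add_mem ha hb
  zero_mem' := N.zero_mem
  smul_mem' c v hv := by
    have := RepMod.rep_mem N (algebraMap GF A c) hv
    rwa [AlgHom.commutes, Module.algebraMap_end_apply] at this

/-- The submodule of vectors orthogonal to `N`. -/
def perp (B : LinearMap.BilinForm GF V) (hadj : ∀ a, ∃ a', ∀ u v, B (ρ a u) v = B u (ρ a' v))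
    (N : Submodule A (RepMod ρ)) : Submodule A (RepMod ρ) where
  carrier := {v : V | ∀ w ∈ RepMod.toSubspace N, B v w = 0}
  add_mem' {u v} ha hb w hw := by
    have e : ∀ u v : V, B u w = 0 → B v w = 0 → B (u + v) w = 0 := fun u v h1 h2 => by
      rw [map_add, LinearMap.add_apply, h1, h2, add_zero]
    exact e u v (ha w hw) (hb w hw)
  zero_mem' w _ := by
    have : B (0 : V) w = 0 := by rw [map_zero, LinearMap.zero_apply]
    exact this
  smul_mem' a v hv w hw := by
    obtain ⟨a', h⟩ := hadj a
    exact (h v w).trans (hv _ (RepMod.rep_mem N a' hw))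

end RepMod

/-! ### Weight components of invariant subspaces -/

section weights

variable {V : Type*} [AddCommGroup V] [Module GF V] {ρ : Uq n r →ₐ[GF] Module.End GF V}

theorem mem_weightSpace {μ : Wt n} {v : V} :
    v ∈ weightSpace ρ μ ↔ ∀ h : CoWt n, ρ (Uq.K r h) v = q ^ (h μ) • v := Iff.rfl

theorem E_mem_weightSpace {μ : Wt n} {v : V} (hv : v ∈ weightSpace ρ μ) (i : ZMod n) :
    ρ (Uq.E r i) v ∈ weightSpace ρ (μ + alpha i) := by
  intro h
  rw [← Module.End.mul_apply, ← map_mul, (Uq.relations n r).K_mul_E, map_smul, map_mul,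
    LinearMap.smul_apply, Module.End.mul_apply, hv h, map_smul, smul_smul, map_add,
    zpow_add₀ q_ne_zero, mul_comm]

/-- A subspace that is invariant under all `q^h` contains the weight components of its
elements. -/
theorem component_mem {L : Submodule GF V} (hL : ∀ h, ∀ v ∈ L, ρ (Uq.K r h) v ∈ L)
    {w : Wt n → V} (hw : ∀ ν, w ν ∈ weightSpace ρ ν) {μ : Wt n} (s : Finset (Wt n)) (hμ : μ ∉ s)
    (h : w μ + ∑ ν ∈ s, w ν ∈ L) : w μ ∈ L := by
  classical
  induction s using Finset.induction_on generalizing w with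
  | empty => simpa using h
  | insert ν s hν ih =>
    rw [Finset.mem_insert, not_or] at hμ
    obtain ⟨f, hf⟩ := exists_coWt_ne hμ.1
    -- Subtracting from `q^f` its eigenvalue at `ν` kills the component at `ν` and multiplies the
    -- one at `μ` by a non-zero scalar, so the induction removes one weight at a time.
    have h1 : ∀ κ, ρ (Uq.K r f) (w κ) - q ^ (f ν) • w κ = (q ^ (f κ) - q ^ (f ν)) • w κ :=
      fun κ => by rw [hw κ f, sub_smul]
    have h2 := L.sub_mem (hL f _ h) (L.smul_mem (q ^ (f ν)) h)
    rw [map_add, smul_add, add_sub_add_comm, h1, map_sum, Finset.smul_sum,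
      ← Finset.sum_sub_distrib, Finset.sum_congr rfl (fun κ _ => h1 κ), Finset.sum_insert hν,
      sub_self, zero_smul, zero_add] at h2
    have h3 := ih (w := fun κ => (q ^ (f κ) - q ^ (f ν)) • w κ)
      (fun κ => Submodule.smul_mem _ _ (hw κ)) hμ.2 h2
    exact (L.smul_mem_iff (sub_ne_zero.mpr fun h => hf (q_zpow_inj.mp h))).mp h3

/-- Every element of an invariant subspace is the sum of its weight components. -/
theorem exists_components (hsup : ⨆ μ, weightSpace ρ μ = ⊤) {L : Submodule GF V}
    (hL : ∀ h, ∀ v ∈ L, ρ (Uq.K r h) v ∈ L) {v : V} (hv : v ∈ L) :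
    ∃ w : Wt n →₀ V, (∀ ν, w ν ∈ weightSpace ρ ν ∧ w ν ∈ L) ∧ (w.sum fun _ x => x) = v := by
  classical
  have h : v ∈ ⨆ μ, weightSpace ρ μ := hsup ▸ Submodule.mem_top
  obtain ⟨w, h1, h2⟩ := (Submodule.mem_iSup_iff_exists_finsupp _ _).mp h
  refine ⟨w, fun ν => ⟨h1 ν, ?_⟩, h2⟩
  by_cases hν : ν ∈ w.support
  · refine component_mem hL h1 (w.support.erase ν) (Finset.notMem_erase _ _) ?_
    rw [Finset.add_sum_erase _ _ hν]
    rw [Finsupp.sum] at h2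
    rwa [h2]
  · rw [Finsupp.notMem_support_iff.mp hν]; exact L.zero_mem

variable {B : LinearMap.BilinForm GF V}

theorem weightSpace_orthogonal (hK : ∀ h u v, B (ρ (Uq.K r h) u) v = B u (ρ (Uq.K r h) v))
    {μ ν : Wt n} (hμν : μ ≠ ν) {u v : V} (hu : u ∈ weightSpace ρ μ) (hv : v ∈ weightSpace ρ ν) :
    B u v = 0 := by
  obtain ⟨f, hf⟩ := exists_coWt_ne hμν
  have h := hK f u v
  rw [hu f, hv f, map_smul, LinearMap.smul_apply, map_smul, smul_eq_mul, smul_eq_mul] at h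
  by_contra h0
  exact hf (q_zpow_inj.mp (mul_right_cancel₀ h0 h))

variable {A : Type*} [Ring A] [Algebra GF A] {σ : A →ₐ[GF] Module.End GF V}

/-- Submodules are orthogonally complemented. -/
theorem isCompl_perp (hsup : ⨆ μ, weightSpace ρ μ = ⊤)
    (hfin : ∀ μ, FiniteDimensional GF (weightSpace ρ μ))
    (hK : ∀ h u v, B (ρ (Uq.K r h) u) v = B u (ρ (Uq.K r h) v))
    (hB : ∀ v, v ≠ 0 → B v v ≠ 0)
    (hadj : ∀ a, ∃ a', ∀ u v, B (σ a u) v = B u (σ a' v))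
    (hσ : ∀ h, ∃ a, σ a = ρ (Uq.K r h)) (N : Submodule A (RepMod σ)) :
    IsCompl N (perp B hadj N) := by
  have hL : ∀ h, ∀ v ∈ RepMod.toSubspace N, ρ (Uq.K r h) v ∈ RepMod.toSubspace N := by
    intro h v hv
    obtain ⟨a, ha⟩ := hσ h
    rw [← ha]
    exact RepMod.rep_mem N a hv
  constructor
  · rw [Submodule.disjoint_def]
    intro v h1 h2
    by_contra h0
    exact hB v h0 (h2 v h1)
  · have hle : ⨆ μ, weightSpace ρ μ ≤ RepMod.toSubspace (N ⊔ perp B hadj N) := by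
      refine iSup_le fun μ v hv => ?_
      have : FiniteDimensional GF ↥(RepMod.toSubspace N ⊓ weightSpace ρ μ) :=
        Submodule.finiteDimensional_inf_right _ _
      -- The submodule may be infinite-dimensional, so the projection is taken onto its part of
      -- weight `μ` only. The other weight components of its elements are orthogonal to weight `μ`
      -- anyway.
      obtain ⟨a, ⟨haN, haμ⟩, ha⟩ :=
        exists_orthogonal_projection hB (RepMod.toSubspace N ⊓ weightSpace ρ μ) v
      suffices hb : (v - a : V) ∈ RepMod.toSubspace (perp B hadj N) by
        have h1 : a ∈ RepMod.toSubspace (N ⊔ perp B hadj N) :=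
          (le_sup_left : N ≤ N ⊔ perp B hadj N) haN
        have h2 : v - a ∈ RepMod.toSubspace (N ⊔ perp B hadj N) :=
          (le_sup_right : perp B hadj N ≤ N ⊔ perp B hadj N) hb
        simpa using Submodule.add_mem _ h1 h2
      intro w hw
      obtain ⟨f, hf, rfl⟩ := exists_components hsup hL hw
      rw [Finsupp.sum, map_sum]
      refine Finset.sum_eq_zero fun ν _ => ?_
      by_cases hν : μ = ν
      · subst hν
        exact ha _ ⟨(hf μ).2, (hf μ).1⟩
      · exact weightSpace_orthogonal hK hν (Submodule.sub_mem _ hv haμ) (hf ν).1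
    rw [hsup] at hle
    rw [codisjoint_iff, Submodule.eq_top_iff']
    have h : ∀ v : V, v ∈ RepMod.toSubspace (N ⊔ perp B hadj N) := fun v => hle Submodule.mem_top
    exact h

/-! ## Existence of highest weight vectors -/

/-- The position of a node in `1, …, n`. -/
def pos (i : ZMod n) : ℤ := if i = 0 then n else i.val

theorem pos_add_one (hn : Admissible n r) {i : ZMod n} (hi : i ≠ 0) : pos (i + 1) = pos i + 1 := by
  have h1 := hn.val_add_one i
  have h2 : i + 1 = 0 ↔ i.val + 1 = n := by
    rw [← ZMod.val_eq_zero, h1]; split_ifs with h <;> simp [h]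
  unfold pos
  rw [if_neg hi]
  by_cases h : i + 1 = 0
  · have h3 := h2.mp h
    rw [if_pos h]; omega
  · rw [if_neg h, h1, if_neg (mt h2.mpr h)]; push_cast; rfl

/-- The height of a weight. -/
def height [NeZero n] (r : ℕ) (μ : Wt n) : ℤ := ∑ a, ((r : ℤ) - pos a) * μ.2 a

theorem height_add [NeZero n] (μ ν : Wt n) : height r (μ + ν) = height r μ + height r ν := by
  simp [height, mul_add, Finset.sum_add_distrib]

theorem height_alpha [NeZero n] (hn : Admissible n r) {i : ZMod n} (hi : i ≠ 0) :
    height r (alpha i) = 1 := by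
  simp only [height, alpha, delta, Prod.snd_sub, Pi.sub_apply, mul_sub, Finset.sum_sub_distrib,
    Pi.single_apply, mul_ite, mul_one, mul_zero, Finset.sum_ite_eq', Finset.mem_univ, if_true]
  rw [pos_add_one hn hi]; ring

theorem isLow_iff_pos_le [NeZero n] (hn : Admissible n r) (i : ZMod n) :
    IsLow r i ↔ pos i ≤ r := by
  have h2 := hn.add_two_le
  unfold IsLow pos
  split_ifs with h
  · simp [h]; omega
  · simp only [h, Ne, not_false_iff, true_and, Nat.cast_le]

/-- The factor `r - pos a` is non-negative exactly at the low sites, where the weight coordinate is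
non-positive; at high sites both signs are reversed. -/
theorem height_nonpos [NeZero n] (hn : Admissible n r) (x y : ZMod n → ℕ) :
    height r (ketWt r x + ketWt r y) ≤ 0 := by
  refine Finset.sum_nonpos fun a _ => ?_
  have h := isLow_iff_pos_le hn a
  simp only [ketWt, Prod.snd_add, Pi.add_apply]
  split_ifs with ha
  · have := h.mp ha
    nlinarith
  · have := mt h.mpr ha
    nlinarith

/-- A non-zero submodule contains a highest weight vector, of maximal height among its
weights. -/
theorem exists_highest_weight_vector [NeZero n] (hn : Admissible n r)
    (hsup : ⨆ μ, weightSpace ρ μ = ⊤)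
    (hht : ∀ μ, ∀ v ∈ weightSpace ρ μ, v ≠ 0 → height r μ ≤ 0) {L : Submodule GF V}
    (hK : ∀ h, ∀ v ∈ L, ρ (Uq.K r h) v ∈ L) (hE : ∀ i, i ≠ 0 → ∀ v ∈ L, ρ (Uq.E r i) v ∈ L)
    (hL : ∃ v ∈ L, v ≠ 0) :
    ∃ μ, ∃ v ∈ L, v ≠ 0 ∧ v ∈ weightSpace ρ μ ∧ (∀ i, i ≠ 0 → ρ (Uq.E r i) v = 0) ∧
      ∀ ν, height r μ < height r ν → ∀ w ∈ L, w ∈ weightSpace ρ ν → w = 0 := by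
  classical
  -- Heights of weights are bounded above by zero, so a maximal one is found as the least natural
  -- number `-height`. Each `e_i` with `i ≠ 0` raises the height by one and must annihilate the
  -- vector.
  have hex : ∃ k : ℕ, ∃ μ, height r μ = -(k : ℤ) ∧ ∃ v ∈ L, v ≠ 0 ∧ v ∈ weightSpace ρ μ := by
    obtain ⟨v, hv, h0⟩ := hL
    obtain ⟨w, hw, rfl⟩ := exists_components hsup hK hv
    obtain ⟨ν, hν⟩ : ∃ ν, w ν ≠ 0 := by
      by_contra! hc
      exact h0 (Finset.sum_eq_zero fun ν _ => hc ν)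
    have := hht ν _ (hw ν).1 hν
    exact ⟨(-(height r ν)).toNat, ν, by omega, w ν, (hw ν).2, hν, (hw ν).1⟩
  obtain ⟨μ, hμ, v, hv, h0, hvμ⟩ := Nat.find_spec hex
  have hmax : ∀ ν, height r μ < height r ν → ∀ w ∈ L, w ∈ weightSpace ρ ν → w = 0 := by
    intro ν hν w hw hwν
    by_contra hw0
    have := hht ν w hwν hw0
    have h2 := Nat.find_min' hex (m := (-(height r ν)).toNat) ⟨ν, by omega, w, hw, hw0, hwν⟩
    omega
  refine ⟨μ, v, hv, h0, hvμ, fun i hi => ?_, hmax⟩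
  refine hmax (μ + alpha i) ?_ _ (hE i hi v hv) (E_mem_weightSpace hvμ i)
  rw [height_add, height_alpha hn hi]; omega

end weights

/-! ## The module `𝓦_l ⊗ 𝓦_m` -/

/-- The representation on `𝓦_l ⊗ 𝓦_m`. -/
abbrev fundPairRep (hn : Admissible n r) (l m : ℤ) :
    Uq n r →ₐ[GF] Module.End GF (Fund n r l ⊗[GF] Fund n r m) :=
  tensorRep hn (fundRep hn l 1) (fundRep hn m 1)

/-- The inclusion of `𝓦_l ⊗ 𝓦_m` into `𝓦 ⊗ 𝓦`. -/
def incl (n r : ℕ) (l m : ℤ) : Fund n r l ⊗[GF] Fund n r m →ₗ[GF] OscSpace n ⊗[GF] OscSpace n :=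
  TensorProduct.map (Fund n r l).subtype (Fund n r m).subtype

theorem incl_injective (l m : ℤ) : Function.Injective (incl n r l m) :=
  TensorProduct.map_injective_of_flat_flat _ _ (Fund n r l).subtype_injective
    (Fund n r m).subtype_injective

/-- Allows all computations to be made in `𝓦 ⊗ 𝓦`, where a basis is at hand. -/
theorem incl_rep (hn : Admissible n r) (l m : ℤ) (a : Uq n r) (v : Fund n r l ⊗[GF] Fund n r m) :
    incl n r l m (fundPairRep hn l m a v) = pairRep hn a (incl n r l m v) :=
  map_tensorRep hn _ _ _ _ (fun _ _ => rfl) (fun _ _ => rfl) a v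

/-- The vector `|x⟩ ⊗ |y⟩` of `𝓦_l ⊗ 𝓦_m`. -/
def ketPair {l m : ℤ} {x y : ZMod n → ℕ} (hx : charge r x = l) (hy : charge r y = m) :
    Fund n r l ⊗[GF] Fund n r m :=
  (⟨ket x, fund_ket hx⟩ : Fund n r l) ⊗ₜ (⟨ket y, fund_ket hy⟩ : Fund n r m)

section fundTensor

variable {l m : ℤ}

theorem incl_ketPair {x y : ZMod n → ℕ} (hx : charge r x = l) (hy : charge r y = m) :
    incl n r l m (ketPair hx hy) = ket x ⊗ₜ ket y := by
  simp [incl, ketPair]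

theorem eq_top_of_ketPair_mem {p : Submodule GF (Fund n r l ⊗[GF] Fund n r m)}
    (h : ∀ x y (hx : charge r x = l) (hy : charge r y = m), ketPair hx hy ∈ p) : p = ⊤ := by
  rw [Submodule.eq_top_iff']
  have h1 : ∀ u (hu : u ∈ Fund n r l) y (hy : charge r y = m),
      (⟨u, hu⟩ : Fund n r l) ⊗ₜ[GF] (⟨ket y, fund_ket hy⟩ : Fund n r m) ∈ p := by
    intro u hu y hy
    induction hu using Submodule.span_induction with
    | mem u hu =>
      obtain ⟨x, hx, rfl⟩ := hu
      exact h x y hx hy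
    | zero =>
      have : (⟨0, Submodule.zero_mem _⟩ : Fund n r l) = 0 := rfl
      rw [this, TensorProduct.zero_tmul]
      exact Submodule.zero_mem _
    | add u v hu hv h1 h2 =>
      have : (⟨u + v, Submodule.add_mem _ hu hv⟩ : Fund n r l) = ⟨u, hu⟩ + ⟨v, hv⟩ := rfl
      rw [this, TensorProduct.add_tmul]
      exact Submodule.add_mem _ h1 h2
    | smul c u hu h1 =>
      have : (⟨c • u, Submodule.smul_mem _ c hu⟩ : Fund n r l) = c • ⟨u, hu⟩ := rfl
      rw [this, ← TensorProduct.smul_tmul']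
      exact Submodule.smul_mem _ _ h1
  have h2 : ∀ (u : Fund n r l) w (hw : w ∈ Fund n r m), u ⊗ₜ[GF] (⟨w, hw⟩ : Fund n r m) ∈ p := by
    intro u w hw
    induction hw using Submodule.span_induction with
    | mem w hw =>
      obtain ⟨y, hy, rfl⟩ := hw
      exact h1 u.1 u.2 y hy
    | zero =>
      have : (⟨0, Submodule.zero_mem _⟩ : Fund n r m) = 0 := rfl
      rw [this, TensorProduct.tmul_zero]
      exact Submodule.zero_mem _
    | add w v hw hv h1 h2 =>
      have : (⟨w + v, Submodule.add_mem _ hw hv⟩ : Fund n r m) = ⟨w, hw⟩ + ⟨v, hv⟩ := rfl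
      rw [this, TensorProduct.tmul_add]
      exact Submodule.add_mem _ h1 h2
    | smul c w hw h1 =>
      have : (⟨c • w, Submodule.smul_mem _ c hw⟩ : Fund n r m) = c • ⟨w, hw⟩ := rfl
      rw [this, TensorProduct.tmul_smul]
      exact Submodule.smul_mem _ _ h1
  intro z
  induction z using TensorProduct.induction_on with
  | zero => exact Submodule.zero_mem _
  | add v w hv hw => exact Submodule.add_mem _ hv hw
  | tmul u w => exact h2 u w.1 w.2

open Classical in
theorem coef_ket (x y x' y' : ZMod n → ℕ) :
    coef x y (ket x' ⊗ₜ ket y') = if x' = x ∧ y' = y then 1 else 0 := by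
  rw [coef_tmul, oscCoord_ket, oscCoord_ket]
  split_ifs <;> simp_all

theorem ketPair_ne_zero {x y : ZMod n → ℕ} (hx : charge r x = l) (hy : charge r y = m) :
    ketPair hx hy ≠ 0 := by
  intro h
  have := coef_ket x y x y
  rw [← incl_ketPair hx hy, h, map_zero, map_zero, if_pos ⟨rfl, rfl⟩] at this
  exact zero_ne_one this

/-- The vectors whose coefficients are supported on a given set. -/
def supportedOn (l m : ℤ) (P : (ZMod n → ℕ) → (ZMod n → ℕ) → Prop) :
    Submodule GF (Fund n r l ⊗[GF] Fund n r m) where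
  carrier := {v | ∀ x y, coef x y (incl n r l m v) ≠ 0 → P x y}
  add_mem' {u v} hu hv x y h := by
    by_contra hP
    apply h
    rw [map_add, map_add, not_not.mp (mt (hu x y) hP), not_not.mp (mt (hv x y) hP), add_zero]
  zero_mem' x y h := absurd (by rw [map_zero, map_zero]) h
  smul_mem' c v hv x y h := by
    refine hv x y fun h0 => h ?_
    rw [map_smul, map_smul, h0, smul_zero]

theorem ketPair_mem_supportedOn {P : (ZMod n → ℕ) → (ZMod n → ℕ) → Prop} {x y : ZMod n → ℕ}
    (hx : charge r x = l) (hy : charge r y = m) (h : P x y) :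
    ketPair hx hy ∈ supportedOn l m P := by
  intro x' y' hc
  rw [incl_ketPair, coef_ket] at hc
  split_ifs at hc with h'
  · rw [← h'.1, ← h'.2]; exact h
  · exact absurd rfl hc

theorem charge_of_coef_ne_zero {v : Fund n r l ⊗[GF] Fund n r m} {x y : ZMod n → ℕ}
    (h : coef x y (incl n r l m v) ≠ 0) : charge r x = l ∧ charge r y = m := by
  have : supportedOn (n := n) l m (fun x y => charge r x = l ∧ charge r y = m) = ⊤ :=
    eq_top_of_ketPair_mem fun x y hx hy => ketPair_mem_supportedOn hx hy ⟨hx, hy⟩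
  have hv : v ∈ supportedOn (n := n) l m (fun x y => charge r x = l ∧ charge r y = m) :=
    this ▸ Submodule.mem_top
  exact hv x y h

theorem eq_zero_of_coef {v : Fund n r l ⊗[GF] Fund n r m}
    (h : ∀ x y, coef x y (incl n r l m v) = 0) : v = 0 :=
  incl_injective l m (by rw [map_zero]; exact coef_ext_zero h)

theorem eq_of_coef {v w : Fund n r l ⊗[GF] Fund n r m}
    (h : ∀ x y, coef x y (incl n r l m v) = coef x y (incl n r l m w)) : v = w := by
  rw [← sub_eq_zero]
  exact eq_zero_of_coef fun x y => by rw [map_sub, map_sub, h, sub_self]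

theorem exists_coef_ne_zero {v : Fund n r l ⊗[GF] Fund n r m} (h : v ≠ 0) :
    ∃ x y, coef x y (incl n r l m v) ≠ 0 := by
  by_contra! hc
  exact h (eq_zero_of_coef hc)

/-- The total weight of `|x⟩ ⊗ |y⟩`. -/
abbrev pairWt (r : ℕ) (x y : ZMod n → ℕ) : Wt n := ketWt r x + ketWt r y

theorem pairWt_eq (x y : ZMod n → ℕ) :
    pairWt r x y = (-2, fun i => if IsLow r i then -((x + y) i : ℤ) else (x + y) i) := by
  refine Prod.ext (by simp [pairWt, ketWt]) (funext fun i => ?_)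
  by_cases h : IsLow r i <;> simp [pairWt, ketWt, h]
  ring

/-- The level is always `-2` and the sign at each site is fixed, so even the image in `P_fin`
determines the total occupation numbers. -/
theorem toFin_pairWt_inj {x y x' y' : ZMod n → ℕ}
    (h : toFin n r (pairWt r x y) = toFin n r (pairWt r x' y')) : x + y = x' + y' := by
  funext i
  have := congrFun h i
  rw [pairWt_eq, pairWt_eq] at this
  simp only [toFin, LinearMap.coe_mk, AddHom.coe_mk] at this
  split_ifs at this <;> omega

theorem mem_weightSpace_iff (hn : Admissible n r) {μ : Wt n} {v : Fund n r l ⊗[GF] Fund n r m} :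
    v ∈ weightSpace (fundPairRep hn l m) μ
      ↔ ∀ x y, coef x y (incl n r l m v) ≠ 0 → pairWt r x y = μ := by
  rw [mem_weightSpace]
  constructor
  · intro h x y hc
    by_contra hne
    obtain ⟨f, hf⟩ := exists_coWt_ne hne
    have h1 := congrArg (fun z => coef x y (incl n r l m z)) (h f)
    simp only [incl_rep, coef_pairRep_K, map_smul, smul_eq_mul] at h1
    exact hf (q_zpow_inj.mp (mul_right_cancel₀ hc h1))
  · intro h f
    refine eq_of_coef fun x y => ?_
    rw [incl_rep, coef_pairRep_K, map_smul, map_smul, smul_eq_mul]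
    by_cases hc : coef x y (incl n r l m v) = 0
    · rw [hc, mul_zero, mul_zero]
    · have e : ketWt r x + ketWt r y = μ := h x y hc
      rw [e]

theorem mem_finWeightSpace_iff (hn : Admissible n r) {μ : WtFin n}
    {v : Fund n r l ⊗[GF] Fund n r m} :
    v ∈ finWeightSpace ((fundPairRep hn l m).comp (UqGl n r).val) μ
      ↔ ∀ x y, coef x y (incl n r l m v) ≠ 0 → toFin n r (pairWt r x y) = μ := by
  have e : v ∈ finWeightSpace ((fundPairRep hn l m).comp (UqGl n r).val) μ
      ↔ ∀ i, fundPairRep hn l m (Uq.K r (finVee r i)) v = q ^ (μ i) • v := Iff.rfl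
  rw [e]
  constructor
  · intro h x y hc
    funext i
    have h1 := congrArg (fun z => coef x y (incl n r l m z)) (h i)
    simp only [incl_rep, coef_pairRep_K, map_smul, smul_eq_mul] at h1
    rw [toFin_apply]
    exact q_zpow_inj.mp (mul_right_cancel₀ hc h1)
  · intro h i
    refine eq_of_coef fun x y => ?_
    rw [incl_rep, coef_pairRep_K, map_smul, map_smul, smul_eq_mul]
    by_cases hc : coef x y (incl n r l m v) = 0
    · rw [hc, mul_zero, mul_zero]
    · rw [← h x y hc, toFin_apply]

/-- Weight decompositions of `𝓦_l ⊗ 𝓦_m`, where `|x⟩ ⊗ |y⟩` has weight `π x y`. -/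
theorem goodWeights [NeZero n] {M : Type*} [AddCommGroup M] {roots : Set M}
    {π : (ZMod n → ℕ) → (ZMod n → ℕ) → M} {W : M → Submodule GF (Fund n r l ⊗[GF] Fund n r m)}
    (hW : ∀ μ v, v ∈ W μ ↔ ∀ x y, coef x y (incl n r l m v) ≠ 0 → π x y = μ)
    (hinj : ∀ x y x' y', π x y = π x' y' → x + y = x' + y')
    (hdom : ∃ γ, ∀ x y, charge r x = l → charge r y = m →
      γ - π x y ∈ AddSubmonoid.closure roots) : GoodWeights roots W := by
  refine ⟨?_, ?_, fun μ => ?_, ?_⟩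
  · intro μ
    have h1 : (⨆ ν, ⨆ _ : ν ≠ μ, W ν) ≤ supportedOn l m fun x y => π x y ≠ μ :=
      iSup₂_le fun ν hν v hv x y hc h => hν (((hW ν v).mp hv x y hc).symm.trans h)
    rw [Submodule.disjoint_def]
    intro v hv hv'
    refine eq_zero_of_coef fun x y => ?_
    by_contra hc
    exact h1 hv' x y hc ((hW μ v).mp hv x y hc)
  · refine eq_top_of_ketPair_mem fun x y hx hy => ?_
    exact Submodule.mem_iSup_of_mem (π x y) ((hW _ _).mpr (ketPair_mem_supportedOn hx hy rfl))
  -- The weight fixes `x + y`, and only finitely many pairs have a given sum. A vector of this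
  -- weight is determined by its coefficients at these pairs.
  · have hfin : {p : (ZMod n → ℕ) × (ZMod n → ℕ) | π p.1 p.2 = μ}.Finite := by
      by_cases hne : ∃ x y, π x y = μ
      · obtain ⟨x, y, rfl⟩ := hne
        refine ((Set.finite_Iic (x + y)).prod (Set.finite_Iic (x + y))).subset fun p hp => ?_
        have := hinj _ _ _ _ hp
        rw [Set.mem_prod, Set.mem_Iic, Set.mem_Iic, ← this]
        exact ⟨le_self_add, le_add_self⟩
      · exact Set.finite_empty.subset fun p hp => hne ⟨_, _, hp⟩
    have : Finite {p : (ZMod n → ℕ) × (ZMod n → ℕ) | π p.1 p.2 = μ} := hfin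
    let f : W μ →ₗ[GF] ({p : (ZMod n → ℕ) × (ZMod n → ℕ) | π p.1 p.2 = μ} → GF) :=
      LinearMap.pi fun p => (coef p.1.1 p.1.2).comp ((incl n r l m).comp (W μ).subtype)
    refine Module.Finite.of_injective f ?_
    refine fun v w hvw => Subtype.ext (eq_of_coef fun x y => ?_)
    by_cases hπ : π x y = μ
    · exact congrFun hvw ⟨(x, y), hπ⟩
    · rw [not_not.mp (mt ((hW μ v).mp v.2 x y) hπ), not_not.mp (mt ((hW μ w).mp w.2 x y) hπ)]
  · obtain ⟨γ, hγ⟩ := hdom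
    refine ⟨{γ}, Set.finite_singleton γ, fun μ hμ => ⟨γ, rfl, ?_⟩⟩
    obtain ⟨v, hv, h0⟩ := (Submodule.ne_bot_iff _).mp hμ
    obtain ⟨x, y, hc⟩ := exists_coef_ne_zero h0
    obtain ⟨hx, hy⟩ := charge_of_coef_ne_zero hc
    rw [← (hW μ v).mp hv x y hc]
    exact hγ x y hx hy

/-- Telescoping; since `b ≤ n`, the node `0` does not occur among the simple roots used. -/
theorem delta_sub_delta_mem {a b : ℕ} (ha : 1 ≤ a) (hab : a ≤ b)
    (hb : b ≤ n) : (delta (a : ZMod n) - delta (b : ZMod n) : Wt n)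
      ∈ AddSubmonoid.closure {a : Wt n | ∃ i : ZMod n, i ≠ 0 ∧ a = alpha i} := by
  induction b, hab using Nat.le_induction with
  | base => rw [sub_self]; exact AddSubmonoid.zero_mem _
  | succ b hab ih =>
    have e : (delta (a : ZMod n) - delta ((b + 1 : ℕ) : ZMod n) : Wt n)
        = (delta (a : ZMod n) - delta (b : ZMod n)) + alpha (b : ZMod n) := by
      rw [alpha]; push_cast; abel
    rw [e]
    refine AddSubmonoid.add_mem _ (ih (by omega)) (AddSubmonoid.subset_closure ⟨_, ?_, rfl⟩)
    intro h0
    rw [ZMod.natCast_eq_zero_iff] at h0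
    have := Nat.le_of_dvd (by omega) h0
    omega

theorem wt_eq_sum [NeZero n] (k : ℤ) (g : ZMod n → ℤ) :
    ((k, g) : Wt n) = k • LambdaR + ∑ a, g a • delta a := by
  refine Prod.ext (by simp [LambdaR, delta, Prod.fst_sum]) (funext fun i => ?_)
  simp [LambdaR, delta, Prod.snd_sum, Finset.sum_apply, Pi.single_apply]

/-- The bound `-2 Λ_r + (l + m) δ_{r+1}` is obtained by replacing every `δ_a` with `δ_{r+1}`, which
preserves the charge. Each replacement costs a sum of simple roots: `δ_a - δ_{r+1}` for a low site
and `δ_{r+1} - δ_a` for a high one, with multiplicity the occupation number. -/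
theorem exists_dominating_weight (hn : Admissible n r) (l m : ℤ) :
    ∃ γ : Wt n, ∀ x y, charge r x = l → charge r y = m →
      γ - pairWt r x y ∈ AddSubmonoid.closure {a : Wt n | ∃ i : ZMod n, i ≠ 0 ∧ a = alpha i} := by
  have := hn.neZero
  have h2 := hn.add_two_le
  set C := AddSubmonoid.closure {a : Wt n | ∃ i : ZMod n, i ≠ 0 ∧ a = alpha i} with hC
  have hstep : ∀ a : ZMod n, (if IsLow r a then delta a - delta ((r + 1 : ℕ) : ZMod n)
      else delta ((r + 1 : ℕ) : ZMod n) - delta a : Wt n) ∈ C := by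
    intro a
    have hlt := ZMod.val_lt a
    split_ifs with ha
    · have h1 := ha.2
      have h3 : a.val ≠ 0 := fun h => ha.1 ((ZMod.val_eq_zero a).mp h)
      have := delta_sub_delta_mem (n := n) (a := a.val) (b := r + 1) (by omega) (by omega)
        (by omega)
      rwa [ZMod.natCast_zmod_val] at this
    · by_cases h0 : a = 0
      · have := delta_sub_delta_mem (n := n) (a := r + 1) (b := n) (by omega) (by omega) le_rfl
        rw [ZMod.natCast_self] at this
        rwa [h0]
      · have h1 : ¬ a.val ≤ r := fun h => ha ⟨h0, h⟩
        have := delta_sub_delta_mem (n := n) (a := r + 1) (b := a.val) (by omega) (by omega) hlt.le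
        rwa [ZMod.natCast_zmod_val] at this
  refine ⟨(-2 : ℤ) • LambdaR + (l + m) • delta ((r + 1 : ℕ) : ZMod n), fun x y hx hy => ?_⟩
  have e : (-2 : ℤ) • LambdaR + (l + m) • delta ((r + 1 : ℕ) : ZMod n) - pairWt r x y
      = ∑ a, (x + y) a • (if IsLow r a then delta a - delta ((r + 1 : ℕ) : ZMod n)
        else delta ((r + 1 : ℕ) : ZMod n) - delta a : Wt n) := by
    rw [← hx, ← hy, ← charge_add, charge_eq_univ_sum hn, pairWt_eq, Finset.sum_smul]
    have e2 : ((-2, fun i => if IsLow r i then -((x + y) i : ℤ) else (x + y) i) : Wt n)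
        = (-2 : ℤ) • LambdaR
          + ∑ a, (if IsLow r a then -((x + y) a : ℤ) else (x + y) a) • delta a :=
      wt_eq_sum _ _
    rw [e2, add_sub_add_left_eq_sub, ← Finset.sum_sub_distrib]
    refine Finset.sum_congr rfl fun a _ => ?_
    split_ifs
    · rw [neg_smul, neg_smul, natCast_zsmul, natCast_zsmul, smul_sub]; abel
    · rw [natCast_zsmul, natCast_zsmul, smul_sub]
  rw [e]
  exact AddSubmonoid.sum_mem _ fun a _ => AddSubmonoid.nsmul_mem _ (hstep a) _

theorem goodWeights_weightSpace (hn : Admissible n r) (l m : ℤ) :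
    GoodWeights {a | ∃ i : ZMod n, i ≠ 0 ∧ a = alpha i} (weightSpace (fundPairRep hn l m)) := by
  have := hn.neZero
  exact goodWeights (fun μ v => mem_weightSpace_iff hn)
    (fun x y x' y' h => toFin_pairWt_inj (congrArg (toFin n r) h))
    (exists_dominating_weight hn l m)

theorem goodWeights_finWeightSpace (hn : Admissible n r) (l m : ℤ) :
    GoodWeights {a | ∃ i : ZMod n, i ≠ 0 ∧ a = toFin n r (alpha i)}
      (finWeightSpace ((fundPairRep hn l m).comp (UqGl n r).val)) := by
  have := hn.neZero
  refine goodWeights (π := fun x y => toFin n r (pairWt r x y))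
    (fun μ v => mem_finWeightSpace_iff hn) (fun x y x' y' h => toFin_pairWt_inj h) ?_
  obtain ⟨γ, hγ⟩ := exists_dominating_weight hn l m
  refine ⟨toFin n r γ, fun x y hx hy => ?_⟩
  rw [← map_sub]
  have h := AddSubmonoid.mem_map_of_mem (toFin n r).toAddMonoidHom (hγ x y hx hy)
  rw [AddMonoidHom.map_mclosure] at h
  refine AddSubmonoid.closure_mono ?_ h
  rintro _ ⟨_, ⟨i, hi, rfl⟩, rfl⟩
  exact ⟨i, hi, rfl⟩

theorem height_nonpos_of_weight [NeZero n] (hn : Admissible n r) (μ : Wt n) :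
    ∀ v ∈ weightSpace (fundPairRep hn l m) μ, v ≠ 0 → height r μ ≤ 0 := by
  intro v hv h0
  obtain ⟨x, y, hc⟩ := exists_coef_ne_zero h0
  rw [← (mem_weightSpace_iff hn).mp hv x y hc]
  exact height_nonpos hn x y

/-- The contravariant form on `𝓦_l ⊗ 𝓦_m`. -/
def fundForm [NeZero n] (l m : ℤ) : LinearMap.BilinForm GF (Fund n r l ⊗[GF] Fund n r m) :=
  (pairForm n).compl₁₂ (incl n r l m) (incl n r l m)

theorem fundForm_apply [NeZero n] (v w : Fund n r l ⊗[GF] Fund n r m) :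
    fundForm l m v w = pairForm n (incl n r l m v) (incl n r l m w) := rfl

theorem fundForm_anisotropic [NeZero n] {v : Fund n r l ⊗[GF] Fund n r m} (hv : v ≠ 0) :
    fundForm l m v v ≠ 0 := by
  intro h
  have := phi_pairForm_pos (z := incl n r l m v) fun h0 =>
    hv (incl_injective l m (by simpa using h0))
  rw [← fundForm_apply, h, map_zero] at this
  exact this.false

theorem fundForm_contravariant [NeZero n] (hn : Admissible n r) (l m : ℤ) :
    ∃ θ : ZMod n → GF, (∀ i, θ i ≠ 0) ∧ Contravariant (fundPairRep hn l m) (fundForm l m) θ := by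
  obtain ⟨θ, h1, h2⟩ := oscForm_contravariant hn
  exact ⟨θ, h1, (h2.tensor hn h2).pullback _ (incl_rep hn l m)⟩

end fundTensor

/-! ## Elements that act as a lowering operator on one tensor factor -/

theorem Admissible.natCast_ne (hn : Admissible n r) {a b : ℕ} (ha : 1 ≤ a) (hab : a < b)
    (hb : b ≤ n) : (a : ZMod n) ≠ (b : ZMod n) := by
  have := hn.neZero
  intro h
  have h1 := congrArg ZMod.val h
  rw [ZMod.val_natCast_of_lt (by omega)] at h1
  rcases hb.eq_or_lt with rfl | hb
  · rw [ZMod.natCast_self, ZMod.val_zero] at h1; omega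
  · rw [ZMod.val_natCast_of_lt hb] at h1; omega

theorem Admissible.isLow_natCast (hn : Admissible n r) {a : ℕ} (ha : 1 ≤ a) (hb : a ≤ n) :
    IsLow r (a : ZMod n) ↔ a ≤ r := by
  have := hn.neZero
  have h2 := hn.add_two_le
  rcases hb.eq_or_lt with rfl | hb
  · rw [ZMod.natCast_self]
    exact ⟨fun h => absurd h Admissible.not_isLow_zero, fun h => by omega⟩
  · rw [IsLow, Ne, ← ZMod.val_eq_zero, ZMod.val_natCast_of_lt hb]; omega

/-- This includes `i = 0`, where the central term in `α_0^∨` matches the shift in `finVee`. The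
simple coroots thus add up to zero around the cycle, and the product of all `e_j` with `j ≠ i`
carries the same Cartan factor as `f_i`. -/
theorem alphaVee_eq_finVee_sub (hn : Admissible n r) (i : ZMod n) :
    alphaVee r i = finVee r i - finVee r (i + 1) := by
  by_cases hi : i = 0
  · subst hi
    have h1 := hn.isLow_one
    have h2 : ¬ IsLow r (0 : ZMod n) := Admissible.not_isLow_zero
    simp only [alphaVee, finVee, zero_add, if_pos h1, if_neg h2, if_neg hn.r_ne_zero.symm, if_true]
    simp; abel
  · rw [(finVee_eq hn i hi).2]; abel

/-- There is an element of the quantum affine algebra that acts on `|x⟩ ⊗ |y⟩` like a primitive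
element acting by `up a * down b`. -/
def Realizes (hn : Admissible n r) (x y : ZMod n → ℕ) (a b : ZMod n) : Prop :=
  ∃ u : Uq n r, pairRep hn u (ket x ⊗ₜ ket y) = ket x ⊗ₜ up r a (down r b (ket y))
    + up r a (down r b (ket x)) ⊗ₜ oscK r (finVee r b - finVee r a) (ket y)

section realizes

variable {hn : Admissible n r} {x y : ZMod n → ℕ}

theorem realizes_E (hn : Admissible n r) (x y : ZMod n → ℕ) (i : ZMod n) :
    Realizes hn x y i (i + 1) := by
  refine ⟨(scalE r 1 i)⁻¹ • Uq.E r i, ?_⟩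
  rw [map_smul, LinearMap.smul_apply, pairRep_E, smul_smul, inv_mul_cancel₀ (scalE_ne_zero 1 i),
    one_smul, TensorProduct.map_tmul, TensorProduct.map_tmul, alphaVee_eq_finVee_sub hn, neg_sub]
  rfl

/-- Applying `e_j` to the two-term expression gives four terms. The two in which `e_j` meets an
unchanged factor vanish by `hx` and `hy`, so the shape of the coproduct persists and no commutators
are needed. -/
theorem Realizes.step {a b a' b' j : ZMod n} (h : Realizes hn x y a b)
    (hx : up r j (down r (j + 1) (ket x)) = 0) (hy : up r j (down r (j + 1) (ket y)) = 0)
    (hx' : up r j (down r (j + 1) (up r a (down r b (ket x)))) = up r a' (down r b' (ket x)))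
    (hy' : up r j (down r (j + 1) (up r a (down r b (ket y)))) = up r a' (down r b' (ket y)))
    (hh : finVee r b' - finVee r a' = -alphaVee r j + (finVee r b - finVee r a)) :
    Realizes hn x y a' b' := by
  obtain ⟨u, hu⟩ := h
  refine ⟨(scalE r 1 j)⁻¹ • Uq.E r j * u, ?_⟩
  have hy0 : up r j (down r (j + 1) (oscK r (finVee r b - finVee r a) (ket y))) = 0 := by
    rw [oscK_ket, map_smul, map_smul, hy, smul_zero]
  rw [map_mul, Module.End.mul_apply, hu, map_smul, LinearMap.smul_apply, pairRep_E, smul_smul,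
    inv_mul_cancel₀ (scalE_ne_zero 1 j), one_smul, hh, oscK_add]
  simp only [map_add, TensorProduct.map_tmul, Module.End.mul_apply, Module.End.one_apply, hx, hx',
    hy', hy0, TensorProduct.zero_tmul, TensorProduct.tmul_zero, add_zero, zero_add]

theorem up_down_ket_of_low {j : ZMod n} (hj : IsLow r j) (h0 : x j = 0) :
    up r j (down r j (ket x)) = ket x := by
  rw [up_down_ket, if_pos hj, h0, qInt_one, one_smul]

theorem down_up_ket_of_high {j : ZMod n} (hj : ¬ IsLow r j) (h0 : x j = 0) :
    down r j (up r j (ket x)) = ket x := by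
  rw [down_up_ket, if_neg hj, h0, qInt_one, one_smul]

theorem up_ket_of_low {j : ZMod n} (hj : IsLow r j) (h0 : x j = 0) : up r j (ket x) = 0 := by
  rw [up, if_pos hj, lower_ket, h0, qInt_zero, zero_smul]

theorem down_ket_of_high {j : ZMod n} (hj : ¬ IsLow r j) (h0 : x j = 0) :
    down r j (ket x) = 0 := by
  rw [down, if_neg hj, lower_ket, h0, qInt_zero, zero_smul]

theorem up_down_comm {a b : ZMod n} (h : a ≠ b) (u : OscSpace n) :
    up r a (down r b u) = down r b (up r a u) :=
  LinearMap.congr_fun (up_down (r := r) h).eq u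

theorem up_up_comm (a b : ZMod n) (u : OscSpace n) :
    up r a (up r b u) = up r b (up r a u) :=
  LinearMap.congr_fun (up_up (r := r) a b).eq u

theorem down_down_comm (a b : ZMod n) (u : OscSpace n) :
    down r a (down r b u) = down r b (down r a u) :=
  LinearMap.congr_fun (down_down (r := r) a b).eq u

/-- The previous operator puts a particle at the empty site `j` and `e_j` passes it on to `j + 1`;
the coefficient is `[1] = 1`. On `|x⟩` and `|y⟩` themselves there is nothing to remove at `j`, so
`e_j` vanishes. -/
theorem Realizes.step_low {a j : ZMod n} (h : Realizes hn x y a j) (hj : IsLow r j)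
    (ha : a ≠ j + 1) (hx : x j = 0) (hy : y j = 0) : Realizes hn x y a (j + 1) := by
  have h1 := (hn.add_one_ne j).symm
  have e : ∀ z : ZMod n → ℕ, z j = 0 →
      up r j (down r (j + 1) (up r a (down r j (ket z)))) = up r a (down r (j + 1) (ket z)) := by
    intro z hz
    rw [← up_down_comm ha, up_up_comm, up_down_comm h1, up_down_ket_of_low hj hz]
  refine h.step ?_ ?_ (e x hx) (e y hy) (by rw [alphaVee_eq_finVee_sub hn]; abel)
  · rw [up_down_comm h1, up_ket_of_low hj hx, map_zero]
  · rw [up_down_comm h1, up_ket_of_low hj hy, map_zero]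

/-- The mirror image of `Realizes.step_low`: the particle created at the empty high site `j + 1` is
handed down to `j`. -/
theorem Realizes.step_high {b j : ZMod n} (h : Realizes hn x y (j + 1) b)
    (hj : ¬ IsLow r (j + 1)) (hb : b ≠ j + 1) (hx : x (j + 1) = 0) (hy : y (j + 1) = 0) :
    Realizes hn x y j b := by
  have e : ∀ z : ZMod n → ℕ, z (j + 1) = 0 →
      up r j (down r (j + 1) (up r (j + 1) (down r b (ket z)))) = up r j (down r b (ket z)) := by
    intro z hz
    rw [up_down_comm hb.symm, down_down_comm, down_up_ket_of_high hj hz]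
  refine h.step ?_ ?_ (e x hx) (e y hy) (by rw [alphaVee_eq_finVee_sub hn]; abel)
  · rw [down_ket_of_high hj hx, map_zero]
  · rw [down_ket_of_high hj hy, map_zero]

/-- The lowering operator at a node `i` next to `r` is realized by the product of all `e_j` with
`j ≠ i`, if `x` and `y` are supported on the nodes `i` and `i + 1`. -/
theorem realizes_lowering (hn : Admissible n r) {i : ℕ} (h1 : r ≤ i + 1) (h2 : i ≤ r + 1)
    (hx : ∀ a, a ≠ (i : ZMod n) → a ≠ (i : ZMod n) + 1 → x a = 0)
    (hy : ∀ a, a ≠ (i : ZMod n) → a ≠ (i : ZMod n) + 1 → y a = 0) :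
    Realizes hn x y ((i : ZMod n) + 1) (i : ZMod n) := by
  have hr := hn.two_le
  have hrn := hn.add_two_le
  have hcast : (i : ZMod n) + 1 = ((i + 1 : ℕ) : ZMod n) := by push_cast; rfl
  -- Starting with `e_0`, apply `e_1, …, e_{i-1}`. The intermediate sites are low because `i ≤ r +
  -- 1`.
  have low : ∀ k : ℕ, 1 ≤ k → k ≤ i → Realizes hn x y 0 (k : ZMod n) := by
    intro k hk
    induction k, hk using Nat.le_induction with
    | base =>
      intro _
      have := realizes_E hn x y 0
      rwa [zero_add, ← Nat.cast_one] at this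
    | succ k hk ih =>
      intro hki
      have n1 : (k : ZMod n) ≠ (i : ZMod n) := hn.natCast_ne hk (by omega) (by omega)
      have n2 : (k : ZMod n) ≠ (i : ZMod n) + 1 := by
        rw [hcast]; exact hn.natCast_ne hk (by omega) (by omega)
      have n3 : (0 : ZMod n) ≠ (k : ZMod n) + 1 := by
        have := hn.natCast_ne (a := k + 1) (b := n) (by omega) (by omega) le_rfl
        rw [ZMod.natCast_self] at this
        push_cast at this
        exact this.symm
      have := (ih (by omega)).step_low ((hn.isLow_natCast hk (by omega)).mpr (by omega)) n3
        (hx _ n1 n2) (hy _ n1 n2)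
      push_cast
      exact this
  -- Continue from site `n`, which is `0` modulo `n`, with `e_{n-1}, …, e_{i+1}`. The sites passed
  -- are at least `i + 2`, and they are high because `r ≤ i + 1`.
  have high : ∀ d : ℕ, d + i + 1 ≤ n → Realizes hn x y ((n - d : ℕ) : ZMod n) (i : ZMod n) := by
    intro d
    induction d with
    | zero =>
      intro _
      rw [Nat.sub_zero, ZMod.natCast_self]
      exact low i (by omega) le_rfl
    | succ d ih =>
      intro hd
      have e : ((n - (d + 1) : ℕ) : ZMod n) + 1 = ((n - d : ℕ) : ZMod n) := by
        rw [← Nat.cast_add_one]; congr 1; omega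
      have n1 : ((n - d : ℕ) : ZMod n) ≠ (i : ZMod n) :=
        (hn.natCast_ne (by omega) (by omega) (by omega)).symm
      have n2 : ((n - d : ℕ) : ZMod n) ≠ (i : ZMod n) + 1 := by
        rw [hcast]; exact (hn.natCast_ne (by omega) (by omega) (by omega)).symm
      refine Realizes.step_high (by rw [e]; exact ih (by omega)) ?_ ?_ ?_ ?_
      · rw [e, hn.isLow_natCast (by omega) (by omega)]; omega
      · rw [e]; exact n1.symm
      · rw [e]; exact hx _ n1 n2
      · rw [e]; exact hy _ n1 n2
  have := high (n - (i + 1)) (by omega)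
  rw [Nat.sub_sub_self (by omega)] at this
  rwa [hcast]

theorem pairRep_F_ket (hn : Admissible n r) (i : ZMod n) (x y : ZMod n → ℕ) :
    pairRep hn (Uq.F r i) (ket x ⊗ₜ ket y) = scalF 1 i •
      (down r i (up r (i + 1) (ket x)) ⊗ₜ ket y
        + oscK r (alphaVee r i) (ket x) ⊗ₜ down r i (up r (i + 1) (ket y))) := by
  rw [pairRep, tensorRep_F, oscRep_F, oscRep_K]
  simp [TensorProduct.smul_tmul']

/-- The lowering operator can be applied to each of the two tensor factors alone. -/
theorem exists_lowering (hn : Admissible n r) {i : ℕ} (h1 : r ≤ i + 1) (h2 : i ≤ r + 1)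
    (hx : ∀ a, a ≠ (i : ZMod n) → a ≠ (i : ZMod n) + 1 → x a = 0)
    (hy : ∀ a, a ≠ (i : ZMod n) → a ≠ (i : ZMod n) + 1 → y a = 0)
    (hne : alphaVee r (i : ZMod n) (pairWt r x y) ≠ 0) :
    (∃ u, pairRep hn u (ket x ⊗ₜ ket y)
      = down r (i : ZMod n) (up r ((i : ZMod n) + 1) (ket x)) ⊗ₜ ket y) ∧
    ∃ u, pairRep hn u (ket x ⊗ₜ ket y)
      = ket x ⊗ₜ down r (i : ZMod n) (up r ((i : ZMod n) + 1) (ket y)) := by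
  obtain ⟨u, hu⟩ := realizes_lowering hn h1 h2 hx hy
  have hs := scalF_ne_zero 1 (i : ZMod n)
  have hF : pairRep hn ((scalF 1 (i : ZMod n))⁻¹ • Uq.F r (i : ZMod n)) (ket x ⊗ₜ ket y)
      = down r (i : ZMod n) (up r ((i : ZMod n) + 1) (ket x)) ⊗ₜ ket y
        + q ^ (alphaVee r (i : ZMod n) (ketWt r x)) •
          ket x ⊗ₜ down r (i : ZMod n) (up r ((i : ZMod n) + 1) (ket y)) := by
    rw [map_smul, LinearMap.smul_apply, pairRep_F_ket, smul_smul, inv_mul_cancel₀ hs, one_smul,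
      oscK_ket, TensorProduct.smul_tmul']
  rw [← alphaVee_eq_finVee_sub hn, up_down_comm (hn.add_one_ne _), up_down_comm (hn.add_one_ne _),
    oscK_ket, TensorProduct.tmul_smul] at hu
  set X := down r (i : ZMod n) (up r ((i : ZMod n) + 1) (ket x))
  set Y := down r (i : ZMod n) (up r ((i : ZMod n) + 1) (ket y))
  set α := q ^ (alphaVee r (i : ZMod n) (ketWt r x)) with hα
  set β := q ^ (alphaVee r (i : ZMod n) (ketWt r y)) with hβ
  set f := (scalF 1 (i : ZMod n))⁻¹ • Uq.F r (i : ZMod n)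
  -- The two elements produce `X ⊗ y + α x ⊗ Y` and `β X ⊗ y + x ⊗ Y`. This is the determinant of
  -- the system, and `α β` is `q` to the power of the pairing that `hne` assumes to be non-zero.
  have hdet : 1 - α * β ≠ 0 := by
    rw [hα, hβ, ← zpow_add₀ q_ne_zero, ← map_add]
    exact sub_ne_zero.mpr fun h => hne (q_zpow_eq_one_iff.mp h.symm)
  refine ⟨⟨(1 - α * β)⁻¹ • (f - α • u), ?_⟩, ⟨(1 - α * β)⁻¹ • (u - β • f), ?_⟩⟩
  · simp only [map_smul, map_sub, LinearMap.smul_apply, LinearMap.sub_apply, hu, hF]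
    rw [inv_smul_eq_iff₀ hdet]
    module
  · simp only [map_smul, map_sub, LinearMap.smul_apply, LinearMap.sub_apply, hu, hF]
    rw [inv_smul_eq_iff₀ hdet]
    module

end realizes

/-- `|x⟩` is a non-zero multiple of the image of `|x₀⟩` under the lowering operator at `i`. -/
structure LowersTo (r : ℕ) (i : ZMod n) (x₀ x : ZMod n → ℕ) : Prop where
  wt : ketWt r x₀ = ketWt r x + alpha i
  charge : charge r x₀ = charge r x
  ket : ∃ c : GF, c ≠ 0 ∧ down r i (up r (i + 1) (ket x₀)) = c • ket x

theorem lowersTo_high (hn : Admissible n r) {i : ZMod n} (h1 : ¬ IsLow r i)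
    (h2 : ¬ IsLow r (i + 1)) (z : ZMod n → ℕ) : LowersTo r i (z + eps i) (z + eps (i + 1)) where
  wt := by rw [ketWt_add_eps, ketWt_add_eps, if_neg h1, if_neg h2, alpha]; abel
  charge := by rw [charge_add_eps hn, charge_add_eps hn, if_neg h1, if_neg h2]
  ket := by
    refine ⟨_, qInt_succ_ne_zero (z i), ?_⟩
    rw [up, if_neg h2, down, if_neg h1, raise_ket, lower_ket, add_right_comm,
      add_tsub_cancel_right]
    simp [eps_self, eps_ne (hn.add_one_ne i)]

theorem lowersTo_low (hn : Admissible n r) {i : ZMod n} (h1 : IsLow r i)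
    (h2 : IsLow r (i + 1)) (z : ZMod n → ℕ) : LowersTo r i (z + eps (i + 1)) (z + eps i) where
  wt := by rw [ketWt_add_eps, ketWt_add_eps, if_pos h1, if_pos h2, alpha]; abel
  charge := by rw [charge_add_eps hn, charge_add_eps hn, if_pos h1, if_pos h2]
  ket := by
    refine ⟨_, qInt_succ_ne_zero (z (i + 1)), ?_⟩
    rw [up, if_pos h2, down, if_pos h1, lower_ket, map_smul, raise_ket, add_tsub_cancel_right]
    simp [eps_self]

theorem lowersTo_r (hn : Admissible n r) (z : ZMod n → ℕ) :
    LowersTo r (r : ZMod n) z (z + eps (r : ZMod n) + eps ((r : ZMod n) + 1)) where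
  wt := by
    rw [ketWt_add_eps, ketWt_add_eps, if_pos hn.isLow_r, if_neg hn.not_isLow_r_add_one, alpha]; abel
  charge := by
    rw [charge_add_eps hn, charge_add_eps hn, if_pos hn.isLow_r, if_neg hn.not_isLow_r_add_one]
    ring
  ket := by
    refine ⟨1, one_ne_zero, ?_⟩
    rw [up, if_neg hn.not_isLow_r_add_one, down, if_pos hn.isLow_r, raise_ket, raise_ket, one_smul,
      add_right_comm]

/-! ## Irreducibility -/

/-- Elements of `N` are sums of weight components in `N`; the one of weight `μ` is zero by
assumption, and the others are orthogonal to `w`. -/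
theorem mem_perp_of_weight {V : Type*} [AddCommGroup V] [Module GF V]
    {ρ : Uq n r →ₐ[GF] Module.End GF V} {B : LinearMap.BilinForm GF V}
    (hsup : ⨆ μ, weightSpace ρ μ = ⊤)
    (hK : ∀ h u v, B (ρ (Uq.K r h) u) v = B u (ρ (Uq.K r h) v))
    {hadj : ∀ a, ∃ a', ∀ u v, B (ρ a u) v = B u (ρ a' v)}
    {N : Submodule (Uq n r) (RepMod ρ)} {μ : Wt n} {w : V} (hw : w ∈ weightSpace ρ μ)
    (h : ∀ z ∈ RepMod.toSubspace N, z ∈ weightSpace ρ μ → z = 0) :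
    w ∈ RepMod.toSubspace (perp B hadj N) := by
  intro z hz
  obtain ⟨f, hf, rfl⟩ := exists_components hsup (fun h v hv => RepMod.rep_mem N (Uq.K r h) hv) hz
  rw [Finsupp.sum, map_sum]
  refine Finset.sum_eq_zero fun ν _ => ?_
  by_cases hν : μ = ν
  · subst hν
    rw [h _ (hf μ).2 (hf μ).1, map_zero]
  · exact weightSpace_orthogonal hK hν hw (hf ν).1

theorem exists_eq_add_eps {x : ZMod n → ℕ} {a : ZMod n} (h : x a ≠ 0) : ∃ z, x = z + eps a :=
  ⟨x - eps a, (sub_add_eps h).symm⟩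

/-- The vectors of `𝓦_l ⊗ 𝓦_m` that generate a highest weight module over `U_q(gl_n)` have the
shape described by `HWShape`. -/
theorem exists_hwShape (hn : Admissible n r) {l m : ℤ} {μ : Wt n} {v : Fund n r l ⊗[GF] Fund n r m}
    (hv : v ∈ weightSpace (fundPairRep hn l m) μ) (h0 : v ≠ 0)
    (hE : ∀ i, i ≠ 0 → fundPairRep hn l m (Uq.E r i) v = 0) :
    ∃ t, μ = (-2, fun i => if IsLow r i then -(t i : ℤ) else t i) ∧
      HWShape r (fun x y => coef x y (incl n r l m v) ≠ 0) l m t := by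
  obtain ⟨x, y, hc⟩ := exists_coef_ne_zero h0
  refine ⟨x + y, ?_, hwShape hn (fun x' y' hc' => ⟨?_, charge_of_coef_ne_zero hc'⟩) fun i hi => ?_⟩
  · rw [← (mem_weightSpace_iff hn).mp hv x y hc, pairWt_eq]
  · refine toFin_pairWt_inj (r := r) ?_
    rw [(mem_weightSpace_iff hn).mp hv x y hc, (mem_weightSpace_iff hn).mp hv x' y' hc']
  · rw [← incl_rep, hE i hi, map_zero]

theorem alphaVee_pairWt_of_high (hn : Admissible n r) {i : ZMod n} (h1 : ¬ IsLow r i)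
    (h2 : ¬ IsLow r (i + 1)) (x y : ZMod n → ℕ) :
    alphaVee r i (pairWt r x y) = ((x + y) i : ℤ) - (x + y) (i + 1) := by
  rw [pairWt, map_add, alphaVee_ketWt hn, alphaVee_ketWt hn, if_neg h1, if_neg h1, if_neg h2,
    if_neg h2, Pi.add_apply, Pi.add_apply]
  push_cast; ring

theorem alphaVee_pairWt_of_low (hn : Admissible n r) {i : ZMod n} (h1 : IsLow r i)
    (h2 : IsLow r (i + 1)) (x y : ZMod n → ℕ) :
    alphaVee r i (pairWt r x y) = ((x + y) (i + 1) : ℤ) - (x + y) i := by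
  rw [pairWt, map_add, alphaVee_ketWt hn, alphaVee_ketWt hn, if_pos h1, if_pos h1, if_pos h2,
    if_pos h2, Pi.add_apply, Pi.add_apply]
  push_cast; ring

theorem alphaVee_pairWt_r (hn : Admissible n r) (x y : ZMod n → ℕ) :
    alphaVee r (r : ZMod n) (pairWt r x y) =
      -(((x + y) (r : ZMod n) : ℤ) + (x + y) ((r : ZMod n) + 1) + 2) := by
  rw [pairWt, map_add, alphaVee_ketWt hn, alphaVee_ketWt hn, if_pos hn.isLow_r, if_pos hn.isLow_r,
    if_neg hn.not_isLow_r_add_one, if_neg hn.not_isLow_r_add_one, Pi.add_apply, Pi.add_apply]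
  push_cast; ring

/-- A vector of maximal height in a submodule of `𝓦_l ⊗ 𝓦_m`. -/
structure IsMaximal [NeZero n] (hn : Admissible n r) {l m : ℤ}
    (N : Submodule (Uq n r) (RepMod (fundPairRep hn l m))) (μ : Wt n)
    (v : Fund n r l ⊗[GF] Fund n r m) : Prop where
  mem : v ∈ RepMod.toSubspace N
  weight : v ∈ weightSpace (fundPairRep hn l m) μ
  max : ∀ ν, height r μ < height r ν → ∀ w ∈ RepMod.toSubspace N,
    w ∈ weightSpace (fundPairRep hn l m) ν → w = 0

section irreducible

variable [NeZero n] {hn : Admissible n r} {l m : ℤ}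
  {N : Submodule (Uq n r) (RepMod (fundPairRep hn l m))} {μ : Wt n}
  {v : Fund n r l ⊗[GF] Fund n r m}

/-- The weight `μ + α_i` is higher than the maximal height in `N`, so the basis vector lies in the
orthogonal complement of `N`, which is stable under the whole affine algebra. -/
theorem pairForm_eq_zero_of_ketPair (hv : IsMaximal hn N μ v) {i : ℕ} (h1 : r ≤ i + 1)
    (h2 : i ≤ r + 1) {x₀ y₀ : ZMod n → ℕ} (hx : charge r x₀ = l) (hy : charge r y₀ = m)
    (hμ : pairWt r x₀ y₀ = μ + alpha (i : ZMod n)) (u : Uq n r) :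
    pairForm n (pairRep hn u (ket x₀ ⊗ₜ ket y₀)) (incl n r l m v) = 0 := by
  obtain ⟨θ, hθ, hB⟩ := fundForm_contravariant hn l m
  have hr := hn.two_le
  have hrn := hn.add_two_le
  have hi : (i : ZMod n) ≠ 0 := by
    rw [← ZMod.natCast_self n]
    exact hn.natCast_ne (by omega) (by omega) le_rfl
  have hw : ketPair hx hy ∈ RepMod.toSubspace (perp (fundForm l m) (hB.exists_adjoint hθ) N) := by
    refine mem_perp_of_weight (goodWeights_weightSpace hn l m).2.1 hB.K
      (μ := μ + alpha (i : ZMod n)) ?_ (hv.max _ ?_)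
    · rw [mem_weightSpace_iff]
      exact ketPair_mem_supportedOn hx hy hμ
    · rw [height_add, height_alpha hn hi]; omega
  have := (RepMod.rep_mem (perp (fundForm l m) (hB.exists_adjoint hθ) N) u hw :) v hv.mem
  rwa [fundForm_apply, incl_rep, incl_ketPair] at this

theorem oscNorm_mul_ne_zero (x y : ZMod n → ℕ) : oscNorm x * oscNorm y ≠ 0 := fun h => by
  have h1 := mul_pos (phi_oscNorm_pos x) (phi_oscNorm_pos y)
  rw [← map_mul, h, map_zero] at h1
  exact h1.false

/-- Up to a non-zero scalar, `|x⟩ ⊗ |y⟩` is generated by the higher vector `|x₀⟩ ⊗ |y⟩` through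
`exists_lowering`, hence it is orthogonal to `v`. Pairing with it extracts the coefficient. -/
theorem coef_eq_zero_of_lowersTo_left (hv : IsMaximal hn N μ v) {i : ℕ} (h1 : r ≤ i + 1)
    (h2 : i ≤ r + 1) {x₀ x y : ZMod n → ℕ} (hL : LowersTo r (i : ZMod n) x₀ x)
    (hx : ∀ a, a ≠ (i : ZMod n) → a ≠ (i : ZMod n) + 1 → x₀ a = 0)
    (hy : ∀ a, a ≠ (i : ZMod n) → a ≠ (i : ZMod n) + 1 → y a = 0)
    (hne : alphaVee r (i : ZMod n) (pairWt r x₀ y) ≠ 0) : coef x y (incl n r l m v) = 0 := by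
  by_contra hc
  obtain ⟨cx, cy⟩ := charge_of_coef_ne_zero hc
  have hμ : pairWt r x₀ y = μ + alpha (i : ZMod n) := by
    rw [← (mem_weightSpace_iff hn).mp hv.weight x y hc, pairWt, pairWt, hL.wt]; abel
  obtain ⟨⟨u, hu⟩, -⟩ := exists_lowering hn h1 h2 hx hy hne
  obtain ⟨c, h0, hk⟩ := hL.ket
  have := pairForm_eq_zero_of_ketPair hv h1 h2 (hL.charge.trans cx) cy hμ u
  rw [hu, hk, ← TensorProduct.smul_tmul', map_smul, LinearMap.smul_apply, pairForm_ket,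
    smul_eq_mul] at this
  exact mul_ne_zero h0 (mul_ne_zero (oscNorm_mul_ne_zero x y) hc) this

theorem coef_eq_zero_of_lowersTo_right (hv : IsMaximal hn N μ v) {i : ℕ} (h1 : r ≤ i + 1)
    (h2 : i ≤ r + 1) {y₀ x y : ZMod n → ℕ} (hL : LowersTo r (i : ZMod n) y₀ y)
    (hx : ∀ a, a ≠ (i : ZMod n) → a ≠ (i : ZMod n) + 1 → x a = 0)
    (hy : ∀ a, a ≠ (i : ZMod n) → a ≠ (i : ZMod n) + 1 → y₀ a = 0)
    (hne : alphaVee r (i : ZMod n) (pairWt r x y₀) ≠ 0) : coef x y (incl n r l m v) = 0 := by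
  by_contra hc
  obtain ⟨cx, cy⟩ := charge_of_coef_ne_zero hc
  have hμ : pairWt r x y₀ = μ + alpha (i : ZMod n) := by
    rw [← (mem_weightSpace_iff hn).mp hv.weight x y hc, pairWt, pairWt, hL.wt]; abel
  obtain ⟨-, ⟨u, hu⟩⟩ := exists_lowering hn h1 h2 hx hy hne
  obtain ⟨c, h0, hk⟩ := hL.ket
  have := pairForm_eq_zero_of_ketPair hv h1 h2 cx (hL.charge.trans cy) hμ u
  rw [hu, hk, TensorProduct.tmul_smul, map_smul, LinearMap.smul_apply, pairForm_ket,
    smul_eq_mul] at this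
  exact mul_ne_zero h0 (mul_ne_zero (oscNorm_mul_ne_zero x y) hc) this

/-! ### The support of a vector of maximal height -/

section support

variable {t : ZMod n → ℕ} {x y : ZMod n → ℕ}

/-- A particle at `r + 2` could have been lowered from `r + 1` within its own tensor factor, and
maximality excludes such coefficients. -/
theorem eq_zero_at_high (hv : IsMaximal hn N μ v)
    (hS : HWShape r (fun x y => coef x y (incl n r l m v) ≠ 0) l m t)
    (h1 : ∀ i, i ≠ (r : ZMod n) + 1 → i ≠ (r : ZMod n) + 1 + 1 → t i = 0)
    (h2 : t ((r : ZMod n) + 1 + 1) ≤ t ((r : ZMod n) + 1))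
    (hc : coef x y (incl n r l m v) ≠ 0) :
    x ((r : ZMod n) + 1 + 1) = 0 ∧ y ((r : ZMod n) + 1 + 1) = 0 := by
  have hne := hn.add_one_ne ((r : ZMod n) + 1)
  have l1 := hn.not_isLow_r_add_one
  have l2 := hn.not_isLow_r_add_two
  have ht := hS.total hc
  have hx : ∀ i, i ≠ (r : ZMod n) + 1 → i ≠ (r : ZMod n) + 1 + 1 → x i = 0 := fun i i1 i2 =>
    hS.left_eq_zero hc (h1 i i1 i2)
  have hy : ∀ i, i ≠ (r : ZMod n) + 1 → i ≠ (r : ZMod n) + 1 + 1 → y i = 0 := fun i i1 i2 =>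
    hS.right_eq_zero hc (h1 i i1 i2)
  have hcast : ((r + 1 : ℕ) : ZMod n) = (r : ZMod n) + 1 := by push_cast; rfl
  subst ht
  constructor
  · by_contra h
    obtain ⟨z, rfl⟩ := exists_eq_add_eps h
    refine hc (coef_eq_zero_of_lowersTo_left hv (i := r + 1) (by omega) le_rfl
      (x₀ := z + eps ((r : ZMod n) + 1)) ?_ ?_ ?_ ?_) <;> rw [hcast]
    · exact lowersTo_high hn l1 l2 z
    · intro a a1 a2
      have := hx a a1 a2
      simpa [eps_ne (Ne.symm a1), eps_ne (Ne.symm a2)] using this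
    · exact hy
    -- Raising the particle back changes the difference of the occupation numbers at `r + 1` and `r
    -- + 2` by two. By `h2` that difference was non-negative, so now it is positive.
    · rw [alphaVee_pairWt_of_high hn l1 l2]
      simp only [Pi.add_apply, eps_self, eps_ne hne, eps_ne hne.symm] at h2 ⊢
      omega
  · by_contra h
    obtain ⟨z, rfl⟩ := exists_eq_add_eps h
    refine hc (coef_eq_zero_of_lowersTo_right hv (i := r + 1) (by omega) le_rfl
      (y₀ := z + eps ((r : ZMod n) + 1)) ?_ ?_ ?_ ?_) <;> rw [hcast]
    · exact lowersTo_high hn l1 l2 z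
    · exact hx
    · intro a a1 a2
      have := hy a a1 a2
      simpa [eps_ne (Ne.symm a1), eps_ne (Ne.symm a2)] using this
    · rw [alphaVee_pairWt_of_high hn l1 l2]
      simp only [Pi.add_apply, eps_self, eps_ne hne, eps_ne hne.symm] at h2 ⊢
      omega

theorem eq_zero_at_low (hv : IsMaximal hn N μ v)
    (hS : HWShape r (fun x y => coef x y (incl n r l m v) ≠ 0) l m t)
    (h1 : ∀ i, i ≠ (r : ZMod n) - 1 → i ≠ (r : ZMod n) → t i = 0)
    (h2 : t ((r : ZMod n) - 1) ≤ t (r : ZMod n))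
    (hc : coef x y (incl n r l m v) ≠ 0) :
    x ((r : ZMod n) - 1) = 0 ∧ y ((r : ZMod n) - 1) = 0 := by
  have hr := hn.two_le
  have hne := hn.r_sub_one_ne
  have l1 := hn.isLow_r_sub_one
  have e : (r : ZMod n) - 1 + 1 = r := sub_add_cancel _ _
  have l2 : IsLow r ((r : ZMod n) - 1 + 1) := by rw [e]; exact hn.isLow_r
  have ht := hS.total hc
  have hx : ∀ i, i ≠ (r : ZMod n) - 1 → i ≠ (r : ZMod n) → x i = 0 := fun i i1 i2 =>
    hS.left_eq_zero hc (h1 i i1 i2)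
  have hy : ∀ i, i ≠ (r : ZMod n) - 1 → i ≠ (r : ZMod n) → y i = 0 := fun i i1 i2 =>
    hS.right_eq_zero hc (h1 i i1 i2)
  have hcast : ((r - 1 : ℕ) : ZMod n) = (r : ZMod n) - 1 := by
    rw [Nat.cast_sub (by omega), Nat.cast_one]
  have key := fun z => lowersTo_low hn l1 l2 z
  have wt := fun x y => alphaVee_pairWt_of_low hn l1 l2 x y
  rw [e] at key wt
  subst ht
  constructor
  · by_contra h
    obtain ⟨z, rfl⟩ := exists_eq_add_eps h
    refine hc (coef_eq_zero_of_lowersTo_left hv (i := r - 1) (by omega) (by omega)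
      (x₀ := z + eps (r : ZMod n)) ?_ ?_ ?_ ?_) <;> rw [hcast]
    · exact key z
    · rw [e]
      intro a a1 a2
      have := hx a a1 a2
      simpa [eps_ne (Ne.symm a1), eps_ne (Ne.symm a2)] using this
    · rw [e]; exact hy
    · rw [wt]
      simp only [Pi.add_apply, eps_self, eps_ne hne, eps_ne hne.symm] at h2 ⊢
      omega
  · by_contra h
    obtain ⟨z, rfl⟩ := exists_eq_add_eps h
    refine hc (coef_eq_zero_of_lowersTo_right hv (i := r - 1) (by omega) (by omega)
      (y₀ := z + eps (r : ZMod n)) ?_ ?_ ?_ ?_) <;> rw [hcast]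
    · exact key z
    · rw [e]; exact hx
    · rw [e]
      intro a a1 a2
      have := hy a a1 a2
      simpa [eps_ne (Ne.symm a1), eps_ne (Ne.symm a2)] using this
    · rw [wt]
      simp only [Pi.add_apply, eps_self, eps_ne hne, eps_ne hne.symm] at h2 ⊢
      omega

/-- A factor with particles at both `r` and `r + 1` arises from a higher vector by creating a pair.
At node `r` the pairing is always negative, so `exists_lowering` applies without further conditions.
-/
theorem eq_zero_at_pair (hv : IsMaximal hn N μ v)
    (hS : HWShape r (fun x y => coef x y (incl n r l m v) ≠ 0) l m t)
    (h1 : ∀ i, i ≠ (r : ZMod n) → i ≠ (r : ZMod n) + 1 → t i = 0)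
    (hc : coef x y (incl n r l m v) ≠ 0) :
    (x (r : ZMod n) = 0 ∨ x ((r : ZMod n) + 1) = 0) ∧
      (y (r : ZMod n) = 0 ∨ y ((r : ZMod n) + 1) = 0) := by
  have hne := hn.add_one_ne (r : ZMod n)
  have hx : ∀ i, i ≠ (r : ZMod n) → i ≠ (r : ZMod n) + 1 → x i = 0 := fun i i1 i2 =>
    hS.left_eq_zero hc (h1 i i1 i2)
  have hy : ∀ i, i ≠ (r : ZMod n) → i ≠ (r : ZMod n) + 1 → y i = 0 := fun i i1 i2 =>
    hS.right_eq_zero hc (h1 i i1 i2)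
  have split : ∀ x : ZMod n → ℕ, ¬ (x (r : ZMod n) = 0 ∨ x ((r : ZMod n) + 1) = 0) →
      ∃ z, x = z + eps (r : ZMod n) + eps ((r : ZMod n) + 1) := by
    intro x h
    rw [not_or] at h
    obtain ⟨z, rfl⟩ := exists_eq_add_eps h.2
    obtain ⟨z', rfl⟩ := exists_eq_add_eps (x := z) (a := (r : ZMod n)) (by
      simpa [eps_ne hne] using h.1)
    exact ⟨z', rfl⟩
  constructor
  · by_contra h
    obtain ⟨z, rfl⟩ := split x h
    refine hc (coef_eq_zero_of_lowersTo_left hv (i := r) (by omega) (by omega)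
      (lowersTo_r hn z) ?_ hy ?_)
    · intro a a1 a2
      have := hx a a1 a2
      simpa [eps_ne (Ne.symm a1), eps_ne (Ne.symm a2)] using this
    · rw [alphaVee_pairWt_r hn]; omega
  · by_contra h
    obtain ⟨z, rfl⟩ := split y h
    refine hc (coef_eq_zero_of_lowersTo_right hv (i := r) (by omega) (by omega)
      (lowersTo_r hn z) hx ?_ ?_)
    · intro a a1 a2
      have := hy a a1 a2
      simpa [eps_ne (Ne.symm a1), eps_ne (Ne.symm a2)] using this
    · rw [alphaVee_pairWt_r hn]; omega

/-- Highest weight vectors of maximal height are multiples of `|base l⟩ ⊗ |base m⟩`. -/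
theorem eq_base_of_coef_ne_zero (hv : IsMaximal hn N μ v)
    (hS : HWShape r (fun x y => coef x y (incl n r l m v) ≠ 0) l m t)
    (hc : coef x y (incl n r l m v) ≠ 0) : x = base n r l ∧ y = base n r m := by
  have hne := hn.add_one_ne (r : ZMod n)
  have cx := hS.charge_left hc
  have cy := hS.charge_right hc
  rcases hS.cases hn hc with ⟨h1, h2⟩ | h1 | ⟨h1, h2⟩
  · obtain ⟨zx, zy⟩ := eq_zero_at_high hv hS h1 h2 hc
    have h0 := h1 _ hne.symm (hn.add_two_ne _).symm
    refine ⟨eq_base hn cx (fun i _ i2 => ?_) (Or.inl (hS.left_eq_zero hc h0)),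
      eq_base hn cy (fun i _ i2 => ?_) (Or.inl (hS.right_eq_zero hc h0))⟩
    · by_cases i3 : i = (r : ZMod n) + 1 + 1
      · rw [i3, zx]
      · exact hS.left_eq_zero hc (h1 i i2 i3)
    · by_cases i3 : i = (r : ZMod n) + 1 + 1
      · rw [i3, zy]
      · exact hS.right_eq_zero hc (h1 i i2 i3)
  · obtain ⟨zx, zy⟩ := eq_zero_at_pair hv hS h1 hc
    exact ⟨eq_base hn cx (fun i i1 i2 => hS.left_eq_zero hc (h1 i i1 i2)) zx,
      eq_base hn cy (fun i i1 i2 => hS.right_eq_zero hc (h1 i i1 i2)) zy⟩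
  · obtain ⟨zx, zy⟩ := eq_zero_at_low hv hS h1 h2 hc
    have h0 := h1 ((r : ZMod n) + 1)
      (fun h' => hn.not_isLow_r_add_one (h' ▸ hn.isLow_r_sub_one)) hne
    refine ⟨eq_base hn cx (fun i i1 _ => ?_) (Or.inr (hS.left_eq_zero hc h0)),
      eq_base hn cy (fun i i1 _ => ?_) (Or.inr (hS.right_eq_zero hc h0))⟩
    · by_cases i3 : i = (r : ZMod n) - 1
      · rw [i3, zx]
      · exact hS.left_eq_zero hc (h1 i i3 i1)
    · by_cases i3 : i = (r : ZMod n) - 1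
      · rw [i3, zy]
      · exact hS.right_eq_zero hc (h1 i i3 i1)

end support

/-- A vector of maximal height in `N` is also a highest weight vector for `U_q(gl_n)`, and the
support computation reduces it to a non-zero multiple of this single basis vector. -/
theorem ketPair_base_mem (hN : N ≠ ⊥) :
    ketPair (charge_base hn l) (charge_base hn m) ∈ RepMod.toSubspace N := by
  obtain ⟨w, hw, hw0⟩ := (Submodule.ne_bot_iff N).mp hN
  obtain ⟨μ, v, hvN, h0, hvμ, hE, hmax⟩ := exists_highest_weight_vector hn
    (goodWeights_weightSpace hn l m).2.1 (height_nonpos_of_weight hn) (L := RepMod.toSubspace N)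
    (fun h v hv => RepMod.rep_mem N _ hv) (fun i _ v hv => RepMod.rep_mem N _ hv) ⟨w, hw, hw0⟩
  obtain ⟨t, -, hS⟩ := exists_hwShape hn hvμ h0 hE
  have hb := fun {x y} => eq_base_of_coef_ne_zero (x := x) (y := y) ⟨hvN, hvμ, hmax⟩ hS
  have e : v = coef (base n r l) (base n r m) (incl n r l m v) •
      ketPair (charge_base hn l) (charge_base hn m) := by
    refine eq_of_coef fun x y => ?_
    rw [map_smul, map_smul, incl_ketPair, coef_ket, smul_eq_mul]
    split_ifs with h
    · rw [h.1, h.2, mul_one]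
    · rw [mul_zero]
      by_contra hc
      exact h ⟨(hb hc).1.symm, (hb hc).2.symm⟩
  obtain ⟨x, y, hc⟩ := exists_coef_ne_zero h0
  have hc' := hc
  rw [(hb hc).1, (hb hc).2] at hc'
  rw [e] at hvN
  exact ((RepMod.toSubspace N).smul_mem_iff hc').mp hvN

end irreducible

/-- A proper non-zero submodule has a non-zero orthogonal complement. Both contain the base vector,
which would then be isotropic. -/
theorem isSimpleModule_fundPairRep (hn : Admissible n r) (l m : ℤ) :
    IsSimpleModule (Uq n r) (RepMod (fundPairRep hn l m)) := by
  have := hn.neZero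
  obtain ⟨θ, hθ, hB⟩ := fundForm_contravariant hn l m
  have hG := goodWeights_weightSpace hn l m
  have h0 := ketPair_ne_zero (charge_base hn l) (charge_base hn m)
  have hnt : Nontrivial (RepMod (fundPairRep hn l m)) := ⟨⟨_, _, h0⟩⟩
  rw [isSimpleModule_iff]
  refine { eq_bot_or_eq_top := fun N => ?_ }
  by_contra! hN
  have hC := isCompl_perp hG.2.1 hG.2.2.1 hB.K (fun v => fundForm_anisotropic)
    (hB.exists_adjoint hθ) (fun h => ⟨_, rfl⟩) N
  have hP : perp (fundForm l m) (hB.exists_adjoint hθ) N ≠ ⊥ := by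
    intro h
    rw [h] at hC
    exact hN.2 (by simpa using hC.sup_eq_top)
  have h1 := ketPair_base_mem hN.1
  have h2 := ketPair_base_mem hP
  exact fundForm_anisotropic h0 (h2 _ h1)

/-! ## The restriction to `U_q(gl_n)` -/

theorem oscPart_of_nonneg {a : ℤ} (ha : 0 ≤ a) (u v : Wt n) :
    (if 0 < a then a • u else if a < 0 then a • v else 0) = a • u := by
  rcases ha.eq_or_lt with rfl | h
  · simp
  · rw [if_pos h]

theorem oscPart_of_nonpos {a : ℤ} (ha : a ≤ 0) (u v : Wt n) :
    (if 0 < a then a • u else if a < 0 then a • v else 0) = a • v := by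
  rcases ha.eq_or_lt with rfl | h
  · simp
  · rw [if_neg (by omega), if_pos h]

theorem oscWt_two (a b : ℤ) : oscWt n r ![a, b] = (-2 : ℤ) • LambdaR +
    ((if 0 < a then a • delta ((r : ZMod n) + 1)
      else if a < 0 then a • delta ((r : ZMod n) - 1) else 0) +
    (if 0 < b then b • delta ((r : ZMod n) + 1 + 1)
      else if b < 0 then b • delta (r : ZMod n) else 0)) := by
  have e1 : ((r : ZMod n) - 2 + 1) = (r : ZMod n) - 1 := by ring
  have e2 : ((r : ZMod n) + (1 + 1)) = (r : ZMod n) + 1 + 1 := by ring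
  have e3 : ((r : ZMod n) - 2 + (1 + 1)) = (r : ZMod n) := by ring
  simp [oscWt, Fin.sum_univ_two, e1, e2, e3]

/-- The bounds on the numbers of negative and positive parts hold automatically, since two parts are
at most `r` and at most `n - r`. -/
theorem isOscPartition_two (hn : Admissible n r) {a b : ℤ} (h : b ≤ a) :
    IsOscPartition n r ![a, b] := by
  have h1 := hn.two_le
  have h2 := hn.add_two_le
  refine ⟨?_, (Finset.card_le_univ _).trans (by simpa using h1),
    (Finset.card_le_univ _).trans (by rw [Fintype.card_fin]; omega)⟩
  intro i j hij
  fin_cases i <;> fin_cases j <;> simp_all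

/-- The weights of highest weight vectors of `𝓦_l ⊗ 𝓦_m` correspond to generalized partitions of
length two. -/
theorem HWShape.exists_oscWt [NeZero n] (hn : Admissible n r)
    {N : (ZMod n → ℕ) → (ZMod n → ℕ) → Prop} {l m : ℤ} {t : ZMod n → ℕ} (h : HWShape r N l m t)
    {x y : ZMod n → ℕ} (hN : N x y) :
    ∃ lam : Fin 2 → ℤ, IsOscPartition n r lam ∧
      oscWt n r lam = (-2, fun i => if IsLow r i then -(t i : ℤ) else t i) := by
  have key : ∀ a b : ZMod n, a ≠ b → (∀ i, i ≠ a → i ≠ b → t i = 0) →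
      ((-2, fun i => if IsLow r i then -(t i : ℤ) else t i) : Wt n) = (-2 : ℤ) • LambdaR +
        ((if IsLow r a then -(t a : ℤ) else t a) • delta a
          + (if IsLow r b then -(t b : ℤ) else t b) • delta b) := by
    intro a b hab h0
    rw [wt_eq_sum, Fintype.sum_eq_add a b hab]
    rintro i ⟨i1, i2⟩
    simp [h0 i i1 i2]
  rcases h.cases hn hN with ⟨h1, h2⟩ | h1 | ⟨h1, h2⟩
  · refine ⟨_, isOscPartition_two hn (Int.ofNat_le.mpr h2), ?_⟩
    rw [oscWt_two, key _ _ (hn.add_one_ne _).symm h1, if_neg hn.not_isLow_r_add_one,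
      if_neg hn.not_isLow_r_add_two, oscPart_of_nonneg (Int.natCast_nonneg _),
      oscPart_of_nonneg (Int.natCast_nonneg _)]
  · refine ⟨![(t ((r : ZMod n) + 1) : ℤ), -(t (r : ZMod n) : ℤ)],
      isOscPartition_two hn (by omega), ?_⟩
    rw [oscWt_two, key _ _ (hn.add_one_ne _) (fun i i1 i2 => h1 i i2 i1),
      if_neg hn.not_isLow_r_add_one, if_pos hn.isLow_r, oscPart_of_nonneg (Int.natCast_nonneg _),
      oscPart_of_nonpos (by omega)]
  · refine ⟨![-(t ((r : ZMod n) - 1) : ℤ), -(t (r : ZMod n) : ℤ)],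
      isOscPartition_two hn (by omega), ?_⟩
    rw [oscWt_two, key _ _ hn.r_sub_one_ne h1, if_pos hn.isLow_r_sub_one, if_pos hn.isLow_r,
      oscPart_of_nonpos (by omega), oscPart_of_nonpos (by omega)]

section gl

variable {l m : ℤ}

/-- The representation of `U_q(gl_n)` on `𝓦_l ⊗ 𝓦_m`. -/
abbrev fundPairRepGl (hn : Admissible n r) (l m : ℤ) :
    UqGl n r →ₐ[GF] Module.End GF (Fund n r l ⊗[GF] Fund n r m) :=
  (fundPairRep hn l m).comp (UqGl n r).val

/-- Highest weight vectors for `U_q(gl_n)` of the same weight are proportional. -/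
theorem highest_weight_vectors_proportional (hn : Admissible n r) {μ : Wt n}
    {v w : Fund n r l ⊗[GF] Fund n r m} (hv : v ∈ weightSpace (fundPairRep hn l m) μ)
    (hw : w ∈ weightSpace (fundPairRep hn l m) μ) (hw0 : w ≠ 0)
    (hvE : ∀ i, i ≠ 0 → fundPairRep hn l m (Uq.E r i) v = 0)
    (hwE : ∀ i, i ≠ 0 → fundPairRep hn l m (Uq.E r i) w = 0) : ∃ c : GF, v = c • w := by
  have shape : ∀ u ∈ weightSpace (fundPairRep hn l m) μ, u ≠ 0 →
      (∀ i, i ≠ 0 → fundPairRep hn l m (Uq.E r i) u = 0) → ∃ t : ZMod n → ℕ,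
        μ = (-2, fun i => if IsLow r i then -(t i : ℤ) else t i) ∧
        coef (base n r l) (t - base n r l) (incl n r l m u) ≠ 0 := by
    intro u hu h0 hE
    obtain ⟨t, hμ, hS⟩ := exists_hwShape hn hu h0 hE
    obtain ⟨x, y, hc⟩ := exists_coef_ne_zero h0
    exact ⟨t, hμ, hS.base hn hc⟩
  obtain ⟨t, ht, hct⟩ := shape w hw hw0 hwE
  -- By `HWShape.base` this functional is non-zero on every non-zero highest weight vector of weight
  -- `μ`. The combination of `v` and `w` that it kills must therefore vanish.
  set κ := (coef (base n r l) (t - base n r l)).comp (incl n r l m)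
  refine ⟨κ v / κ w, ?_⟩
  rw [← sub_eq_zero]
  by_contra h0
  obtain ⟨t', ht', hct'⟩ := shape (v - (κ v / κ w) • w)
    (Submodule.sub_mem _ hv (Submodule.smul_mem _ _ hw)) h0
    (fun i hi => by rw [map_sub, map_smul, hvE i hi, hwE i hi, smul_zero, sub_zero])
  have e : t' = t := by
    rw [ht] at ht'
    funext i
    have := congrFun (congrArg Prod.snd ht') i
    dsimp only at this
    split_ifs at this <;> omega
  subst e
  refine hct' ?_
  have : κ (v - (κ v / κ w) • w) = 0 := by
    rw [map_sub, map_smul, smul_eq_mul, div_mul_cancel₀ _ (show κ w ≠ 0 from hct), sub_self]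
  exact this

variable {hn : Admissible n r} {L : Submodule (UqGl n r) (RepMod (fundPairRepGl hn l m))}

theorem IsIrreducibleHW.exists_vector {γ : Wt n} (h : IsIrreducibleHW n r L γ) :
    ∃ v ∈ RepMod.toSubspace L, v ≠ 0 ∧ v ∈ weightSpace (fundPairRep hn l m) γ ∧
      ∀ i, i ≠ 0 → fundPairRep hn l m (Uq.E r i) v = 0 := by
  obtain ⟨-, ⟨v, hv⟩, h0, hK, hE⟩ := h
  change Fund n r l ⊗[GF] Fund n r m at v
  refine ⟨v, hv, fun h => h0 (Subtype.ext h), fun h => ?_, fun i hi =>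
    congrArg Subtype.val (hE i hi)⟩
  have h1 : fundPairRepGl hn l m (UqGl.K r h) v
      = fundPairRepGl hn l m (algebraMap GF _ (q ^ (h γ))) v := congrArg Subtype.val (hK h)
  rwa [AlgHom.commutes, Module.algebraMap_end_apply] at h1

/-- A simple submodule contains a weight vector of maximal height, which is a highest weight vector,
and the shape analysis restricts its weight. -/
theorem exists_isIrreducibleHW (hL : IsSimpleModule (UqGl n r) L) :
    ∃ lam : Fin 2 → ℤ, IsOscPartition n r lam ∧ IsIrreducibleHW n r L (oscWt n r lam) := by
  have := hn.neZero
  have := IsSimpleModule.nontrivial (UqGl n r) L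
  obtain ⟨u, hu⟩ := exists_ne (0 : L)
  obtain ⟨μ, v, hvL, h0, hvμ, hE, -⟩ := exists_highest_weight_vector hn
    (goodWeights_weightSpace hn l m).2.1 (height_nonpos_of_weight hn) (L := RepMod.toSubspace L)
    (fun h v hv => RepMod.rep_mem L (UqGl.K r h) hv)
    (fun i hi v hv => RepMod.rep_mem L (UqGl.E r i hi) hv)
    ⟨u.1, u.2, fun h => hu (Subtype.ext h)⟩
  obtain ⟨t, rfl, hS⟩ := exists_hwShape hn hvμ h0 hE
  obtain ⟨x, y, hc⟩ := exists_coef_ne_zero h0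
  obtain ⟨lam, h1, h2⟩ := hS.exists_oscWt hn hc
  refine ⟨lam, h1, hL, ⟨v, hvL⟩, fun h => h0 (congrArg Subtype.val h), fun h => Subtype.ext ?_,
    fun i hi => Subtype.ext (hE i hi)⟩
  have e : fundPairRepGl hn l m (UqGl.K r h) v
      = fundPairRepGl hn l m (algebraMap GF _ (q ^ (h (oscWt n r lam)))) v := by
    rw [AlgHom.commutes, Module.algebraMap_end_apply, h2]
    exact hvμ h
  exact e

/-- Complete reducibility comes from the same form: the adjoints of elements of `U_q(gl_n)` stay in
`U_q(gl_n)`, and all `q^h` are available for weight decompositions. -/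
theorem isSemisimpleModule_fundPairRepGl (hn : Admissible n r) (l m : ℤ) :
    IsSemisimpleModule (UqGl n r) (RepMod (fundPairRepGl hn l m)) := by
  have := hn.neZero
  obtain ⟨θ, hθ, hB⟩ := fundForm_contravariant hn l m
  have hG := goodWeights_weightSpace hn l m
  have hadj : ∀ a : UqGl n r, ∃ a' : UqGl n r, ∀ u v, fundForm l m (fundPairRepGl hn l m a u) v
      = fundForm l m u (fundPairRepGl hn l m a' v) := fun a => by
    obtain ⟨a', ha', h⟩ := hB.exists_adjoint_gl hθ a.2
    exact ⟨⟨a', ha'⟩, h⟩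
  exact { exists_isCompl := fun N => ⟨_, isCompl_perp hG.2.1 hG.2.2.1 hB.K
    (fun v => fundForm_anisotropic) hadj (fun h => ⟨UqGl.K r h, rfl⟩) N⟩ }

/-- Finiteness comes as multiplicity one: two different summands with the same highest weight would
have proportional highest weight vectors, against their independence. -/
theorem isLevelSum_top (hn : Admissible n r) (l m : ℤ) :
    IsLevelSum 2 (⊤ : Submodule (UqGl n r) (RepMod (fundPairRepGl hn l m))) := by
  have := isSemisimpleModule_fundPairRepGl hn l m
  obtain ⟨S, h1, h2, h3⟩ := IsSemisimpleModule.exists_sSupIndep_sSup_simples_eq_top (UqGl n r)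
    (RepMod (fundPairRepGl hn l m))
  refine ⟨S, h1, h2, fun L hL => exists_isIrreducibleHW (h3 L hL), fun lam _ =>
    Set.Subsingleton.finite ?_⟩
  rintro L ⟨hL, hirr⟩ L' ⟨hL', hirr'⟩
  by_contra hne
  obtain ⟨v, hvL, hv0, hv, hvE⟩ := hirr.exists_vector
  obtain ⟨w, hwL, hw0, hw, hwE⟩ := hirr'.exists_vector
  obtain ⟨c, rfl⟩ := highest_weight_vectors_proportional hn hv hw hw0 hvE hwE
  have hd := h1.pairwiseDisjoint hL hL' hne
  exact hv0 ((Submodule.disjoint_def.mp hd) _ hvL ((RepMod.toSubspace L').smul_mem c hwL))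

theorem isLevelSum_bot {M : Type*} [AddCommGroup M] [Module (UqGl n r) M] (ℓ : ℕ) :
    IsLevelSum ℓ (⊥ : Submodule (UqGl n r) M) :=
  ⟨∅, sSupIndep_empty, sSup_empty, fun _ h => absurd h (Set.notMem_empty _), fun _ _ =>
    Set.finite_empty.subset fun _ h => h.1⟩

theorem inOsc_fundPairRepGl (hn : Admissible n r) (l m : ℤ) : InOsc (fundPairRepGl hn l m) := by
  -- Each tensor factor contributes level one, so the whole module sits at `ℓ = 2` and the bound is
  -- `3`.
  refine ⟨goodWeights_finWeightSpace hn l m, fun ℓ => if ℓ = 2 then ⊤ else ⊥, ?_, ?_,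
    if_neg (by norm_num), fun ℓ _ => ?_, 3, fun ℓ hℓ => if_neg (by omega)⟩
  · intro i
    dsimp only
    split_ifs with h
    · have : (⨆ j, ⨆ _ : j ≠ i, (if j = 2 then ⊤ else ⊥ :
          Submodule (UqGl n r) (RepMod (fundPairRepGl hn l m)))) = ⊥ :=
        le_bot_iff.mp (iSup₂_le fun j hj => by rw [if_neg (h ▸ hj)])
      rw [this]
      exact disjoint_bot_right
    · exact disjoint_bot_left
  · exact top_le_iff.mp (le_iSup_of_le 2 (if_pos rfl).ge)
  · dsimp only
    split_ifs with h
    · subst h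
      exact isLevelSum_top hn l m
    · exact isLevelSum_bot ℓ

end gl

end QOsc

end

theorem theorem4p3 {n r : ℕ} (hn : QOsc.Admissible n r) (l m : ℤ) :
    IsSimpleModule (QOsc.Uq n r)
      (QOsc.RepMod (QOsc.tensorRep hn (QOsc.fundRep hn l 1) (QOsc.fundRep hn m 1))) ∧
    QOsc.InOscHat (QOsc.tensorRep hn (QOsc.fundRep hn l 1) (QOsc.fundRep hn m 1)) :=
  ⟨QOsc.isSimpleModule_fundPairRep hn l m, QOsc.goodWeights_weightSpace hn l m,
    QOsc.inOsc_fundPairRepGl hn l m⟩
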